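/- Let $n\ge 1$, $0<\beta\le 1$, $\alpha:=1+\beta$, and let $\Omega\subset\mathbb{R}^n$ be a bounded open set with $0\in\Omega$. Let $g\in W^{1,2}(\Omega)$, let $\phi:\Omega\to\mathbb{R}$ be of class $C^{1,\beta}$ (with $\nabla\phi$ being $\beta$-Hölder continuous on compact subsets of $\Omega$), $\phi(0)=|\nabla\phi(0)|=0$, and put $K=\{w\in W^{1,2}(\Omega): w-g\in W^{1,2}_0(\Omega),\ w\ge\phi \text{ a.e. in }\Omega\}$. Let $u\in K$ satisfy $\int_\Omega|\nabla u|^2\le\int_\Omega|\nabla w|^2$ for all $w\in K$. Let $R_0>0$ with $B_{R_0}=\{|x|<R_0\}\subset\Omega$, and assume $$\Big(\frac{|x|}{R}\Big)^{\alpha}\phi\Big(R\frac{x}{|x|}\Big)\ge\phi(x)\qquad\text{for all } 0<R<R_0,\ 0<|x|\le R .$$ For $0<R<R_0$ let $$A(R)=\frac{1}{R^{n+2(\alpha-1)}}\int_{B_R}|\nabla u|^2\,dx-\alpha\int_{S^{n-1}}\Big(\frac{u(R\theta)}{R^\alpha}\Big)^2d\theta ,$$ where $\theta\mapsto u(R\theta)$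 is the trace of $u$ on $\partial B_R$, that is, the value at $R$ of the continuous curve in $L^2(S^{n-1})$ that agrees with $r\mapsto u(r\,\cdot)$ for a.e. $r\in(0,R_0)$; these traces exist. Then: (i) $A$ is nondecreasing on $(0,R_0)$ and absolutely continuous on compact subintervals of $(0,R_0)$. (ii) For a.e. $R\in(0,R_0)$, $A$ is differentiable at $R$, the function $\theta\mapsto(\partial_\nu u(R\theta)-\alpha u(R\theta)/R)^2$ is integrable over $S^{n-1}$ (where $\partial_\nu u(R\theta)=\nabla u(R\theta)\cdot\theta$), and $$A'(R)\ \ge\ \frac{1}{R^{1+2(\alpha-1)}}\int_{S^{n-1}}\Big(\partial_\nu u(R\theta)-\alpha\frac{u(R\theta)}{R}\Big)^2d\theta ;$$ moreover $A'(R)=0$ if and only if $u$ is homogeneous of degree $\alpha$ in $B_R$ (i.e. agrees there a.e. with a function $v$ on $\mathbb{R}^n$ such that $v(tx)=t^\alpha v(x)$ for all $t>0$ and all $x$). (iii) For every $0<\rho\le R_0$, $A$ is constant on $(0,\rho)$ if and only if $u$ is homogeneous of degree $\alpha$ in $B_\rho$. (iv) If $u$ is continuously differentiable in $B_{R_0}$,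 then (i)'s monotonicity, (ii) and (iii) hold with the pointwise values of $u$ and $\nabla u$, with "for a.e. $R$" in (ii) replaced by "for every $R\in(0,R_0)$", and with homogeneity understood everywhere in the ball. -/

import Mathlib

open MeasureTheory Set Filter Topology Metric
open scoped ContDiff Gradient

noncomputable section

/-- Euclidean `n`-space. -/
abbrev EucSp (n : ℕ) : Type := EuclideanSpace ℝ (Fin n)

/-- The unit sphere `S^{n-1}`. -/
abbrev USphere (n : ℕ) : Type := sphere (0 : EucSp n) 1

/-- The surface measure of the unit sphere (total mass `n * |B_1|`). -/
def sphereMeasure (n : ℕ) : Measure (USphere n) := (volume : Measure (EucSp n)).toSphere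

/-- `ψ ∈ C_c^∞(Ω)`. -/
structure IsTestFunction {n : ℕ} (Ω : Set (EucSp n)) (ψ : EucSp n → ℝ) : Prop where
  smooth : ContDiff ℝ ∞ ψ
  compact : HasCompactSupport ψ
  support : tsupport ψ ⊆ Ω

/-- `u ∈ W^{1,2}(Ω)` with weak gradient `G`. -/
structure MemW12 {n : ℕ} (Ω : Set (EucSp n)) (u : EucSp n → ℝ) (G : EucSp n → EucSp n) :
    Prop where
  memLp : MemLp u 2 (volume.restrict Ω)
  memLp_grad : MemLp G 2 (volume.restrict Ω)
  weak : ∀ ψ : EucSp n → ℝ, IsTestFunction Ω ψ →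
    ∫ x in Ω, u x • ∇ ψ x = - ∫ x in Ω, ψ x • G x

/-- `v ∈ W^{1,2}_0(Ω)`: the `W^{1,2}`-closure of `C_c^∞(Ω)`. -/
def MemW12Zero {n : ℕ} (Ω : Set (EucSp n)) (v : EucSp n → ℝ) : Prop :=
  ∃ G : EucSp n → EucSp n, MemW12 Ω v G ∧
    ∀ ε : ℝ, 0 < ε → ∃ ψ : EucSp n → ℝ, IsTestFunction Ω ψ ∧
      eLpNorm (fun x => v x - ψ x) 2 (volume.restrict Ω) ≤ ENNReal.ofReal ε ∧
      eLpNorm (fun x => G x - ∇ ψ x) 2 (volume.restrict Ω) ≤ ENNReal.ofReal ε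

/-- `w`, with weak gradient `H`, belongs to the admissible class
`K = {w : w - g ∈ W^{1,2}_0(Ω), w ≥ φ a.e.}`. -/
structure IsAdmissible {n : ℕ} (Ω : Set (EucSp n)) (g φ w : EucSp n → ℝ)
    (H : EucSp n → EucSp n) : Prop where
  memW12 : MemW12 Ω w H
  boundary : MemW12Zero Ω (fun x => w x - g x)
  above : ∀ᵐ x ∂(volume.restrict Ω), φ x ≤ w x

/-- `u`, with weak gradient `G`, solves the obstacle problem: it belongs to `K` and has least
Dirichlet energy in `K`. -/
structure IsObstacleMinimizer {n : ℕ} (Ω : Set (EucSp n)) (g φ u : EucSp n → ℝ)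
    (G : EucSp n → EucSp n) : Prop where
  admissible : IsAdmissible Ω g φ u G
  minimal : ∀ (w : EucSp n → ℝ) (H : EucSp n → EucSp n), IsAdmissible Ω g φ w H →
    ∫ x in Ω, ‖G x‖ ^ 2 ≤ ∫ x in Ω, ‖H x‖ ^ 2

/-- `φ ∈ C^{1,β}(Ω)`: differentiable in `Ω`, with gradient Hölder continuous of exponent `β` on
compact subsets of `Ω`. -/
def IsC1Holder {n : ℕ} (β : ℝ) (Ω : Set (EucSp n)) (φ : EucSp n → ℝ) : Prop :=
  (∀ x ∈ Ω, DifferentiableAt ℝ φ x) ∧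
    ∀ K : Set (EucSp n), IsCompact K → K ⊆ Ω → ∃ C : ℝ, ∀ x ∈ K, ∀ y ∈ K,
      ‖∇ φ x - ∇ φ y‖ ≤ C * ‖x - y‖ ^ β

/-- `T R`, for `0 < R < R₀`, is the trace `θ ↦ u (R θ)` on the unit sphere of `u` on the sphere of
radius `R`: the curve `R ↦ T R` in `L²(S^{n-1})` is continuous, and `T R` is the
restriction of `u` for almost every `R`. These conditions determine each `T R` up to null sets. -/
structure IsSphereTrace {n : ℕ} (R₀ : ℝ) (u : EucSp n → ℝ) (T : ℝ → USphere n → ℝ) : Prop where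
  memLp : ∀ R ∈ Ioo 0 R₀, MemLp (T R) 2 (sphereMeasure n)
  ae_eq : ∀ᵐ R ∂(volume.restrict (Ioo 0 R₀)), ∀ᵐ θ ∂(sphereMeasure n),
    T R θ = u (R • (θ : EucSp n))
  cont : ∀ R ∈ Ioo 0 R₀,
    Tendsto (fun r => eLpNorm (fun θ => T r θ - T R θ) 2 (sphereMeasure n)) (𝓝 R) (𝓝 0)

/-- The pointwise restrictions `θ ↦ u (R θ)`. -/
def sphereRestrict {n : ℕ} (u : EucSp n → ℝ) (R : ℝ) (θ : USphere n) : ℝ :=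
  u (R • (θ : EucSp n))

/-- The Weiss-type energy
`A(R) = R^{-(n+2(α-1))} ∫_{B_R} |G|² - α ∫_{S^{n-1}} (T_R / R^α)²`, where `G` is the gradient of
the function and `T_R` is its trace on the sphere of radius `R`. -/
def weissA {n : ℕ} (α : ℝ) (G : EucSp n → EucSp n) (T : ℝ → USphere n → ℝ) (R : ℝ) : ℝ :=
  R ^ (-((n : ℝ) + 2 * (α - 1))) * (∫ x in ball (0 : EucSp n) R, ‖G x‖ ^ 2)
    - α * ∫ θ, (T R θ / R ^ α) ^ 2 ∂(sphereMeasure n)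

/-- The integrand `(∂_ν u - α u / R)²` on the sphere of radius `R`, as a function of
`θ ∈ S^{n-1}`. -/
def radialDefect {n : ℕ} (α : ℝ) (G : EucSp n → EucSp n) (T : ℝ → USphere n → ℝ) (R : ℝ)
    (θ : USphere n) : ℝ :=
  (inner ℝ (G (R • (θ : EucSp n))) (θ : EucSp n) - α * T R θ / R) ^ 2

/-- `v` is positively homogeneous of degree `α`. -/
def IsPosHomogeneous {n : ℕ} (α : ℝ) (v : EucSp n → ℝ) : Prop :=
  ∀ (t : ℝ) (x : EucSp n), 0 < t → v (t • x) = t ^ α * v x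

/-- `u` coincides almost everywhere in `B_ρ` with a homogeneous function of degree `α`. -/
def IsAEHomogeneousOnBall {n : ℕ} (α ρ : ℝ) (u : EucSp n → ℝ) : Prop :=
  ∃ v : EucSp n → ℝ, IsPosHomogeneous α v ∧ ∀ᵐ x ∂(volume.restrict (ball (0 : EucSp n) ρ)), u x = v x

/-- `u` coincides everywhere in `B_ρ` with a homogeneous function of degree `α`. -/
def IsHomogeneousOnBall {n : ℕ} (α ρ : ℝ) (u : EucSp n → ℝ) : Prop :=
  ∃ v : EucSp n → ℝ, IsPosHomogeneous α v ∧ EqOn u v (ball (0 : EucSp n) ρ)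

end

/-! Let `h` be the homogeneous replacement of `u` in `B_R`, that is `(|x|/R)^α u(R x/|x|)`: it has
degree `α` and the boundary values of `u` on `∂B_R`. Its gradient splits orthogonally into a radial
part, which sees only the values of `u` on the sphere, and the tangential part of `∇u` there, both
scaled by `(|x|/R)^(α-1)`. Hence `∫_{B_R} |∇h|²` is an explicit combination of integrals over the
sphere (`integral_norm_homGrad_sq`). Write `D(R) = ∫_{B_R} |∇u|²` and `H(R) = ∫ u(Rθ)² dθ`. With `D'
= R^(n-1) ∫ |∇u(Rθ)|²` and `H' = 2 ∫ u ∂_ν u`, differentiating `A` gives the exact identity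
`hasDerivAt_weissA`: `A'(R) = (n+2(α-1)) R^(-(n+2(α-1))-1) (∫_{B_R} |∇h|² - ∫_{B_R} |∇u|²) +
R^(-(1+2(α-1))) ∫ (∂_ν u - α u/R)²`.

The condition on `φ` says that `φ` lies below its own homogeneous replacement. So `h ≥ φ`, and `h`,
continued by `u` outside `B_R`, is admissible; minimality makes the first term nonnegative.

If `A'(R) = 0`, the two energies agree. Strict convexity, used through the competitor `(u+h)/2`,
gives `∇h = ∇u`, and `h - u`, compactly supported with zero gradient, vanishes. Conversely, if `u`
is homogeneous in `B_R`, it is its own replacement there and satisfies Euler's relation, so both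
terms vanish at almost every smaller radius. By absolute continuity `A` is constant on `(0,R)`, and
its derivative at `R`, where it exists, is read off from the left.

The analytic work is to justify this for Sobolev `u`. For `C¹` functions `h - u` is Lipschitz and
vanishes on the sphere, so its extension by zero is in `W^{1,2}_0` (`w0Pair_repl_of_contDiffOn`). In
general `u` is mollified; by Fubini in polar coordinates a subsequence converges with its gradients
in `L²` of almost every sphere, and the conclusion passes to the limit (`ae_w0Pair_repl`). The same
approximation yields the fundamental theorem of calculus along rays for `u` and `u²`
(`sphere_identities`). This produces the traces (`exists_isSphereTrace`) and shows that `H` is a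
primitive (`IsSphereTrace.integral_sq_sub`); `D` is one by polar coordinates. Lebesgue
differentiation then gives almost every radius. For `C¹` minimizers every ingredient is available at
each radius, so no exceptional set remains. -/

noncomputable section

/-! ### Polar coordinates -/

/-- The measure `r ^ (n - 1) dr` on `(0, ∞)`. -/
def radialMeasure (n : ℕ) : Measure ℝ :=
  (volume.restrict (Ioi 0)).withDensity fun r => ENNReal.ofReal (r ^ (n - 1))

instance (n : ℕ) : IsFiniteMeasure (sphereMeasure n) := by
  unfold sphereMeasure; infer_instance

instance (n : ℕ) : SFinite (radialMeasure n) := by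
  unfold radialMeasure; infer_instance

instance (n : ℕ) [NeZero n] : Nontrivial (EucSp n) := by
  have : Nonempty (Fin n) := ⟨0⟩
  infer_instance

instance (n : ℕ) [NeZero n] : Nonempty (USphere n) :=
  (NormedSpace.sphere_nonempty.mpr zero_le_one).to_subtype

/-- The density is positive on the half-line, so the weighted and the Lebesgue measure have the same
null sets. Fubini for the weighted measure therefore yields statements for Lebesgue-almost every
radius. -/
theorem ae_radialMeasure_iff {n : ℕ} {P : ℝ → Prop} :
    (∀ᵐ r ∂radialMeasure n, P r) ↔ ∀ᵐ r ∂volume.restrict (Ioi (0 : ℝ)), P r := by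
  unfold radialMeasure
  rw [ae_withDensity_iff (by fun_prop)]
  refine eventually_congr ?_
  filter_upwards [ae_restrict_mem measurableSet_Ioi] with r hr
  have : ENNReal.ofReal (r ^ (n - 1)) ≠ 0 := by
    simpa using pow_pos hr (n - 1)
  simp [this]

/-- `(r, θ) ↦ r θ`. -/
def polarMap {n : ℕ} (p : ℝ × USphere n) : EucSp n := p.1 • (p.2 : EucSp n)

theorem continuous_polarMap {n : ℕ} : Continuous (polarMap (n := n)) := by
  unfold polarMap; fun_prop

theorem measurePreserving_coe_volumeIoiPow (n : ℕ) :
    MeasurePreserving ((↑) : Ioi (0 : ℝ) → ℝ) (Measure.volumeIoiPow (n - 1))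
      (radialMeasure n) := by
  refine ⟨measurable_subtype_coe, ?_⟩
  ext s hs
  rw [Measure.map_apply measurable_subtype_coe hs, Measure.volumeIoiPow,
    withDensity_apply _ (measurable_subtype_coe hs), radialMeasure, withDensity_apply _ hs]
  rw [setLIntegral_subtype measurableSet_Ioi _ fun a : ℝ ↦ .ofReal (a ^ (n - 1)),
    Measure.restrict_restrict hs, Subtype.image_preimage_coe, inter_comm]

/-- The homeomorphism of the punctured space with sphere times half-line is inverted, the two
factors are swapped, and the removed origin is a null set. -/
theorem measurePreserving_polarMap (n : ℕ) [NeZero n] :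
    MeasurePreserving (polarMap (n := n)) ((radialMeasure n).prod (sphereMeasure n)) volume := by
  have h1 := ((volume : Measure (EucSp n)).measurePreserving_homeomorphUnitSphereProd)
  rw [finrank_euclideanSpace_fin] at h1
  have h2 := MeasurePreserving.symm
    (e := (homeomorphUnitSphereProd (EucSp n)).toMeasurableEquiv) h1
  have h3 : MeasurePreserving ((↑) : ({0}ᶜ : Set (EucSp n)) → EucSp n)
      ((volume : Measure (EucSp n)).comap (↑)) volume := by
    refine ⟨measurable_subtype_coe, ?_⟩
    rw [map_comap_subtype_coe (measurableSet_singleton _).compl, restrict_compl_singleton]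
  have h4 := h3.comp h2
  have h5 : MeasurePreserving (Prod.map id ((↑) : Ioi (0 : ℝ) → ℝ))
      ((volume : Measure (EucSp n)).toSphere.prod (Measure.volumeIoiPow (n - 1)))
      ((volume : Measure (EucSp n)).toSphere.prod (radialMeasure n)) :=
    (MeasurePreserving.id _).prod (measurePreserving_coe_volumeIoiPow n)
  have h6 : MeasurePreserving Prod.swap 
      ((volume : Measure (EucSp n)).toSphere.prod (radialMeasure n))
      ((radialMeasure n).prod (sphereMeasure n)) := Measure.measurePreserving_swap
  have h7 := h6.comp h5
  refine ⟨continuous_polarMap.measurable, ?_⟩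
  rw [← h7.map_eq, Measure.map_map continuous_polarMap.measurable h7.measurable]
  exact h4.map_eq

/-- The direction `x / ‖x‖` of `x` (with an arbitrary value at `0`). -/
def direction {n : ℕ} [NeZero n] (x : EucSp n) : USphere n :=
  if h : x = 0 then Classical.arbitrary _ else ⟨‖x‖⁻¹ • x, by simp [norm_smul, h]⟩

theorem coe_direction {n : ℕ} [NeZero n] {x : EucSp n} (h : x ≠ 0) :
    (direction x : EucSp n) = ‖x‖⁻¹ • x := by simp [direction, h]

theorem norm_smul_direction {n : ℕ} [NeZero n] (x : EucSp n) :
    ‖x‖ • (direction x : EucSp n) = x := by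
  by_cases h : x = 0
  · simp [h]
  · rw [coe_direction h, smul_smul, mul_inv_cancel₀ (by simpa using h), one_smul]

@[simp] theorem norm_usphere {n : ℕ} (θ : USphere n) : ‖(θ : EucSp n)‖ = 1 := by simp

theorem norm_polarMap {n : ℕ} {r : ℝ} (hr : 0 ≤ r) (θ : USphere n) :
    ‖polarMap (r, θ)‖ = r := by
  simp [polarMap, norm_smul, abs_of_nonneg hr]

theorem norm_smul_usphere {n : ℕ} {r : ℝ} (hr : 0 ≤ r) (θ : USphere n) :
    ‖r • (θ : EucSp n)‖ = r := norm_polarMap hr θ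

theorem direction_smul {n : ℕ} [NeZero n] {r : ℝ} (hr : 0 < r) (θ : USphere n) :
    direction (r • (θ : EucSp n)) = θ := by
  have : r • (θ : EucSp n) ≠ 0 := by
    rw [← norm_pos_iff, norm_smul_usphere hr.le]; exact hr
  ext1
  rw [coe_direction this, norm_smul_usphere hr.le, smul_smul, inv_mul_cancel₀ hr.ne', one_smul]

theorem measurable_direction {n : ℕ} [NeZero n] : Measurable (direction (n := n)) := by
  rw [← (MeasurableEmbedding.subtype_coe isClosed_sphere.measurableSet).measurable_comp_iff]
  have : ((↑) : USphere n → EucSp n) ∘ direction = fun x =>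
      if x = 0 then ((direction (0 : EucSp n) : USphere n) : EucSp n) else ‖x‖⁻¹ • x := by
    ext1 x
    split_ifs with h
    · simp [h]
    · simp [coe_direction h]
  rw [this]
  exact Measurable.ite (measurableSet_singleton _) measurable_const (by fun_prop)

/-- The cone over a null set of the sphere is, in polar coordinates, a product with a null factor.
This carries statements that hold almost everywhere on one sphere over to homogeneous extensions
into the ball. -/
theorem quasiMeasurePreserving_direction (n : ℕ) [NeZero n] :
    Measure.QuasiMeasurePreserving (direction (n := n)) volume (sphereMeasure n) := by
  refine ⟨measurable_direction, ?_⟩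
  intro s hs
  obtain ⟨t, hst, ht, hts⟩ := exists_measurable_superset_of_null hs
  refine measure_mono_null hst ?_
  rw [← (measurePreserving_polarMap n).map_eq,
    Measure.map_map measurable_direction continuous_polarMap.measurable,
    measure_eq_zero_iff_ae_notMem]
  refine (ae_map_iff (measurable_direction.comp continuous_polarMap.measurable).aemeasurable
    ht.compl).mpr ?_
  have h0 : ∀ᵐ p ∂((radialMeasure n).prod (sphereMeasure n)), p.2 ∉ t :=
    Measure.quasiMeasurePreserving_snd.ae (p := fun θ => θ ∉ t) (measure_eq_zero_iff_ae_notMem.mp hts)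
  have h1 : ∀ᵐ p ∂((radialMeasure n).prod (sphereMeasure n)), 0 < p.1 :=
    Measure.quasiMeasurePreserving_fst.ae (p := fun r : ℝ => 0 < r)
      (ae_radialMeasure_iff.mpr (ae_restrict_mem measurableSet_Ioi))
  filter_upwards [h0, h1] with p hp hp1
  rw [Function.comp_apply, polarMap, direction_smul hp1]
  exact hp

theorem ae_polar {n : ℕ} [NeZero n] {P : EucSp n → Prop} (h : ∀ᵐ x, P x) :
    ∀ᵐ r ∂volume.restrict (Ioi (0 : ℝ)), ∀ᵐ θ : USphere n ∂sphereMeasure n, P (r • (θ : EucSp n)) := by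
  rw [← ae_radialMeasure_iff (n := n)]
  exact Measure.ae_ae_of_ae_prod ((measurePreserving_polarMap n).quasiMeasurePreserving.ae h)

theorem ae_polar_ball {n : ℕ} [NeZero n] {P : EucSp n → Prop} {R : ℝ}
    (h : ∀ᵐ x ∂volume.restrict (ball (0 : EucSp n) R), P x) :
    ∀ᵐ r ∂volume.restrict (Ioo (0 : ℝ) R), ∀ᵐ θ : USphere n ∂sphereMeasure n, P (r • (θ : EucSp n)) := by
  rw [ae_restrict_iff' measurableSet_ball] at h
  have := ae_polar h
  rw [ae_restrict_iff' measurableSet_Ioi] at this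
  rw [ae_restrict_iff' measurableSet_Ioo]
  filter_upwards [this] with r hr hr'
  filter_upwards [hr hr'.1] with θ hθ
  exact hθ (by rw [mem_ball_zero_iff, norm_smul_usphere hr'.1.le]; exact hr'.2)

theorem ae_direction {n : ℕ} [NeZero n] {P : USphere n → Prop}
    (h : ∀ᵐ θ ∂sphereMeasure n, P θ) : ∀ᵐ x : EucSp n, P (direction x) :=
  (quasiMeasurePreserving_direction n).ae h

theorem ae_ne_zero (n : ℕ) [NeZero n] : ∀ᵐ x : EucSp n, x ≠ 0 := by
  simp [ae_iff]

theorem restrict_Ioo_radialMeasure {n : ℕ} (R : ℝ) :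
    (radialMeasure n).restrict (Ioo 0 R) =
      (volume.restrict (Ioo 0 R)).withDensity fun r => ENNReal.ofReal (r ^ (n - 1)) := by
  rw [radialMeasure, restrict_withDensity measurableSet_Ioo,
    Measure.restrict_restrict measurableSet_Ioo]
  congr 2
  ext x; simp +contextual

theorem ae_ofReal_pow_ne_zero (n : ℕ) (R : ℝ) :
    ∀ᵐ r ∂volume.restrict (Ioo (0 : ℝ) R), ENNReal.ofReal (r ^ (n - 1)) ≠ 0 := by
  filter_upwards [ae_restrict_mem measurableSet_Ioo] with r hr
  simpa using pow_pos hr.1 (n - 1)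

/-- Polar coordinates on a ball centred at the origin. -/
theorem measurePreserving_polarMap_ball (n : ℕ) [NeZero n] (R : ℝ) :
    MeasurePreserving (polarMap (n := n))
      (((radialMeasure n).restrict (Ioo 0 R)).prod (sphereMeasure n))
      (volume.restrict (ball 0 R)) := by
  have h := (measurePreserving_polarMap n).restrict_preimage (measurableSet_ball (x := 0) (ε := R))
  convert h using 1
  have : (sphereMeasure n) = (sphereMeasure n).restrict univ := by simp
  rw [this, Measure.prod_restrict, ← this]
  -- A negative first coordinate can also be mapped into the ball, so the two sets agree only up to
  -- the null set of nonpositive radii.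
  refine Measure.restrict_congr_set ?_
  have h1 : ∀ᵐ p ∂((radialMeasure n).prod (sphereMeasure n)), 0 < p.1 :=
    Measure.quasiMeasurePreserving_fst.ae (p := fun r : ℝ => 0 < r)
      (ae_radialMeasure_iff.mpr (ae_restrict_mem measurableSet_Ioi))
  filter_upwards [h1] with p hp
  refine propext ?_
  change p ∈ (Ioo 0 R ×ˢ univ) ↔ p ∈ polarMap ⁻¹' ball 0 R
  simp [polarMap, norm_smul, abs_of_pos hp, hp]

theorem lintegral_polar_ball {n : ℕ} [NeZero n] {f : EucSp n → ENNReal} {R : ℝ}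
    (hf : AEMeasurable f (volume.restrict (ball 0 R))) :
    ∫⁻ x in ball 0 R, f x =
      ∫⁻ r in Ioo 0 R, ENNReal.ofReal (r ^ (n - 1)) *
        ∫⁻ θ, f (r • (θ : EucSp n)) ∂sphereMeasure n := by
  have h := measurePreserving_polarMap_ball n R
  have hf' : AEMeasurable (fun p => f (polarMap p))
      (((radialMeasure n).restrict (Ioo 0 R)).prod (sphereMeasure n)) :=
    (h.map_eq.symm ▸ hf : AEMeasurable f _).comp_aemeasurable h.aemeasurable
  rw [← h.map_eq, lintegral_map' (by rwa [h.map_eq]) h.aemeasurable, lintegral_prod _ hf',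
    restrict_Ioo_radialMeasure, lintegral_withDensity_eq_lintegral_mul₀]
  · rfl
  · fun_prop
  · rw [restrict_Ioo_radialMeasure] at hf'
    have := hf'.lintegral_prod_right'
    exact this.mono_ac (withDensity_absolutelyContinuous' (by fun_prop) (ae_ofReal_pow_ne_zero n R))

theorem ae_restrict_radialMeasure_iff {n : ℕ} {R : ℝ} {P : ℝ → Prop} :
    (∀ᵐ r ∂(radialMeasure n).restrict (Ioo 0 R), P r) ↔
      ∀ᵐ r ∂volume.restrict (Ioo (0 : ℝ) R), P r := by
  rw [restrict_Ioo_radialMeasure, ae_withDensity_iff (by fun_prop)]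
  refine eventually_congr ?_
  filter_upwards [ae_ofReal_pow_ne_zero n R] with r hr
  simp [hr]

theorem integrable_radial_iff {n : ℕ} {R : ℝ} {f : ℝ → ℝ} :
    Integrable f ((radialMeasure n).restrict (Ioo 0 R)) ↔
      IntegrableOn (fun r => r ^ (n - 1) * f r) (Ioo 0 R) := by
  rw [restrict_Ioo_radialMeasure, integrable_withDensity_iff_integrable_smul' (by fun_prop)
    (by simp), IntegrableOn]
  refine integrable_congr ?_
  filter_upwards [ae_restrict_mem measurableSet_Ioo] with r hr
  rw [ENNReal.toReal_ofReal (pow_nonneg hr.1.le _), smul_eq_mul]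

theorem ae_fst_mem_Ioo (n : ℕ) (R : ℝ) :
    ∀ᵐ p ∂(((radialMeasure n).restrict (Ioo 0 R)).prod (sphereMeasure n)), p.1 ∈ Ioo 0 R :=
  Measure.quasiMeasurePreserving_fst.ae (p := fun r : ℝ => r ∈ Ioo 0 R)
    (ae_restrict_mem measurableSet_Ioo)

theorem integral_radial {n : ℕ} {R : ℝ} (f : ℝ → ℝ) :
    ∫ r in Ioo 0 R, f r ∂radialMeasure n = ∫ r in Ioo 0 R, r ^ (n - 1) * f r := by
  rw [restrict_Ioo_radialMeasure, integral_withDensity_eq_integral_toReal_smul (by fun_prop)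
    (by simp)]
  refine setIntegral_congr_fun measurableSet_Ioo fun r hr => ?_
  rw [ENNReal.toReal_ofReal (pow_nonneg hr.1.le _), smul_eq_mul]

theorem integrable_polar_ball {n : ℕ} [NeZero n] {f : EucSp n → ℝ} {R : ℝ}
    (hf : IntegrableOn f (ball 0 R)) :
    IntegrableOn (fun r => r ^ (n - 1) * ∫ θ, f (r • (θ : EucSp n)) ∂sphereMeasure n) (Ioo 0 R) ∧
    (∀ᵐ r ∂volume.restrict (Ioo 0 R),
      Integrable (fun θ : USphere n => f (r • (θ : EucSp n))) (sphereMeasure n)) ∧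
    ∫ x in ball 0 R, f x =
      ∫ r in Ioo 0 R, r ^ (n - 1) * ∫ θ, f (r • (θ : EucSp n)) ∂sphereMeasure n := by
  have h := measurePreserving_polarMap_ball n R
  have hf' : Integrable (fun p => f (polarMap p))
      (((radialMeasure n).restrict (Ioo 0 R)).prod (sphereMeasure n)) :=
    h.integrable_comp_of_integrable hf
  refine ⟨integrable_radial_iff.mp hf'.integral_prod_left,
    ae_restrict_radialMeasure_iff.mp hf'.prod_right_ae, ?_⟩
  have hf2 : IntegrableOn f (ball 0 R) := hf
  rw [IntegrableOn, ← h.map_eq] at hf2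
  rw [← integral_radial, ← h.map_eq, integral_map h.aemeasurable hf2.aestronglyMeasurable,
    integral_prod _ hf']
  rfl

/-- The integral over a ball of a product of a radial function and a function of the direction. -/
theorem integral_ball_radial_mul {n : ℕ} [NeZero n] (R : ℝ) (a : ℝ → ℝ) (b : USphere n → ℝ)
    (ha : Measurable a) (hb : AEStronglyMeasurable b (sphereMeasure n)) :
    ∫ x in ball (0 : EucSp n) R, a ‖x‖ * b (direction x) =
      (∫ r in Ioo 0 R, r ^ (n - 1) * a r) * ∫ θ, b θ ∂sphereMeasure n := by
  have h := measurePreserving_polarMap_ball n R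
  have hm : AEStronglyMeasurable (fun x : EucSp n => a ‖x‖ * b (direction x)) :=
    (ha.comp measurable_norm).aestronglyMeasurable.mul
      (hb.comp_quasiMeasurePreserving (quasiMeasurePreserving_direction n))
  rw [← integral_radial, ← integral_prod_mul, ← h.map_eq, integral_map h.aemeasurable
    (by rw [h.map_eq]; exact hm.restrict)]
  refine integral_congr_ae ?_
  filter_upwards [ae_fst_mem_Ioo n R] with p hp
  rw [norm_polarMap hp.1.le, polarMap, direction_smul hp.1]

/-! ### Convergence in `L²` -/

theorem eLpNorm_two_sq {α E : Type*} [MeasurableSpace α] {μ : Measure α} [NormedAddCommGroup E]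
    (f : α → E) : eLpNorm f 2 μ ^ 2 = ∫⁻ x, ‖f x‖ₑ ^ 2 ∂μ := by
  have := eLpNorm_nnreal_pow_eq_lintegral (μ := μ) (f := f) (p := 2) (by norm_num)
  simp only [NNReal.coe_ofNat, ENNReal.coe_ofNat, ENNReal.rpow_ofNat] at this
  exact this

theorem tendsto_eLpNorm_two_iff {α E ι : Type*} [MeasurableSpace α] {μ : Measure α}
    [NormedAddCommGroup E] {f : ι → α → E} {l : Filter ι} :
    Tendsto (fun i => eLpNorm (f i) 2 μ) l (𝓝 0) ↔
      Tendsto (fun i => ∫⁻ x, ‖f i x‖ₑ ^ 2 ∂μ) l (𝓝 0) := by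
  simp_rw [← eLpNorm_two_sq]
  constructor
  · intro h
    simpa using ENNReal.Tendsto.pow (n := 2) h
  · intro h
    have h' := (ENNReal.continuous_rpow_const (y := (1 / 2 : ℝ))).tendsto 0 |>.comp h
    simp only [ENNReal.zero_rpow_of_pos (by norm_num : (0 : ℝ) < 1 / 2)] at h'
    refine h'.congr fun i => ?_
    simp only [Function.comp]
    rw [← ENNReal.rpow_natCast, ← ENNReal.rpow_mul]
    norm_num

/-- Cauchy–Schwarz against the constant `1`. It serves for the probability measure of the mollifier
and for a segment of a ray. -/
theorem sq_lintegral_le {α : Type*} [MeasurableSpace α] {μ : Measure α} {f : α → ENNReal}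
    (hf : AEMeasurable f μ) : (∫⁻ x, f x ∂μ) ^ 2 ≤ μ univ * ∫⁻ x, f x ^ 2 ∂μ := by
  have h := ENNReal.lintegral_mul_le_Lp_mul_Lq μ (Real.HolderConjugate.two_two)
    hf (aemeasurable_const (b := (1 : ENNReal)))
  simp only [Pi.mul_apply, mul_one, ENNReal.one_rpow, lintegral_const, one_mul] at h
  calc (∫⁻ x, f x ∂μ) ^ 2
      ≤ ((∫⁻ x, f x ^ (2 : ℝ) ∂μ) ^ (1 / 2 : ℝ) * μ univ ^ (1 / 2 : ℝ)) ^ 2 := by gcongr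
    _ = μ univ * ∫⁻ x, f x ^ 2 ∂μ := by
        rw [← ENNReal.mul_rpow_of_nonneg _ _ (by norm_num : (0 : ℝ) ≤ 1 / 2),
          ← ENNReal.rpow_natCast, ← ENNReal.rpow_mul]
        norm_num [mul_comm]

/-! ### Mollification -/

/-- The bump function of radius `1 / (k + 1)` used for mollification. -/
def mollBump (n k : ℕ) : ContDiffBump (0 : EucSp n) where
  rIn := (1 / 2) * (1 / ((k : ℝ) + 1))
  rOut := 1 / ((k : ℝ) + 1)
  rIn_pos := by positivity
  rIn_lt_rOut := by
    have : 0 < 1 / ((k : ℝ) + 1) := by positivity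
    linarith

theorem mollBump_rOut (n k : ℕ) : (mollBump n k).rOut = 1 / ((k : ℝ) + 1) := rfl

theorem tendsto_mollBump_rOut (n : ℕ) :
    Tendsto (fun k => (mollBump n k).rOut) atTop (𝓝 0) :=
  tendsto_one_div_add_atTop_nhds_zero_nat

/-- The mollification of `f` at scale `1 / (k + 1)`. -/
def mollify {n : ℕ} {E : Type*} [NormedAddCommGroup E] [NormedSpace ℝ E] (k : ℕ)
    (f : EucSp n → E) : EucSp n → E :=
  MeasureTheory.convolution ((mollBump n k).normed volume) f (ContinuousLinearMap.lsmul ℝ ℝ) volume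

section

variable {n : ℕ} {E : Type*} [NormedAddCommGroup E] [NormedSpace ℝ E]

theorem mollify_apply (k : ℕ) (f : EucSp n → E) (x : EucSp n) :
    mollify k f x = ∫ t, (mollBump n k).normed volume t • f (x - t) := by
  simp [mollify, convolution_def]

theorem mollify_convolutionExists (k : ℕ) {f : EucSp n → E} (hf : LocallyIntegrable f) :
    ConvolutionExists ((mollBump n k).normed volume) f (ContinuousLinearMap.lsmul ℝ ℝ) volume :=
  (mollBump n k).hasCompactSupport_normed.convolutionExists_left _
    (mollBump n k).continuous_normed hf

theorem mollify_sub (k : ℕ) {f g : EucSp n → E} (hf : LocallyIntegrable f)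
    (hg : LocallyIntegrable g) : mollify k (f - g) = mollify k f - mollify k g := by
  ext1 x
  rw [Pi.sub_apply, mollify_apply, mollify, mollify, convolution_def, convolution_def,
    ← integral_sub (mollify_convolutionExists k hf x) (mollify_convolutionExists k hg x)]
  simp [smul_sub]

theorem contDiff_mollify [CompleteSpace E] (k : ℕ) {f : EucSp n → E} (hf : LocallyIntegrable f) :
    ContDiff ℝ ∞ (mollify k f) :=
  (mollBump n k).hasCompactSupport_normed.contDiff_convolution_left _
    (mollBump n k).contDiff_normed hf

theorem lintegral_mollBump (n k : ℕ) :
    ∫⁻ t, ENNReal.ofReal ((mollBump n k).normed volume t) = 1 := by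
  rw [← ofReal_integral_eq_lintegral_ofReal (mollBump n k).integrable_normed
    (.of_forall (mollBump n k).nonneg_normed), (mollBump n k).integral_normed, ENNReal.ofReal_one]

/-- The mollifier is a probability density: the square of an average is at most the average of the
squares, and Tonelli with translation invariance does the rest. -/
theorem eLpNorm_mollify_le (k : ℕ) {f : EucSp n → E} (hf : AEStronglyMeasurable f) :
    eLpNorm (mollify k f) 2 volume ≤ eLpNorm f 2 volume := by
  rw [← ENNReal.pow_le_pow_left_iff (n := 2) two_ne_zero, eLpNorm_two_sq, eLpNorm_two_sq]
  set ρ : EucSp n → ENNReal := fun t => ENNReal.ofReal ((mollBump n k).normed volume t)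
  have hρ : Measurable ρ :=
    ((mollBump n k).continuous_normed (μ := volume)).measurable.ennreal_ofReal
  have hν : (volume.withDensity ρ) univ = 1 := by
    rw [withDensity_apply _ MeasurableSet.univ, Measure.restrict_univ, lintegral_mollBump]
  have hfm (x : EucSp n) : AEStronglyMeasurable (fun t => f (x - t)) :=
    hf.comp_quasiMeasurePreserving (quasiMeasurePreserving_sub_left volume x)
  have h1 (x : EucSp n) : ‖mollify k f x‖ₑ ^ 2 ≤ ∫⁻ t, ρ t * ‖f (x - t)‖ₑ ^ 2 := by
    have h2 : ‖mollify k f x‖ₑ ≤ ∫⁻ t, ‖f (x - t)‖ₑ ∂(volume.withDensity ρ) := by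
      rw [mollify_apply, lintegral_withDensity_eq_lintegral_mul₀ hρ.aemeasurable (hfm x).enorm]
      refine (enorm_integral_le_lintegral_enorm _).trans (lintegral_mono fun t => ?_)
      simp only [Pi.mul_apply, ρ]
      rw [enorm_smul, Real.enorm_of_nonneg ((mollBump n k).nonneg_normed t)]
    refine (pow_le_pow_left' h2 2).trans ((sq_lintegral_le ?_).trans ?_)
    · exact (hfm x).enorm.mono_ac (withDensity_absolutelyContinuous _ _)
    · rw [hν, one_mul, lintegral_withDensity_eq_lintegral_mul₀ hρ.aemeasurable
        ((hfm x).enorm.pow_const 2)]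
      rfl
  refine (lintegral_mono h1).trans ?_
  rw [lintegral_lintegral_swap]
  · have h3 (t : EucSp n) : ∫⁻ x, ρ t * ‖f (x - t)‖ₑ ^ 2 = ρ t * ∫⁻ x, ‖f x‖ₑ ^ 2 := by
      rw [lintegral_const_mul' _ _ (by simp [ρ]),
        lintegral_sub_right_eq_self (fun x => ‖f x‖ₑ ^ 2) t]
    simp_rw [h3]
    rw [lintegral_mul_const _ hρ, lintegral_mollBump, one_mul]
  · refine (hρ.comp measurable_snd).aemeasurable.mul (AEMeasurable.pow_const ?_ 2)
    exact (hf.comp_quasiMeasurePreserving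
      (quasiMeasurePreserving_sub volume volume)).enorm

theorem mollify_eq_self_of_const (k : ℕ) [CompleteSpace E] {f : EucSp n → E} {x : EucSp n}
    (h : ∀ y ∈ ball x (mollBump n k).rOut, f y = f x) : mollify k f x = f x :=
  (mollBump n k).normed_convolution_eq_right h

/-- Uniform continuity gives uniform convergence. All the differences vanish outside one compact
set, the `1`-thickening of the support, so uniform convergence implies convergence in `L²`. -/
theorem tendsto_mollify_of_continuous [CompleteSpace E] {f : EucSp n → E} (hf : Continuous f)
    (hc : HasCompactSupport f) :
    Tendsto (fun k => eLpNorm (mollify k f - f) 2 volume) atTop (𝓝 0) := by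
  set K := cthickening 1 (tsupport f)
  have hK : IsCompact K := IsCompact.cthickening hc
  have hout : ∀ k, ∀ x ∉ K, (mollify k f - f) x = 0 := by
    intro k x hx
    rw [Pi.sub_apply, sub_eq_zero]
    have hz : ∀ y ∈ ball x (mollBump n k).rOut, f y = 0 := by
      intro y hy
      by_contra hne
      refine hx (mem_cthickening_of_dist_le x y 1 _ (subset_tsupport f hne) ?_)
      rw [mem_ball, mollBump_rOut, dist_comm] at hy
      refine hy.le.trans ?_
      rw [div_le_one (by positivity)]
      linarith [(Nat.cast_nonneg k : (0 : ℝ) ≤ k)]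
    refine mollify_eq_self_of_const k fun y hy => ?_
    rw [hz y hy, hz x (mem_ball_self (mollBump n k).rOut_pos)]
  have hu := hc.uniformContinuous_of_continuous hf
  have hbound : ∀ ε > (0 : ℝ), ∀ᶠ k in atTop, ∀ x, ‖(mollify k f - f) x‖ ≤ ε := by
    intro ε hε
    obtain ⟨δ, hδ, h⟩ := Metric.uniformContinuous_iff.mp hu ε hε
    filter_upwards [(tendsto_order.mp (tendsto_mollBump_rOut n)).2 δ hδ] with k hk x
    rw [Pi.sub_apply, ← dist_eq_norm]
    exact (mollBump n k).dist_normed_convolution_le hf.aestronglyMeasurable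
      fun y hy => (h (lt_trans (mem_ball.mp hy) hk)).le
  rw [tendsto_eLpNorm_two_iff, ENNReal.tendsto_nhds_zero]
  intro ε hε
  obtain ⟨δ, hδ, h⟩ : ∃ δ : ℝ, 0 < δ ∧ ENNReal.ofReal δ ^ 2 * volume K ≤ ε := by
    have : Tendsto (fun δ : ℝ => ENNReal.ofReal δ ^ 2 * volume K) (𝓝[>] 0) (𝓝 0) := by
      have h1 : Tendsto (fun δ : ℝ => ENNReal.ofReal δ ^ 2 * volume K) (𝓝 0)
          (𝓝 (ENNReal.ofReal 0 ^ 2 * volume K)) :=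
        ENNReal.Tendsto.mul_const
          (ENNReal.Tendsto.pow (ENNReal.continuous_ofReal.tendsto 0)) (Or.inr hK.measure_lt_top.ne)
      simp only [ENNReal.ofReal_zero, ne_eq, OfNat.ofNat_ne_zero, not_false_eq_true, zero_pow,
        zero_mul] at h1
      exact h1.mono_left nhdsWithin_le_nhds
    obtain ⟨δ, h1, h2⟩ := ((ENNReal.tendsto_nhds_zero.mp this ε hε).and self_mem_nhdsWithin).exists
    exact ⟨δ, h2, h1⟩
  filter_upwards [hbound δ hδ] with k hk
  calc ∫⁻ x, ‖(mollify k f - f) x‖ₑ ^ 2 ≤ ∫⁻ x in K, ENNReal.ofReal δ ^ 2 := by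
        rw [← lintegral_indicator hK.measurableSet]
        refine lintegral_mono fun x => ?_
        by_cases hx : x ∈ K
        · rw [indicator_of_mem hx]
          gcongr
          rw [← ofReal_norm]
          exact ENNReal.ofReal_le_ofReal (hk x)
        · rw [hout k x hx]
          simp
    _ ≤ ε := by rwa [setLIntegral_const]

/-- Mollifications converge in `L²`. -/
theorem tendsto_mollify [CompleteSpace E] {f : EucSp n → E} (hf : MemLp f 2) :
    Tendsto (fun k => eLpNorm (mollify k f - f) 2 volume) atTop (𝓝 0) := by
  rw [ENNReal.tendsto_nhds_zero]
  intro ε hε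
  have hε3 : ε / 3 ≠ 0 := by simp [hε.ne']
  obtain ⟨g, hgc, hfg, hg, hgL⟩ := hf.exists_hasCompactSupport_eLpNorm_sub_le (by norm_num) hε3
  filter_upwards [ENNReal.tendsto_nhds_zero.mp (tendsto_mollify_of_continuous hg hgc) (ε / 3)
    (pos_iff_ne_zero.mpr hε3)] with k hk
  have hfl : LocallyIntegrable f := hf.locallyIntegrable (by norm_num)
  have hgl : LocallyIntegrable g := hgL.locallyIntegrable (by norm_num)
  have hm1 := (contDiff_mollify k hfl).continuous.aestronglyMeasurable (μ := volume)
  have hm2 := (contDiff_mollify k hgl).continuous.aestronglyMeasurable (μ := volume)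
  -- The first term is controlled by the `L²` contraction property, the second by the continuous
  -- case, the third by the choice of `g`.
  have heq : mollify k f - f = mollify k (f - g) + ((mollify k g - g) + (g - f)) := by
    rw [mollify_sub k hfl hgl]; abel
  rw [heq]
  calc _ ≤ ε / 3 + (ε / 3 + ε / 3) := by
        refine (eLpNorm_add_le ?_ ?_ (by norm_num)).trans (add_le_add ?_
          ((eLpNorm_add_le ?_ ?_ (by norm_num)).trans (add_le_add hk ?_)))
        · rw [mollify_sub k hfl hgl]; exact hm1.sub hm2
        · exact (hm2.sub hgL.1).add (hgL.1.sub hf.1)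
        · exact (eLpNorm_mollify_le k (hf.1.sub hgL.1)).trans hfg
        · exact hm2.sub hgL.1
        · exact hgL.1.sub hf.1
        · rwa [eLpNorm_sub_comm]
    _ = ε := by rw [← add_assoc]; exact ENNReal.add_thirds ε

end

/-! ### Weak gradients -/

section

variable {n : ℕ}

theorem inner_gradient_eq_fderiv (f : EucSp n → ℝ) (x v : EucSp n) :
    inner ℝ (∇ f x) v = fderiv ℝ f x v := by
  rw [gradient, InnerProductSpace.toDual_symm_apply]

theorem norm_gradient (f : EucSp n → ℝ) (x : EucSp n) : ‖∇ f x‖ = ‖fderiv ℝ f x‖ := by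
  rw [gradient, LinearIsometryEquiv.norm_map]

theorem continuous_gradient {f : EucSp n → ℝ} (hf : ContDiff ℝ 1 f) : Continuous (∇ f) :=
  (InnerProductSpace.toDual ℝ (EucSp n)).symm.continuous.comp (hf.continuous_fderiv one_ne_zero)

theorem measurable_gradient (f : EucSp n → ℝ) : Measurable (∇ f) :=
  (InnerProductSpace.toDual ℝ (EucSp n)).symm.continuous.measurable.comp (measurable_fderiv ℝ f)

theorem gradient_eq_zero_of_notMem_tsupport {f : EucSp n → ℝ} {x : EucSp n} (hx : x ∉ tsupport f) :
    ∇ f x = 0 := by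
  rw [← norm_eq_zero, norm_gradient, norm_eq_zero]
  by_contra h
  exact hx (support_fderiv_subset ℝ h)

theorem IsTestFunction.continuous_gradient {Ω : Set (EucSp n)} {ψ : EucSp n → ℝ}
    (h : IsTestFunction Ω ψ) : Continuous (∇ ψ) :=
  _root_.continuous_gradient (h.smooth.of_le (by exact_mod_cast le_top))

theorem IsTestFunction.hasCompactSupport_gradient {Ω : Set (EucSp n)} {ψ : EucSp n → ℝ}
    (h : IsTestFunction Ω ψ) : HasCompactSupport (∇ ψ) :=
  HasCompactSupport.of_support_subset_isCompact h.compact fun x hx => by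
    by_contra hx'
    exact hx (gradient_eq_zero_of_notMem_tsupport hx')

theorem IsTestFunction.mono {Ω Ω' : Set (EucSp n)} {ψ : EucSp n → ℝ}
    (h : IsTestFunction Ω ψ) (hΩ : Ω ⊆ Ω') : IsTestFunction Ω' ψ :=
  ⟨h.smooth, h.compact, h.support.trans hΩ⟩

theorem IsTestFunction.memLp {Ω : Set (EucSp n)} {ψ : EucSp n → ℝ}
    (h : IsTestFunction Ω ψ) (μ : Measure (EucSp n)) [IsFiniteMeasureOnCompacts μ] :
    MemLp ψ 2 μ :=
  h.smooth.continuous.memLp_of_hasCompactSupport h.compact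

theorem IsTestFunction.memLp_gradient {Ω : Set (EucSp n)} {ψ : EucSp n → ℝ}
    (h : IsTestFunction Ω ψ) (μ : Measure (EucSp n)) [IsFiniteMeasureOnCompacts μ] :
    MemLp (∇ ψ) 2 μ :=
  h.continuous_gradient.memLp_of_hasCompactSupport h.hasCompactSupport_gradient

theorem MemW12.mono {Ω Ω' : Set (EucSp n)} {u : EucSp n → ℝ} {G : EucSp n → EucSp n}
    (h : MemW12 Ω u G) (hΩ : Ω' ⊆ Ω) (hm : MeasurableSet Ω) :
    MemW12 Ω' u G := by
  refine ⟨h.memLp.mono_measure (Measure.restrict_mono hΩ le_rfl),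
    h.memLp_grad.mono_measure (Measure.restrict_mono hΩ le_rfl), fun ψ hψ => ?_⟩
  have h0 : ∀ x ∈ Ω \ Ω', x ∉ tsupport ψ := fun x hx hx' => hx.2 (hψ.support hx')
  have := h.weak ψ (hψ.mono hΩ)
  rwa [setIntegral_eq_of_subset_of_forall_sdiff_eq_zero hm hΩ
      (fun x hx => by rw [gradient_eq_zero_of_notMem_tsupport (h0 x hx), smul_zero]),
    setIntegral_eq_of_subset_of_forall_sdiff_eq_zero hm hΩ
      (fun x hx => by rw [image_eq_zero_of_notMem_tsupport (h0 x hx), zero_smul])] at this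

theorem MemLp.integrable_smul_two {α F : Type*} [MeasurableSpace α] {μ : Measure α}
    [NormedAddCommGroup F] [NormedSpace ℝ F] {f : α → ℝ} {g : α → F}
    (hf : MemLp f 2 μ) (hg : MemLp g 2 μ) : Integrable (fun x => f x • g x) μ :=
  memLp_one_iff_integrable.mp (hg.smul hf)

theorem MemW12.weak_inner {Ω : Set (EucSp n)} {u : EucSp n → ℝ} {G : EucSp n → EucSp n}
    (h : MemW12 Ω u G) {ψ : EucSp n → ℝ} (hψ : IsTestFunction Ω ψ) (v : EucSp n) :
    ∫ x in Ω, u x * fderiv ℝ ψ x v = - ∫ x in Ω, ψ x * inner ℝ (G x) v := by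
  have h1 := congrArg (fun w => inner ℝ v w) (h.weak ψ hψ)
  simp only [inner_neg_right] at h1
  rw [← integral_inner (MemLp.integrable_smul_two h.memLp (hψ.memLp_gradient _)),
    ← integral_inner (MemLp.integrable_smul_two (hψ.memLp _) h.memLp_grad)] at h1
  simp only [real_inner_smul_right] at h1
  simp only [← inner_gradient_eq_fderiv, real_inner_comm v]
  exact h1

/-- This kernel, as a function of `y`, is what gets inserted in the weak formulation to
differentiate a mollification at `x`. -/
theorem isTestFunction_mollBump_sub {Ω : Set (EucSp n)} {k : ℕ} {x : EucSp n}
    (hx : closedBall x (1 / ((k : ℝ) + 1)) ⊆ Ω) :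
    IsTestFunction Ω (fun y => (mollBump n k).normed volume (x - y)) := by
  have hs : tsupport (fun y => (mollBump n k).normed volume (x - y)) ⊆
      closedBall x (1 / ((k : ℝ) + 1)) := by
    refine closure_minimal (fun y hy => ?_) isClosed_closedBall
    have : x - y ∈ Function.support ((mollBump n k).normed volume) := hy
    rw [(mollBump n k).support_normed_eq, mem_ball_zero_iff, mollBump_rOut] at this
    rw [mem_closedBall, dist_eq_norm_sub']
    exact this.le
  exact ⟨(mollBump n k).contDiff_normed.comp (contDiff_const.sub contDiff_id),
    (isCompact_closedBall x _).of_isClosed_subset (isClosed_tsupport _) hs, hs.trans hx⟩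

/-- Mollification commutes with the weak gradient. -/
theorem MemW12.hasGradientAt_mollify {Ω : Set (EucSp n)} (hΩ : MeasurableSet Ω)
    {u : EucSp n → ℝ} {G : EucSp n → EucSp n} (h : MemW12 Ω u G) {k : ℕ} {x : EucSp n}
    (hx : closedBall x (1 / ((k : ℝ) + 1)) ⊆ Ω) :
    HasGradientAt (mollify k (Ω.indicator u)) (mollify k (Ω.indicator G) x) x := by
  have hul : LocallyIntegrable (Ω.indicator u) volume :=
    ((memLp_indicator_iff_restrict hΩ).mpr h.memLp).locallyIntegrable (by norm_num)
  have hGl : LocallyIntegrable (Ω.indicator G) volume :=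
    ((memLp_indicator_iff_restrict hΩ).mpr h.memLp_grad).locallyIntegrable (by norm_num)
  set ρ := (mollBump n k).normed (volume : Measure (EucSp n)) with hρ
  have hρs : ContDiff ℝ 1 ρ := (mollBump n k).contDiff_normed
  have hρc : HasCompactSupport ρ := (mollBump n k).hasCompactSupport_normed
  set L := (ContinuousLinearMap.lsmul ℝ ℝ : ℝ →L[ℝ] ℝ →L[ℝ] ℝ)
  have hd := hρc.hasFDerivAt_convolution_right L.flip hul hρs x
  rw [convolution_flip] at hd
  rw [hasGradientAt_iff_hasFDerivAt]
  refine hd.congr_fderiv ?_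
  ext v
  rw [InnerProductSpace.toDual_apply_apply, convolution_precompR_apply L.flip hul
    (hρc.fderiv ℝ) (hρs.continuous_fderiv one_ne_zero), convolution_def]
  -- The derivative of the convolution falls on the kernel. As a function of `y` the kernel `ρ(x -
  -- y)` has the opposite derivative, which cancels the sign in the weak identity.
  have hw := h.weak_inner (isTestFunction_mollBump_sub hx) v
  have hder (y : EucSp n) : fderiv ℝ (fun y => ρ (x - y)) y v = - fderiv ℝ ρ (x - y) v := by
    have h1 : HasFDerivAt (fun y => ρ (x - y))
        ((fderiv ℝ ρ (x - y)).comp (-(ContinuousLinearMap.id ℝ (EucSp n)))) y :=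
      ((hρs.differentiable one_ne_zero (x - y)).hasFDerivAt).comp y
        ((hasFDerivAt_id y).const_sub x)
    rw [h1.fderiv]; simp
  simp only [← hρ, hder, mul_neg, integral_neg, neg_inj] at hw
  have hG : mollify k (Ω.indicator G) x = ∫ y, ρ (x - y) • Ω.indicator G y := by
    rw [mollify, convolution_eq_swap]; rfl
  have hGi : Integrable fun y => ρ (x - y) • Ω.indicator G y := by
    have := mollify_convolutionExists k hGl x
    exact convolutionExistsAt_iff_integrable_swap.mp this
  rw [hG, real_inner_comm, ← integral_inner hGi]
  simp only [real_inner_smul_right]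
  have e1 : ∀ y, ρ (x - y) * inner ℝ v (Ω.indicator G y) =
      Ω.indicator (fun y => ρ (x - y) * inner ℝ (G y) v) y := by
    intro y; by_cases hy : y ∈ Ω <;> simp [hy, real_inner_comm]
  have e2 : ∀ y, L.flip (Ω.indicator u y) (fderiv ℝ ρ (x - y) v) =
      Ω.indicator (fun y => u y * fderiv ℝ ρ (x - y) v) y := by
    intro y; by_cases hy : y ∈ Ω <;> simp [hy, L, mul_comm]
  simp_rw [e1, e2]
  rw [integral_indicator hΩ, integral_indicator hΩ, hw]

/-- A Lipschitz function has its almost everywhere gradient as weak gradient. -/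
theorem LipschitzWith.integral_smul_gradient {f : EucSp n → ℝ} {C : NNReal}
    (hf : LipschitzWith C f) {ψ : EucSp n → ℝ} (hψ : IsTestFunction univ ψ) :
    ∫ x, f x • ∇ ψ x = - ∫ x, ψ x • ∇ f x := by
  obtain ⟨D, hD⟩ := (hψ.smooth.of_le (by exact_mod_cast le_top) :
    ContDiff ℝ 1 ψ).lipschitzWith_of_hasCompactSupport hψ.compact one_ne_zero
  have hi1 : Integrable fun x => f x • ∇ ψ x :=
    (hf.continuous.smul hψ.continuous_gradient).integrable_of_hasCompactSupport
      hψ.hasCompactSupport_gradient.smul_left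
  have hb : ∀ x, ‖∇ f x‖ ≤ C := fun x => by
    rw [norm_gradient]; exact norm_fderiv_le_of_lipschitz ℝ hf
  have hi2 : Integrable fun x => ψ x • ∇ f x :=
    (hψ.smooth.continuous.integrable_of_hasCompactSupport hψ.compact).smul_bdd C
      (measurable_gradient f).aestronglyMeasurable (.of_forall hb)
  refine ext_inner_left ℝ fun v => ?_
  rw [inner_neg_right, ← integral_inner hi1, ← integral_inner hi2]
  -- Integration by parts is done one direction at a time. By Rademacher's theorem the directional
  -- derivatives of `f` come from its gradient almost everywhere.
  have h := hf.integral_lineDeriv_mul_eq (μ := volume) hD hψ.compact v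
  have e1 : ∀ᵐ x, lineDeriv ℝ f x v * ψ x = inner ℝ v (ψ x • ∇ f x) := by
    filter_upwards [hf.ae_differentiableAt] with x hx
    rw [hx.lineDeriv_eq_fderiv, real_inner_smul_right, real_inner_comm, inner_gradient_eq_fderiv,
      mul_comm]
  have e2 : ∀ᵐ x, lineDeriv ℝ ψ x (-v) * f x = - inner ℝ v (f x • ∇ ψ x) := by
    refine .of_forall fun x => ?_
    rw [((hψ.smooth.differentiable (by simp)) x).lineDeriv_eq_fderiv, real_inner_smul_right,
      real_inner_comm, inner_gradient_eq_fderiv, map_neg]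
    ring
  rw [← integral_congr_ae e1, h, integral_congr_ae e2, integral_neg, neg_neg]

end

/-! ### Limits of test functions in `W^{1,2}` -/

section

variable {n : ℕ}

/-- `(v, G)` is a limit in `L²(Ω)` of pairs `(ψ, ∇ψ)` with `ψ` a test function. -/
structure W0Pair (Ω : Set (EucSp n)) (v : EucSp n → ℝ) (G : EucSp n → EucSp n) : Prop where
  memLp : MemLp v 2 (volume.restrict Ω)
  memLp_grad : MemLp G 2 (volume.restrict Ω)
  approx : ∀ ε : ℝ, 0 < ε → ∃ ψ : EucSp n → ℝ, IsTestFunction Ω ψ ∧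
      eLpNorm (fun x => v x - ψ x) 2 (volume.restrict Ω) ≤ ENNReal.ofReal ε ∧
      eLpNorm (fun x => G x - ∇ ψ x) 2 (volume.restrict Ω) ≤ ENNReal.ofReal ε

theorem tendsto_integral_smul_of_tendsto_eLpNorm_left {α F ι : Type*} [MeasurableSpace α]
    {μ : Measure α} [NormedAddCommGroup F] [NormedSpace ℝ F] {l : Filter ι}
    {f : ι → α → ℝ} {f₀ : α → ℝ} {g : α → F} (hf : ∀ i, MemLp (f i) 2 μ) (hf₀ : MemLp f₀ 2 μ)
    (hg : MemLp g 2 μ) (h : Tendsto (fun i => eLpNorm (fun x => f₀ x - f i x) 2 μ) l (𝓝 0)) :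
    Tendsto (fun i => ∫ x, f i x • g x ∂μ) l (𝓝 (∫ x, f₀ x • g x ∂μ)) := by
  refine tendsto_integral_of_L1' _ (MemLp.integrable_smul_two hf₀ hg).1
    (.of_forall fun i => MemLp.integrable_smul_two (hf i) hg) ?_
  have h2 := ENNReal.Tendsto.mul_const h (Or.inr hg.eLpNorm_ne_top)
  rw [zero_mul] at h2
  refine tendsto_of_tendsto_of_tendsto_of_le_of_le tendsto_const_nhds h2 (fun _ => zero_le)
    fun i => ?_
  have h3 : ((fun x => f i x • g x) - fun x => f₀ x • g x) =
      -((fun x => f₀ x - f i x) • g) := by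
    ext1 x; simp [sub_smul]
  rw [h3, eLpNorm_neg]
  exact eLpNorm_smul_le_mul_eLpNorm hg.1 (hf₀.1.sub (hf i).1)

theorem tendsto_integral_smul_of_tendsto_eLpNorm_right {α F ι : Type*} [MeasurableSpace α]
    {μ : Measure α} [NormedAddCommGroup F] [NormedSpace ℝ F] {l : Filter ι}
    {f : α → ℝ} {g : ι → α → F} {g₀ : α → F} (hf : MemLp f 2 μ) (hg : ∀ i, MemLp (g i) 2 μ)
    (hg₀ : MemLp g₀ 2 μ) (h : Tendsto (fun i => eLpNorm (fun x => g₀ x - g i x) 2 μ) l (𝓝 0)) :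
    Tendsto (fun i => ∫ x, f x • g i x ∂μ) l (𝓝 (∫ x, f x • g₀ x ∂μ)) := by
  refine tendsto_integral_of_L1' _ (MemLp.integrable_smul_two hf hg₀).1
    (.of_forall fun i => MemLp.integrable_smul_two hf (hg i)) ?_
  have h2 := ENNReal.Tendsto.const_mul h (Or.inr hf.eLpNorm_ne_top)
  rw [mul_zero] at h2
  refine tendsto_of_tendsto_of_tendsto_of_le_of_le tendsto_const_nhds h2 (fun _ => zero_le)
    fun i => ?_
  have h3 : ((fun x => f x • g i x) - fun x => f x • g₀ x) =
      -(f • (fun x => g₀ x - g i x)) := by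
    ext1 x; simp [smul_sub]
  rw [h3, eLpNorm_neg]
  exact eLpNorm_smul_le_mul_eLpNorm (hg₀.1.sub (hg i).1) hf.1

theorem W0Pair.exists_seq {Ω : Set (EucSp n)} {v : EucSp n → ℝ} {G : EucSp n → EucSp n}
    (h : W0Pair Ω v G) : ∃ ψ : ℕ → EucSp n → ℝ, (∀ k, IsTestFunction Ω (ψ k)) ∧
      Tendsto (fun k => eLpNorm (fun x => v x - ψ k x) 2 (volume.restrict Ω)) atTop (𝓝 0) ∧
      Tendsto (fun k => eLpNorm (fun x => G x - ∇ (ψ k) x) 2 (volume.restrict Ω)) atTop (𝓝 0) := by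
  choose ψ h1 h2 h3 using fun k : ℕ => h.approx (1 / ((k : ℝ) + 1)) (by positivity)
  have h0 : Tendsto (fun k : ℕ => ENNReal.ofReal (1 / ((k : ℝ) + 1))) atTop (𝓝 0) := by
    simpa using ENNReal.tendsto_ofReal tendsto_one_div_add_atTop_nhds_zero_nat
  exact ⟨ψ, h1, tendsto_of_tendsto_of_tendsto_of_le_of_le tendsto_const_nhds h0
    (fun _ => zero_le) h2, tendsto_of_tendsto_of_tendsto_of_le_of_le tendsto_const_nhds h0
    (fun _ => zero_le) h3⟩

theorem IsTestFunction.exists_lipschitzWith {Ω : Set (EucSp n)} {ψ : EucSp n → ℝ}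
    (h : IsTestFunction Ω ψ) : ∃ C, LipschitzWith C ψ :=
  (h.smooth.of_le (by exact_mod_cast le_top) :
    ContDiff ℝ 1 ψ).lipschitzWith_of_hasCompactSupport h.compact one_ne_zero

/-- The weak identity holds for the approximating test functions, and both of its sides are
continuous under `L²` convergence of the function and of the gradient. -/
theorem W0Pair.memW12 {Ω : Set (EucSp n)} {v : EucSp n → ℝ} {G : EucSp n → EucSp n}
    (h : W0Pair Ω v G) : MemW12 Ω v G := by
  refine ⟨h.memLp, h.memLp_grad, fun η hη => ?_⟩
  obtain ⟨ψ, h1, h2, h3⟩ := h.exists_seq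
  have t1 := tendsto_integral_smul_of_tendsto_eLpNorm_left (fun k => (h1 k).memLp _) h.memLp
    (hη.memLp_gradient _) h2
  have t2 := (tendsto_integral_smul_of_tendsto_eLpNorm_right (hη.memLp _)
    (fun k => (h1 k).memLp_gradient _) h.memLp_grad h3).neg
  refine tendsto_nhds_unique t1 (t2.congr fun k => ?_)
  obtain ⟨C, hC⟩ := (h1 k).exists_lipschitzWith
  have := hC.integral_smul_gradient (hη.mono (subset_univ _))
  have hz : ∀ x ∉ Ω, η x = 0 := fun x hx =>
    image_eq_zero_of_notMem_tsupport fun hx' => hx (hη.support hx')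
  have hz' : ∀ x ∉ Ω, ∇ η x = 0 := fun x hx =>
    gradient_eq_zero_of_notMem_tsupport fun hx' => hx (hη.support hx')
  rw [setIntegral_eq_integral_of_forall_compl_eq_zero (fun x hx => by rw [hz x hx, zero_smul]),
    setIntegral_eq_integral_of_forall_compl_eq_zero (fun x hx => by rw [hz' x hx, smul_zero]),
    this]

theorem W0Pair.memW12Zero {Ω : Set (EucSp n)} {v : EucSp n → ℝ} {G : EucSp n → EucSp n}
    (h : W0Pair Ω v G) : MemW12Zero Ω v := ⟨G, h.memW12, h.approx⟩

theorem MemW12Zero.exists_w0Pair {Ω : Set (EucSp n)} {v : EucSp n → ℝ} (h : MemW12Zero Ω v) :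
    ∃ G, W0Pair Ω v G := by
  obtain ⟨G, h1, h2⟩ := h
  exact ⟨G, h1.memLp, h1.memLp_grad, h2⟩

theorem IsTestFunction.add {Ω : Set (EucSp n)} {ψ η : EucSp n → ℝ} (h : IsTestFunction Ω ψ)
    (h' : IsTestFunction Ω η) : IsTestFunction Ω (fun x => ψ x + η x) :=
  ⟨h.smooth.add h'.smooth, h.compact.add h'.compact,
    (tsupport_add ψ η).trans (union_subset h.support h'.support)⟩

theorem IsTestFunction.gradient_add {Ω : Set (EucSp n)} {ψ η : EucSp n → ℝ}
    (h : IsTestFunction Ω ψ) (h' : IsTestFunction Ω η) (x : EucSp n) :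
    ∇ (fun x => ψ x + η x) x = ∇ ψ x + ∇ η x := by
  refine ext_inner_right ℝ fun v => ?_
  rw [inner_add_left, inner_gradient_eq_fderiv, inner_gradient_eq_fderiv, inner_gradient_eq_fderiv,
    fderiv_fun_add (h.smooth.differentiable (by simp) x) (h'.smooth.differentiable (by simp) x)]
  rfl

theorem IsTestFunction.const_mul {Ω : Set (EucSp n)} {ψ : EucSp n → ℝ} (h : IsTestFunction Ω ψ)
    (c : ℝ) : IsTestFunction Ω (fun x => c * ψ x) :=
  ⟨contDiff_const.mul h.smooth, h.compact.mul_left,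
    (tsupport_mul_subset_right (f := fun _ => c)).trans h.support⟩

theorem IsTestFunction.gradient_const_mul {Ω : Set (EucSp n)} {ψ : EucSp n → ℝ}
    (h : IsTestFunction Ω ψ) (c : ℝ) (x : EucSp n) :
    ∇ (fun x => c * ψ x) x = c • ∇ ψ x := by
  refine ext_inner_right ℝ fun v => ?_
  rw [real_inner_smul_left, inner_gradient_eq_fderiv, inner_gradient_eq_fderiv,
    fderiv_const_mul (h.smooth.differentiable (by simp) x)]
  rfl

theorem W0Pair.add {Ω : Set (EucSp n)} {v w : EucSp n → ℝ} {G H : EucSp n → EucSp n}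
    (h : W0Pair Ω v G) (h' : W0Pair Ω w H) :
    W0Pair Ω (fun x => v x + w x) (fun x => G x + H x) := by
  refine ⟨h.memLp.add h'.memLp, h.memLp_grad.add h'.memLp_grad, fun ε hε => ?_⟩
  obtain ⟨ψ, a1, a2, a3⟩ := h.approx (ε / 2) (by positivity)
  obtain ⟨η, b1, b2, b3⟩ := h'.approx (ε / 2) (by positivity)
  have he : ENNReal.ofReal ε = ENNReal.ofReal (ε / 2) + ENNReal.ofReal (ε / 2) := by
    rw [← ENNReal.ofReal_add (by positivity) (by positivity), add_halves]
  refine ⟨_, a1.add b1, ?_, ?_⟩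
  · have e : (fun x => v x + w x - (ψ x + η x)) =
        (fun x => v x - ψ x) + fun x => w x - η x := by
      ext1 x; simp only [Pi.add_apply]; ring
    rw [e, he]
    exact (eLpNorm_add_le (h.memLp.1.sub (a1.memLp _).1) (h'.memLp.1.sub (b1.memLp _).1)
      (by norm_num)).trans (add_le_add a2 b2)
  · have e : (fun x => G x + H x - ∇ (fun x => ψ x + η x) x) =
        (fun x => G x - ∇ ψ x) + fun x => H x - ∇ η x := by
      ext1 x; rw [a1.gradient_add b1]; simp only [Pi.add_apply]; abel
    rw [e, he]
    exact (eLpNorm_add_le (h.memLp_grad.1.sub (a1.memLp_gradient _).1)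
      (h'.memLp_grad.1.sub (b1.memLp_gradient _).1) (by norm_num)).trans (add_le_add a3 b3)

theorem W0Pair.const_smul {Ω : Set (EucSp n)} {v : EucSp n → ℝ} {G : EucSp n → EucSp n}
    (h : W0Pair Ω v G) {c : ℝ} (hc : c ≠ 0) :
    W0Pair Ω (fun x => c * v x) (fun x => c • G x) := by
  refine ⟨h.memLp.const_mul c, h.memLp_grad.const_smul c, fun ε hε => ?_⟩
  obtain ⟨ψ, a1, a2, a3⟩ := h.approx (ε / |c|) (by positivity)
  have he : ENNReal.ofReal ε = ‖c‖ₑ * ENNReal.ofReal (ε / |c|) := by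
    rw [Real.enorm_eq_ofReal_abs, ← ENNReal.ofReal_mul (abs_nonneg c),
      mul_div_cancel₀ _ (abs_ne_zero.mpr hc)]
  refine ⟨_, a1.const_mul c, ?_, ?_⟩
  · have e : (fun x => c * v x - c * ψ x) = c • (fun x => v x - ψ x) := by
      ext1 x; simp [mul_sub]
    rw [e, he, eLpNorm_const_smul]
    gcongr
  · have e : (fun x => c • G x - ∇ (fun x => c * ψ x) x) = c • (fun x => G x - ∇ ψ x) := by
      ext1 x; rw [a1.gradient_const_mul]; simp [smul_sub]
    rw [e, he, eLpNorm_const_smul]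
    gcongr

theorem W0Pair.congr_ae {Ω : Set (EucSp n)} {v w : EucSp n → ℝ} {G H : EucSp n → EucSp n}
    (h : W0Pair Ω v G) (hv : v =ᵐ[volume.restrict Ω] w) (hG : G =ᵐ[volume.restrict Ω] H) :
    W0Pair Ω w H := by
  refine ⟨(memLp_congr_ae hv).mp h.memLp, (memLp_congr_ae hG).mp h.memLp_grad, fun ε hε => ?_⟩
  obtain ⟨ψ, a1, a2, a3⟩ := h.approx ε hε
  refine ⟨ψ, a1, ?_, ?_⟩
  · exact (eLpNorm_congr_ae (hv.sub (EventuallyEq.refl _ ψ))).symm.trans_le a2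
  · exact (eLpNorm_congr_ae (hG.sub (EventuallyEq.refl _ (∇ ψ)))).symm.trans_le a3

/-- `W0Pair` is closed under `L²` limits. -/
theorem W0Pair.of_tendsto {Ω : Set (EucSp n)} {v : EucSp n → ℝ} {G : EucSp n → EucSp n}
    {w : ℕ → EucSp n → ℝ} {H : ℕ → EucSp n → EucSp n} (h : ∀ k, W0Pair Ω (w k) (H k))
    (hv : MemLp v 2 (volume.restrict Ω)) (hG : MemLp G 2 (volume.restrict Ω))
    (hvw : Tendsto (fun k => eLpNorm (fun x => v x - w k x) 2 (volume.restrict Ω)) atTop (𝓝 0))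
    (hGH : Tendsto (fun k => eLpNorm (fun x => G x - H k x) 2 (volume.restrict Ω)) atTop (𝓝 0)) :
    W0Pair Ω v G := by
  refine ⟨hv, hG, fun ε hε => ?_⟩
  have hε2 : 0 < ENNReal.ofReal (ε / 2) := by simpa using hε
  have he : ENNReal.ofReal ε = ENNReal.ofReal (ε / 2) + ENNReal.ofReal (ε / 2) := by
    rw [← ENNReal.ofReal_add (by positivity) (by positivity), add_halves]
  obtain ⟨k, k1, k2⟩ := ((ENNReal.tendsto_nhds_zero.mp hvw _ hε2).and
    (ENNReal.tendsto_nhds_zero.mp hGH _ hε2)).exists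
  obtain ⟨ψ, a1, a2, a3⟩ := (h k).approx (ε / 2) (by positivity)
  refine ⟨ψ, a1, ?_, ?_⟩
  · have e : (fun x => v x - ψ x) = (fun x => v x - w k x) + fun x => w k x - ψ x := by
      ext1 x; simp
    rw [e, he]
    exact (eLpNorm_add_le (hv.1.sub (h k).memLp.1) ((h k).memLp.1.sub (a1.memLp _).1)
      (by norm_num)).trans (add_le_add k1 a2)
  · have e : (fun x => G x - ∇ ψ x) = (fun x => G x - H k x) + fun x => H k x - ∇ ψ x := by
      ext1 x; simp
    rw [e, he]
    exact (eLpNorm_add_le (hG.1.sub (h k).memLp_grad.1)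
      ((h k).memLp_grad.1.sub (a1.memLp_gradient _).1) (by norm_num)).trans (add_le_add k2 a3)

theorem LipschitzWith.memW12_univ {f : EucSp n → ℝ} {C : NNReal} (hf : LipschitzWith C f)
    (hc : HasCompactSupport f) : MemW12 univ f (∇ f) := by
  have hb : ∀ x, ‖∇ f x‖ ≤ C := fun x => by
    rw [norm_gradient]; exact norm_fderiv_le_of_lipschitz ℝ hf
  refine ⟨hf.continuous.memLp_of_hasCompactSupport hc, ?_, fun ψ hψ => ?_⟩
  · rw [Measure.restrict_univ]
    have h1 : MemLp (∇ f) 2 (volume.restrict (tsupport f)) := by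
      have : IsFiniteMeasure (volume.restrict (tsupport f)) :=
        ⟨by simpa using hc.isCompact.measure_lt_top⟩
      exact MemLp.of_bound (measurable_gradient f).aestronglyMeasurable C (.of_forall hb)
    rw [← memLp_indicator_iff_restrict (isClosed_tsupport f).measurableSet] at h1
    rwa [indicator_eq_self.mpr fun x hx => ?_] at h1
    by_contra hx'
    exact hx (gradient_eq_zero_of_notMem_tsupport hx')
  · simpa using hf.integral_smul_gradient hψ

theorem mollify_eq_zero {E : Type*} [NormedAddCommGroup E] [NormedSpace ℝ E] [CompleteSpace E]
    {f : EucSp n → E} {k : ℕ} {x : EucSp n}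
    (hx : x ∉ cthickening (1 / ((k : ℝ) + 1)) (tsupport f)) : mollify k f x = 0 := by
  have hz : ∀ y ∈ ball x (mollBump n k).rOut, f y = 0 := by
    intro y hy
    by_contra hne
    rw [mem_ball, mollBump_rOut, dist_comm] at hy
    exact hx (mem_cthickening_of_dist_le x y _ _ (subset_tsupport f hne) hy.le)
  have hx0 := hz x (mem_ball_self (mollBump n k).rOut_pos)
  rw [mollify_eq_self_of_const k fun y hy => (hz y hy).trans hx0.symm, hx0]

/-- A compactly supported Lipschitz function belongs to `W^{1,2}_0`. -/
theorem LipschitzWith.w0Pair {f : EucSp n → ℝ} {C : NNReal} (hf : LipschitzWith C f)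
    (hc : HasCompactSupport f) {Ω : Set (EucSp n)} (hΩ : IsOpen Ω) (hs : tsupport f ⊆ Ω) :
    W0Pair Ω f (∇ f) := by
  have hw := hf.memW12_univ hc
  have m1 : MemLp f 2 := by simpa using hw.memLp
  have m2 : MemLp (∇ f) 2 := by simpa using hw.memLp_grad
  refine ⟨m1.restrict Ω, m2.restrict Ω, fun ε hε => ?_⟩
  -- Mollifying at a scale below `δ` keeps the support inside `Ω`, so the mollifications are test
  -- functions there.
  obtain ⟨δ, hδ, hδΩ⟩ := hc.isCompact.exists_cthickening_subset_open hΩ hs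
  have hε' : 0 < ENNReal.ofReal ε := by simpa using hε
  obtain ⟨k, k1, k2, k3⟩ := ((ENNReal.tendsto_nhds_zero.mp (tendsto_mollify m1) _ hε').and
    ((ENNReal.tendsto_nhds_zero.mp (tendsto_mollify m2) _ hε').and
      ((tendsto_order.mp (tendsto_mollBump_rOut n)).2 δ hδ))).exists
  rw [mollBump_rOut] at k3
  have hsub : tsupport (mollify k f) ⊆ cthickening (1 / ((k : ℝ) + 1)) (tsupport f) :=
    closure_minimal (fun x hx => by
      by_contra hx'
      exact hx (mollify_eq_zero hx')) isClosed_cthickening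
  have hgrad : ∀ x, ∇ (mollify k f) x = mollify k (∇ f) x := fun x => by
    have := hw.hasGradientAt_mollify MeasurableSet.univ (k := k) (x := x) (subset_univ _)
    rw [indicator_univ, indicator_univ] at this
    exact this.gradient
  refine ⟨mollify k f, ⟨contDiff_mollify k (m1.locallyIntegrable (by norm_num)),
    (hc.isCompact.cthickening (r := 1 / ((k : ℝ) + 1))).of_isClosed_subset (isClosed_tsupport _) hsub,
    hsub.trans ((cthickening_mono k3.le _).trans hδΩ)⟩, ?_, ?_⟩
  · refine (eLpNorm_mono_measure _ Measure.restrict_le_self).trans ?_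
    rw [show (fun x => f x - mollify k f x) = f - mollify k f from rfl, eLpNorm_sub_comm]
    exact k1
  · refine (eLpNorm_mono_measure _ Measure.restrict_le_self).trans ?_
    simp_rw [hgrad]
    rw [show (fun x => ∇ f x - mollify k (∇ f) x) = ∇ f - mollify k (∇ f) from rfl,
      eLpNorm_sub_comm]
    exact k2

/-- A compactly supported function with vanishing weak gradient vanishes. -/
theorem MemW12.ae_eq_zero_of_grad_eq_zero [NeZero n] {f : EucSp n → ℝ} {G : EucSp n → EucSp n}
    (h : MemW12 univ f G) (hc : HasCompactSupport f) (hG : G =ᵐ[volume] 0) : f =ᵐ[volume] 0 := by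
  have m1 : MemLp f 2 := by simpa using h.memLp
  have hz : ∀ k, mollify k f = 0 := by
    intro k
    have hgrad : ∀ x, fderiv ℝ (mollify k f) x = 0 := fun x => by
      have := h.hasGradientAt_mollify MeasurableSet.univ (k := k) (x := x) (subset_univ _)
      rw [indicator_univ, indicator_univ] at this
      have h0 : mollify k G x = 0 := by
        rw [mollify, convolution_eq_swap]
        refine integral_eq_zero_of_ae ?_
        filter_upwards [hG] with y hy
        simp [hy]
      rw [h0] at this
      rw [← norm_eq_zero, ← norm_gradient, this.gradient, norm_zero]
    have hconst := is_const_of_fderiv_eq_zero (𝕜 := ℝ)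
      ((contDiff_mollify k (m1.locallyIntegrable (by norm_num))).differentiable (by simp)) hgrad
    have hK := hc.isCompact.cthickening (r := 1 / ((k : ℝ) + 1))
    -- The mollification is constant on the whole space, which is not compact as `n ≥ 1`; at a point
    -- far from the support the constant is seen to be zero.
    obtain ⟨y, hy⟩ : ∃ y, y ∉ cthickening (1 / ((k : ℝ) + 1)) (tsupport f) := by
      by_contra! hall
      exact noncompact_univ (EucSp n) (eq_univ_of_forall hall ▸ hK)
    ext1 x
    rw [hconst x y, mollify_eq_zero hy, Pi.zero_apply]
  have ht := tendsto_mollify m1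
  simp only [hz, zero_sub, eLpNorm_neg] at ht
  have h0 := tendsto_nhds_unique ht tendsto_const_nhds
  exact (eLpNorm_eq_zero_iff m1.1 (by norm_num)).mp h0.symm

end

/-! ### Homogeneous extension of functions on a sphere -/

section

variable {n : ℕ}

theorem hasFDerivAt_norm_of_ne_zero {x : EucSp n} (hx : x ≠ 0) :
    HasFDerivAt (fun y : EucSp n => ‖y‖) (‖x‖⁻¹ • innerSL ℝ x) x := by
  have h := (hasStrictFDerivAt_norm_sq x).hasFDerivAt.sqrt (by simpa using hx)
  simp only [Real.sqrt_sq (norm_nonneg _)] at h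
  refine h.congr_fderiv ?_
  ext v
  simp
  field_simp

theorem norm_sub_inner_smul_sq (θ : USphere n) (w : EucSp n) :
    ‖w - inner ℝ w (θ : EucSp n) • (θ : EucSp n)‖ ^ 2 =
      ‖w‖ ^ 2 - inner ℝ w (θ : EucSp n) ^ 2 := by
  rw [norm_sub_sq_real, norm_smul, norm_usphere, real_inner_smul_right, mul_one, Real.norm_eq_abs,
    sq_abs]
  ring

theorem norm_sub_inner_smul_le (θ : USphere n) (w : EucSp n) :
    ‖w - inner ℝ w (θ : EucSp n) • (θ : EucSp n)‖ ≤ ‖w‖ := by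
  refine le_of_sq_le_sq ?_ (norm_nonneg _)
  rw [norm_sub_inner_smul_sq]
  linarith [sq_nonneg (inner ℝ w (θ : EucSp n))]

/-- A segment from inside the ball to outside crosses the sphere, where `f` vanishes. The part up to
the crossing point is no longer than the segment, so the constant `C` is kept. -/
theorem LipschitzOnWith.indicator_closedBall {f : EucSp n → ℝ} {C : NNReal} {R : ℝ}
    (hf : LipschitzOnWith C f (closedBall 0 R)) (h0 : ∀ x, ‖x‖ = R → f x = 0) :
    LipschitzWith C ((ball (0 : EucSp n) R).indicator f) := by
  have hind : ∀ x, ‖x‖ ≤ R → (ball (0 : EucSp n) R).indicator f x = f x := by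
    intro x hx
    by_cases h : x ∈ ball (0 : EucSp n) R
    · simp [h]
    · rw [indicator_of_notMem h, h0 x (le_antisymm hx (by simpa using h))]
  have hout : ∀ x, R ≤ ‖x‖ → (ball (0 : EucSp n) R).indicator f x = 0 := by
    intro x hx
    exact indicator_of_notMem (by simpa using hx) f
  have key : ∀ x y : EucSp n, ‖x‖ ≤ R → R ≤ ‖y‖ →
      dist ((ball (0 : EucSp n) R).indicator f x) ((ball (0 : EucSp n) R).indicator f y) ≤
        C * dist x y := by
    intro x y hx hy
    obtain ⟨t, ht, htR⟩ : ∃ t ∈ Icc (0 : ℝ) 1, ‖AffineMap.lineMap x y t‖ = R := by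
      have hc : ContinuousOn (fun t : ℝ => ‖AffineMap.lineMap x y t‖) (Icc 0 1) :=
        (AffineMap.lineMap_continuous (p := x) (q := y)).norm.continuousOn
      have := intermediate_value_Icc zero_le_one hc
      exact this ⟨by simpa using hx, by simpa using hy⟩
    rw [hind x hx, hout y hy, ← h0 _ htR]
    refine (hf.dist_le_mul x (by simpa using hx) _ (by simpa using htR.le)).trans ?_
    gcongr
    rw [dist_left_lineMap, Real.norm_of_nonneg ht.1]
    exact mul_le_of_le_one_left dist_nonneg ht.2
  refine LipschitzWith.of_dist_le_mul fun x y => ?_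
  rcases le_total ‖x‖ R with hx | hx <;> rcases le_total ‖y‖ R with hy | hy
  · rw [hind x hx, hind y hy]
    exact hf.dist_le_mul x (by simpa using hx) y (by simpa using hy)
  · exact key x y hx hy
  · rw [dist_comm, dist_comm x y]
    exact key y x hy hx
  · rw [hout x hx, hout y hy, dist_self]
    positivity

variable [NeZero n]

/-- The extension of `f`, prescribed on the sphere of radius `R`, that is homogeneous of
degree `α`. -/
def homExt (α R : ℝ) (f : USphere n → ℝ) (x : EucSp n) : ℝ :=
  (‖x‖ / R) ^ α * f (direction x)

/-- The gradient of `homExt α R f`, where `F` is the restriction to the sphere of radius `R` of the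
gradient of an extension of `f`. -/
def homGrad (α R : ℝ) (f : USphere n → ℝ) (F : USphere n → EucSp n) (x : EucSp n) : EucSp n :=
  (‖x‖ / R) ^ (α - 1) • ((α * f (direction x) / R) • (direction x : EucSp n) +
    (F (direction x) - inner ℝ (F (direction x)) (direction x : EucSp n) •
      (direction x : EucSp n)))

/-- The derivative of `y ↦ R y/|y|` is `R/|x|` times the projection onto the tangent space, so only
the tangential part of `∇v` survives. The power of the norm contributes the radial part `α f / R`.
-/
theorem hasGradientAt_homExt {α R : ℝ} (hR : 0 < R) {v : EucSp n → ℝ} {x : EucSp n} (hx : x ≠ 0)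
    (hv : DifferentiableAt ℝ v (R • (direction x : EucSp n))) :
    HasGradientAt (homExt α R (sphereRestrict v R))
      (homGrad α R (sphereRestrict v R) (fun θ => ∇ v (R • (θ : EucSp n))) x) x := by
  have ha : ‖x‖ ≠ 0 := by simpa using hx
  have hpos : 0 < ‖x‖ := by positivity
  have hN := hasFDerivAt_norm_of_ne_zero hx
  have h1 : HasFDerivAt (fun y : EucSp n => (‖y‖ / R) ^ α)
      ((α * (‖x‖ / R) ^ (α - 1)) • (R⁻¹ • (‖x‖⁻¹ • innerSL ℝ x))) x := by
    refine HasFDerivAt.rpow_const ?_ (Or.inl (by positivity))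
    simpa [div_eq_inv_mul] using hN.const_mul R⁻¹
  have h2 : HasFDerivAt (fun y : EucSp n => ‖y‖⁻¹) (-(‖x‖ ^ 2)⁻¹ • (‖x‖⁻¹ • innerSL ℝ x)) x :=
    (hasDerivAt_inv ha).comp_hasFDerivAt x hN
  have h3 := (h2.smul (hasFDerivAt_id x)).const_smul R
  have hd : R • (direction x : EucSp n) = R • (‖x‖⁻¹ • x) := by rw [coe_direction hx]
  have h4 : HasFDerivAt v (fderiv ℝ v (R • (direction x : EucSp n))) (R • (‖x‖⁻¹ • id x)) := by
    rw [id, ← hd]; exact hv.hasFDerivAt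
  have h5 := h1.mul (h4.comp x h3)
  rw [hasGradientAt_iff_hasFDerivAt]
  refine (h5.congr_fderiv ?_).congr_of_eventuallyEq ?_
  · ext h
    rw [InnerProductSpace.toDual_apply_apply]
    simp only [homGrad, sphereRestrict, inner_add_left, inner_sub_left, real_inner_smul_left,
      inner_gradient_eq_fderiv, add_apply, smul_apply,
      ContinuousLinearMap.comp_apply, ContinuousLinearMap.smulRight_apply, smul_eq_mul,
      innerSL_apply_apply, Function.comp_apply, id, map_add, map_smul,
      ContinuousLinearMap.id_apply]
    have hp : (‖x‖ / R) ^ α = (‖x‖ / R) ^ (α - 1) * (‖x‖ / R) := by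
      rw [← Real.rpow_add_one (by positivity)]; ring_nf
    have hev : (R • (fun y : EucSp n => ‖y‖⁻¹) • id) x = R • (direction x : EucSp n) := hd.symm
    rw [hev, hp, coe_direction hx]
    simp only [real_inner_smul_left, map_smul, smul_eq_mul]
    field_simp
    ring
  · filter_upwards [isOpen_ne.mem_nhds hx] with y hy
    simp only [homExt, sphereRestrict, Pi.mul_apply, Function.comp_apply, coe_direction hy]
    rfl

theorem norm_homExt_le {α R : ℝ} (hα : 0 ≤ α) (hR : 0 < R) (f : USphere n → ℝ) {x : EucSp n}
    (hx : ‖x‖ ≤ R) : ‖homExt α R f x‖ ≤ ‖f (direction x)‖ := by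
  rw [homExt, norm_mul, Real.norm_of_nonneg (by positivity)]
  exact mul_le_of_le_one_left (norm_nonneg _)
    (Real.rpow_le_one (by positivity) ((div_le_one hR).mpr hx) hα)

theorem norm_homGrad_le {α R : ℝ} (hα : 1 ≤ α) (hR : 0 < R) (f : USphere n → ℝ)
    (F : USphere n → EucSp n) {x : EucSp n} (hx : ‖x‖ ≤ R) :
    ‖homGrad α R f F x‖ ≤ α / R * ‖f (direction x)‖ + ‖F (direction x)‖ := by
  rw [homGrad, norm_smul, Real.norm_of_nonneg (by positivity)]
  refine (mul_le_of_le_one_left (norm_nonneg _)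
    (Real.rpow_le_one (by positivity) ((div_le_one hR).mpr hx) (by linarith))).trans ?_
  refine (norm_add_le _ _).trans (add_le_add (le_of_eq ?_) (norm_sub_inner_smul_le _ _))
  rw [norm_smul, norm_usphere, mul_one, norm_div, norm_mul, Real.norm_of_nonneg hR.le,
    Real.norm_of_nonneg (by linarith : 0 ≤ α)]
  ring

/-- The extension is bounded by `M (|h|/R)^α`, which is `o(|h|)` because `α > 1`. -/
theorem hasFDerivAt_homExt_zero {α R M : ℝ} (hα : 1 < α) (hR : 0 < R) {f : USphere n → ℝ}
    (hf : ∀ θ, ‖f θ‖ ≤ M) : HasFDerivAt (homExt α R f) (0 : EucSp n →L[ℝ] ℝ) 0 := by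
  have h0 : homExt α R f (0 : EucSp n) = 0 := by
    simp [homExt, Real.zero_rpow (by linarith : α ≠ 0)]
  rw [hasFDerivAt_iff_isLittleO_nhds_zero, Asymptotics.isLittleO_iff]
  intro ε hε
  have ht : Tendsto (fun h : EucSp n => (‖h‖ / R) ^ (α - 1) * (M / R)) (𝓝 0) (𝓝 0) := by
    have : Continuous fun h : EucSp n => (‖h‖ / R) ^ (α - 1) * (M / R) :=
      ((continuous_norm.div_const R).rpow_const fun _ => Or.inr (by linarith)).mul_const _
    simpa [Real.zero_rpow (by linarith : α - 1 ≠ 0)] using this.tendsto 0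
  filter_upwards [(tendsto_order.mp ht).2 ε hε] with h hh
  simp only [zero_add, h0, sub_zero, zero_apply]
  by_cases hz : h = 0
  · simp [hz, h0]
  have hp : (‖h‖ / R) ^ α = (‖h‖ / R) ^ (α - 1) * (‖h‖ / R) := by
    rw [← Real.rpow_add_one (by positivity)]; ring_nf
  rw [homExt, norm_mul, Real.norm_of_nonneg (by positivity), hp]
  calc (‖h‖ / R) ^ (α - 1) * (‖h‖ / R) * ‖f (direction h)‖
      ≤ (‖h‖ / R) ^ (α - 1) * (‖h‖ / R) * M := by gcongr; exact hf _
    _ = (‖h‖ / R) ^ (α - 1) * (M / R) * ‖h‖ := by ring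
    _ ≤ ε * ‖h‖ := by gcongr

/-- The difference between the homogeneous replacement of `u` in `B_R` and `u`. -/
def replDiff (α R : ℝ) (u : EucSp n → ℝ) : EucSp n → ℝ :=
  (ball (0 : EucSp n) R).indicator fun x => homExt α R (sphereRestrict u R) x - u x

/-- The gradient of `replDiff α R u`, where `G` is the gradient of `u`. -/
def replGrad (α R : ℝ) (u : EucSp n → ℝ) (G : EucSp n → EucSp n) : EucSp n → EucSp n :=
  (ball (0 : EucSp n) R).indicator fun x =>
    homGrad α R (sphereRestrict u R) (fun θ => G (R • (θ : EucSp n))) x - G x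

/-- The difference is differentiable with bounded derivative on the closed ball, which is convex,
hence it is Lipschitz there. It vanishes on the sphere, so its extension by zero is Lipschitz with
compact support and therefore lies in `W^{1,2}_0`. -/
theorem w0Pair_repl_of_contDiffOn {α R R₁ : ℝ} (hα : 1 < α) (hR : 0 < R) (hR₁ : R < R₁)
    {v : EucSp n → ℝ} (hv : ContDiffOn ℝ 1 v (ball 0 R₁)) {Ω : Set (EucSp n)} (hΩ : IsOpen Ω)
    (hball : closedBall 0 R ⊆ Ω) : W0Pair Ω (replDiff α R v) (replGrad α R v (∇ v)) := by
  have hsub : closedBall (0 : EucSp n) R ⊆ ball 0 R₁ := closedBall_subset_ball hR₁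
  have hdiff : ∀ x ∈ closedBall (0 : EucSp n) R, DifferentiableAt ℝ v x := fun x hx =>
    (hv.differentiableOn one_ne_zero).differentiableAt (isOpen_ball.mem_nhds (hsub hx))
  have hθ : ∀ θ : USphere n, R • (θ : EucSp n) ∈ closedBall (0 : EucSp n) R := fun θ => by
    rw [mem_closedBall_zero_iff, norm_smul_usphere hR.le]
  obtain ⟨M, hM⟩ := (isCompact_closedBall (0 : EucSp n) R).exists_bound_of_continuousOn
    (hv.continuousOn.mono hsub)
  obtain ⟨L, hL⟩ := (isCompact_closedBall (0 : EucSp n) R).exists_bound_of_continuousOn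
    ((hv.continuousOn_fderiv_of_isOpen isOpen_ball le_rfl).mono hsub)
  set f := sphereRestrict v R with hf
  set F : USphere n → EucSp n := fun θ => ∇ v (R • (θ : EucSp n)) with hF
  have hfM : ∀ θ, ‖f θ‖ ≤ M := fun θ => hM _ (hθ θ)
  have hFL : ∀ θ, ‖F θ‖ ≤ L := fun θ => by
    rw [hF, norm_gradient]; exact hL _ (hθ θ)
  have hM0 : 0 ≤ M := (norm_nonneg _).trans (hfM (Classical.arbitrary _))
  have hL0 : 0 ≤ L := (norm_nonneg _).trans (hFL (Classical.arbitrary _))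
  -- The bound consists of the radial part `α M / R` and the tangential part `L` of the extension,
  -- plus `L` for `v` itself. The origin needs its own argument, since the direction is not
  -- continuous there.
  have hw : ∀ x ∈ closedBall (0 : EucSp n) R, ∃ D : EucSp n →L[ℝ] ℝ,
      HasFDerivAt (fun x => homExt α R f x - v x) D x ∧ ‖D‖ ≤ α / R * M + L + L := by
    intro x hx
    by_cases hx0 : x = 0
    · refine ⟨0 - fderiv ℝ v x, ?_, ?_⟩
      · exact HasFDerivAt.fun_sub (by rw [hx0]; exact hasFDerivAt_homExt_zero hα hR hfM)
          (hdiff x hx).hasFDerivAt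
      · rw [zero_sub, norm_neg]
        refine (hL x hx).trans ?_
        have : 0 ≤ α / R * M := by positivity
        linarith
    · have h1 := hasGradientAt_homExt (α := α) hR hx0 (hdiff _ (hθ (direction x)))
      refine ⟨_, (hasGradientAt_iff_hasFDerivAt.mp h1).fun_sub (hdiff x hx).hasFDerivAt, ?_⟩
      refine (norm_sub_le _ _).trans (add_le_add ?_ (hL x hx))
      rw [LinearIsometryEquiv.norm_map]
      refine (norm_homGrad_le hα.le hR _ _ (by simpa using hx)).trans ?_
      gcongr
      · exact hfM _
      · exact hFL _
  choose! D hD hDb using hw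
  have hlip : LipschitzOnWith (Real.toNNReal (α / R * M + L + L))
      (fun x => homExt α R f x - v x) (closedBall 0 R) := by
    refine (convex_closedBall 0 R).lipschitzOnWith_of_nnnorm_hasFDerivWithin_le
      (fun x hx => (hD x hx).hasFDerivWithinAt) fun x hx => ?_
    exact NNReal.le_toNNReal_of_coe_le (by simpa using hDb x hx)
  have hzero : ∀ x : EucSp n, ‖x‖ = R → homExt α R f x - v x = 0 := by
    intro x hx
    rw [homExt, hx, div_self hR.ne', Real.one_rpow, one_mul, hf, sphereRestrict, ← hx,
      norm_smul_direction, sub_self]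
  have hd := hlip.indicator_closedBall hzero
  have hts : tsupport (replDiff α R v) ⊆ closedBall 0 R :=
    closure_minimal (fun x hx => by
      by_contra hx'
      exact hx (indicator_of_notMem (fun h => hx' (ball_subset_closedBall h)) _))
      isClosed_closedBall
  have hcs : HasCompactSupport (replDiff α R v) :=
    (isCompact_closedBall _ _).of_isClosed_subset (isClosed_tsupport _) hts
  have hW := LipschitzWith.w0Pair (f := replDiff α R v) hd hcs hΩ (hts.trans hball)
  refine hW.congr_ae (EventuallyEq.refl _ _) ?_
  have hsph : ∀ᵐ x : EucSp n, x ∉ sphere (0 : EucSp n) R :=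
    measure_eq_zero_iff_ae_notMem.mp (Measure.addHaar_sphere _ _ _)
  refine ae_restrict_of_ae ?_
  filter_upwards [hsph, ae_ne_zero n] with x hx hx0
  by_cases hxb : x ∈ ball (0 : EucSp n) R
  · rw [replGrad, indicator_of_mem hxb]
    have h1 := hasGradientAt_homExt (α := α) hR hx0 (hdiff _ (hθ (direction x)))
    have h2 : HasGradientAt (fun x => homExt α R f x - v x) (homGrad α R f F x - ∇ v x) x := by
      rw [hasGradientAt_iff_hasFDerivAt, map_sub]
      exact (hasGradientAt_iff_hasFDerivAt.mp h1).fun_sub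
        (hasGradientAt_iff_hasFDerivAt.mp (hdiff x (ball_subset_closedBall hxb)).hasGradientAt)
    refine (h2.congr_of_eventuallyEq ?_).gradient
    filter_upwards [isOpen_ball.mem_nhds hxb] with y hy
    rw [replDiff, indicator_of_mem hy]
  · rw [replGrad, indicator_of_notMem hxb]
    refine gradient_eq_zero_of_notMem_tsupport fun hx' => ?_
    have := hts hx'
    rw [mem_closedBall_zero_iff] at this
    rw [mem_ball_zero_iff, not_lt] at hxb
    exact hx (by simpa using le_antisymm this hxb)

end

/-! ### Restriction of `L²` functions to spheres -/

section

variable {n : ℕ} [NeZero n] {E : Type*} [NormedAddCommGroup E]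

theorem ae_aestronglyMeasurable_sphere {f : EucSp n → E} {R₁ : ℝ}
    (hf : AEStronglyMeasurable f (volume.restrict (ball 0 R₁))) :
    ∀ᵐ R ∂volume.restrict (Ioo 0 R₁),
      AEStronglyMeasurable (fun θ : USphere n => f (R • (θ : EucSp n))) (sphereMeasure n) := by
  have h := hf.comp_measurePreserving (measurePreserving_polarMap_ball n R₁)
  exact ae_restrict_radialMeasure_iff.mp h.prodMk_left

theorem aemeasurable_lintegral_sphere {f : EucSp n → ENNReal} {R₁ : ℝ}
    (hf : AEMeasurable f (volume.restrict (ball 0 R₁))) :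
    AEMeasurable (fun R => ∫⁻ θ, f (R • (θ : EucSp n)) ∂sphereMeasure n)
      (volume.restrict (Ioo 0 R₁)) := by
  have h : AEMeasurable (fun p => f (polarMap p))
      (((radialMeasure n).restrict (Ioo 0 R₁)).prod (sphereMeasure n)) :=
    ((measurePreserving_polarMap_ball n R₁).map_eq.symm ▸ hf :
      AEMeasurable f _).comp_aemeasurable (measurePreserving_polarMap_ball n R₁).aemeasurable
  have h2 := h.lintegral_prod_right'
  rw [restrict_Ioo_radialMeasure] at h2
  exact h2.mono_ac (withDensity_absolutelyContinuous' (by fun_prop) (ae_ofReal_pow_ne_zero n R₁))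

theorem ae_memLp_sphere {f : EucSp n → E} {R₁ : ℝ}
    (hf : MemLp f 2 (volume.restrict (ball 0 R₁))) :
    ∀ᵐ R ∂volume.restrict (Ioo 0 R₁),
      MemLp (fun θ : USphere n => f (R • (θ : EucSp n))) 2 (sphereMeasure n) := by
  have h1 : ∫⁻ x in ball 0 R₁, ‖f x‖ₑ ^ 2 ≠ ⊤ := by
    rw [← eLpNorm_two_sq]; exact (ENNReal.pow_lt_top hf.2).ne
  rw [lintegral_polar_ball (hf.1.enorm.pow_const 2)] at h1
  have h2 := ae_lt_top' (AEMeasurable.mul (by fun_prop)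
    (aemeasurable_lintegral_sphere (hf.1.enorm.pow_const 2))) h1
  filter_upwards [h2, ae_aestronglyMeasurable_sphere hf.1, ae_ofReal_pow_ne_zero n R₁]
    with R hR hm h0
  refine ⟨hm, ?_⟩
  have h3 : ∫⁻ θ : USphere n, ‖f (R • (θ : EucSp n))‖ₑ ^ 2 ∂sphereMeasure n < ⊤ := by
    by_contra htop
    rw [not_lt, top_le_iff] at htop
    simp only [Pi.mul_apply] at hR
    rw [htop, ENNReal.mul_top h0] at hR
    exact lt_irrefl _ hR
  rw [← eLpNorm_two_sq] at h3
  by_contra htop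
  rw [not_lt, top_le_iff] at htop
  rw [htop] at h3
  simp at h3

/-- A sequence tending to zero in `L²` of a ball has a subsequence that tends to zero in `L²` of
almost every sphere. -/
theorem exists_subseq_ae_sphere {f : ℕ → EucSp n → E} {R₁ : ℝ}
    (hf : ∀ k, AEStronglyMeasurable (f k) (volume.restrict (ball 0 R₁)))
    (h : Tendsto (fun k => eLpNorm (f k) 2 (volume.restrict (ball 0 R₁))) atTop (𝓝 0)) :
    ∃ ns : ℕ → ℕ, StrictMono ns ∧ ∀ᵐ R ∂volume.restrict (Ioo 0 R₁),
      Tendsto (fun k => eLpNorm (fun θ : USphere n => f (ns k) (R • (θ : EucSp n))) 2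
        (sphereMeasure n)) atTop (𝓝 0) := by
  rw [tendsto_eLpNorm_two_iff] at h
  -- Along a subsequence with energies at most `2^(-j)`, the sum of the spherical energies is
  -- integrable in the radius. It is therefore finite at almost every radius, where its terms tend
  -- to zero.
  have hev : ∀ j : ℕ, ∀ᶠ k in atTop,
      ∫⁻ x in ball 0 R₁, ‖f k x‖ₑ ^ 2 ≤ (2⁻¹ : ENNReal) ^ j := fun j =>
    ENNReal.tendsto_nhds_zero.mp h _ (ENNReal.pow_pos (by simp) j)
  obtain ⟨ns, hns, hle⟩ := extraction_forall_of_eventually hev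
  refine ⟨ns, hns, ?_⟩
  set e : ℕ → ℝ → ENNReal := fun j r => ENNReal.ofReal (r ^ (n - 1)) *
    ∫⁻ θ, ‖f (ns j) (r • (θ : EucSp n))‖ₑ ^ 2 ∂sphereMeasure n
  have he : ∀ j, AEMeasurable (e j) (volume.restrict (Ioo 0 R₁)) := fun j =>
    AEMeasurable.mul (by fun_prop)
      (aemeasurable_lintegral_sphere ((hf (ns j)).enorm.pow_const 2))
  have hsum : ∫⁻ r in Ioo 0 R₁, ∑' j, e j r ≠ ⊤ := by
    rw [lintegral_tsum he]
    refine ne_top_of_le_ne_top (b := ∑' j : ℕ, (2⁻¹ : ENNReal) ^ j) ?_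
      (ENNReal.tsum_le_tsum fun j => ?_)
    · rw [ENNReal.tsum_geometric]; simp
    · rw [← lintegral_polar_ball ((hf (ns j)).enorm.pow_const 2)]
      exact hle j
  filter_upwards [ae_lt_top' (AEMeasurable.tsum he) hsum, ae_ofReal_pow_ne_zero n R₁]
    with R hR h0
  rw [tendsto_eLpNorm_two_iff]
  have h1 := ENNReal.tendsto_atTop_zero_of_tsum_ne_top hR.ne
  have h2 := ENNReal.Tendsto.const_mul (a := (ENNReal.ofReal (R ^ (n - 1)))⁻¹) h1
    (Or.inr (by simpa using h0))
  rw [mul_zero] at h2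
  refine h2.congr fun j => ?_
  rw [← mul_assoc, ENNReal.inv_mul_cancel h0 ENNReal.ofReal_ne_top, one_mul]

theorem lintegral_ball_direction {g : USphere n → ENNReal} (hg : AEMeasurable g (sphereMeasure n))
    (R : ℝ) : ∫⁻ x in ball (0 : EucSp n) R, g (direction x) =
      (∫⁻ r in Ioo 0 R, ENNReal.ofReal (r ^ (n - 1))) * ∫⁻ θ, g θ ∂sphereMeasure n := by
  rw [lintegral_polar_ball (f := fun x => g (direction x))
    (hg.comp_quasiMeasurePreserving (quasiMeasurePreserving_direction n)).restrict,
    ← lintegral_mul_const _ (by fun_prop)]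
  refine setLIntegral_congr_fun measurableSet_Ioo fun r hr => ?_
  simp_rw [direction_smul hr.1]

theorem lintegral_ofReal_pow_lt_top (k : ℕ) (R : ℝ) :
    ∫⁻ r in Ioo 0 R, ENNReal.ofReal (r ^ k) < ⊤ := by
  have : IntegrableOn (fun r : ℝ => r ^ k) (Ioo 0 R) :=
    ((continuous_pow k).integrableOn_Icc).mono_set Ioo_subset_Icc_self
  exact (lintegral_mono fun r => Real.ofReal_le_enorm _).trans_lt this.2

/-- The `L²` norm over the ball is a fixed multiple of the norm over the sphere. In this way
convergence on a single sphere controls the homogeneous replacements in the ball that it bounds. -/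
theorem tendsto_eLpNorm_comp_direction {b : ℕ → USphere n → E}
    (hb : ∀ k, AEStronglyMeasurable (b k) (sphereMeasure n))
    (h : Tendsto (fun k => eLpNorm (b k) 2 (sphereMeasure n)) atTop (𝓝 0)) (R : ℝ) :
    Tendsto (fun k => eLpNorm (fun x => b k (direction x)) 2
      (volume.restrict (ball (0 : EucSp n) R))) atTop (𝓝 0) := by
  rw [tendsto_eLpNorm_two_iff] at h ⊢
  have h2 := ENNReal.Tendsto.const_mul h
    (Or.inr (lintegral_ofReal_pow_lt_top (n - 1) R).ne)
  rw [mul_zero] at h2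
  refine h2.congr fun k => ?_
  rw [lintegral_ball_direction (g := fun θ => ‖b k θ‖ₑ ^ 2) ((hb k).enorm.pow_const 2)]

theorem memLp_comp_direction {b : USphere n → E} (hb : MemLp b 2 (sphereMeasure n)) (R : ℝ) :
    MemLp (fun x => b (direction x)) 2 (volume.restrict (ball (0 : EucSp n) R)) := by
  refine ⟨(hb.1.comp_quasiMeasurePreserving (quasiMeasurePreserving_direction n)).restrict, ?_⟩
  have h : ∫⁻ x in ball (0 : EucSp n) R, ‖b (direction x)‖ₑ ^ 2 < ⊤ := by
    rw [lintegral_ball_direction (g := fun θ => ‖b θ‖ₑ ^ 2) (hb.1.enorm.pow_const 2),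
      ← eLpNorm_two_sq]
    exact ENNReal.mul_lt_top (lintegral_ofReal_pow_lt_top (n - 1) R) (ENNReal.pow_lt_top hb.2)
  rw [← eLpNorm_two_sq] at h
  by_contra htop
  rw [not_lt, top_le_iff] at htop
  rw [htop] at h
  simp at h

end

section

variable {n : ℕ}

theorem eLpNorm_indicator_ball {E : Type*} [NormedAddCommGroup E] {Ω : Set (EucSp n)} {R : ℝ}
    (hball : ball 0 R ⊆ Ω) (f : EucSp n → E) :
    eLpNorm ((ball (0 : EucSp n) R).indicator f) 2 (volume.restrict Ω) =
      eLpNorm f 2 (volume.restrict (ball 0 R)) := by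
  rw [eLpNorm_indicator_eq_eLpNorm_restrict measurableSet_ball,
    Measure.restrict_restrict measurableSet_ball, inter_eq_self_of_subset_left hball]

theorem memLp_indicator_ball {E : Type*} [NormedAddCommGroup E] {Ω : Set (EucSp n)} {R : ℝ}
    {f : EucSp n → E} (hf : MemLp f 2 (volume.restrict (ball 0 R))) :
    MemLp ((ball (0 : EucSp n) R).indicator f) 2 (volume.restrict Ω) :=
  ((memLp_indicator_iff_restrict measurableSet_ball).mpr hf).restrict Ω

theorem tendsto_eLpNorm_mono_set {E : Type*} [NormedAddCommGroup E] {s t : Set (EucSp n)}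
    (hst : s ⊆ t) {f : ℕ → EucSp n → E}
    (h : Tendsto (fun k => eLpNorm (f k) 2 (volume.restrict t)) atTop (𝓝 0)) :
    Tendsto (fun k => eLpNorm (f k) 2 (volume.restrict s)) atTop (𝓝 0) :=
  tendsto_of_tendsto_of_tendsto_of_le_of_le tendsto_const_nhds h (fun _ => zero_le)
    fun k => eLpNorm_mono_measure (f k) (Measure.restrict_mono hst le_rfl)

end

section

variable {n : ℕ} [NeZero n]

/-! ### Approximation by smooth functions on balls and spheres -/

/-- The approximants are mollifications of the extension by zero. The margin `R₀ - R₁` is needed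
because mollification commutes with the weak gradient only away from the boundary. -/
theorem exists_smooth_approx {R₀ R₁ : ℝ} (hR₁ : R₁ < R₀) {u : EucSp n → ℝ}
    {G : EucSp n → EucSp n} (h : MemW12 (ball 0 R₀) u G) :
    ∃ U : ℕ → EucSp n → ℝ, (∀ k, ContDiff ℝ 1 (U k)) ∧
      Tendsto (fun k => eLpNorm (fun x => u x - U k x) 2 (volume.restrict (ball 0 R₁)))
        atTop (𝓝 0) ∧
      Tendsto (fun k => eLpNorm (fun x => G x - ∇ (U k) x) 2 (volume.restrict (ball 0 R₁)))
        atTop (𝓝 0) ∧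
      ∀ᵐ R ∂volume.restrict (Ioo 0 R₁),
        Tendsto (fun k => eLpNorm (fun θ : USphere n => u (R • (θ : EucSp n)) -
          U k (R • (θ : EucSp n))) 2 (sphereMeasure n)) atTop (𝓝 0) ∧
        Tendsto (fun k => eLpNorm (fun θ : USphere n => G (R • (θ : EucSp n)) -
          ∇ (U k) (R • (θ : EucSp n))) 2 (sphereMeasure n)) atTop (𝓝 0) := by
  have m1 : MemLp ((ball 0 R₀).indicator u) 2 :=
    (memLp_indicator_iff_restrict measurableSet_ball).mpr h.memLp
  have m2 : MemLp ((ball 0 R₀).indicator G) 2 :=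
    (memLp_indicator_iff_restrict measurableSet_ball).mpr h.memLp_grad
  have hsub : ball (0 : EucSp n) R₁ ⊆ ball 0 R₀ := ball_subset_ball hR₁.le
  obtain ⟨k₀, hk₀⟩ := ((tendsto_order.mp (tendsto_mollBump_rOut n)).2 (R₀ - R₁)
    (by linarith)).exists
  rw [mollBump_rOut] at hk₀
  set V : ℕ → EucSp n → ℝ := fun k => mollify (k + k₀) ((ball 0 R₀).indicator u) with hV
  have hVs : ∀ k, ContDiff ℝ 1 (V k) := fun k =>
    (contDiff_mollify _ (m1.locallyIntegrable (by norm_num))).of_le (by exact_mod_cast le_top)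
  have hgrad : ∀ k, ∀ x ∈ ball (0 : EucSp n) R₁,
      ∇ (V k) x = mollify (k + k₀) ((ball 0 R₀).indicator G) x := by
    intro k x hx
    refine (h.hasGradientAt_mollify measurableSet_ball fun y hy => ?_).gradient
    rw [mem_ball_zero_iff] at hx ⊢
    rw [mem_closedBall, dist_eq_norm] at hy
    have h1 : 1 / (((k + k₀ : ℕ) : ℝ) + 1) ≤ 1 / ((k₀ : ℝ) + 1) := by
      push_cast
      gcongr
      linarith [(Nat.cast_nonneg k : (0 : ℝ) ≤ k)]
    have h2 : ‖y‖ ≤ ‖y - x‖ + ‖x‖ := by simpa using norm_add_le (y - x) x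
    linarith
  have c1 : Tendsto (fun k => eLpNorm (fun x => u x - V k x) 2 (volume.restrict (ball 0 R₁)))
      atTop (𝓝 0) := by
    refine tendsto_of_tendsto_of_tendsto_of_le_of_le tendsto_const_nhds
      ((tendsto_mollify m1).comp (tendsto_add_atTop_nat k₀)) (fun _ => zero_le) fun k => ?_
    simp only [Function.comp]
    rw [← eLpNorm_sub_comm]
    refine le_trans (le_of_eq (eLpNorm_congr_ae ?_)) (eLpNorm_mono_measure _ Measure.restrict_le_self)
    filter_upwards [ae_restrict_mem measurableSet_ball] with x hx
    simp [hV, hsub hx]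
  have c2 : Tendsto (fun k => eLpNorm (fun x => G x - ∇ (V k) x) 2 (volume.restrict (ball 0 R₁)))
      atTop (𝓝 0) := by
    refine tendsto_of_tendsto_of_tendsto_of_le_of_le tendsto_const_nhds
      ((tendsto_mollify m2).comp (tendsto_add_atTop_nat k₀)) (fun _ => zero_le) fun k => ?_
    simp only [Function.comp]
    rw [← eLpNorm_sub_comm]
    refine le_trans (le_of_eq (eLpNorm_congr_ae ?_)) (eLpNorm_mono_measure _ Measure.restrict_le_self)
    filter_upwards [ae_restrict_mem measurableSet_ball] with x hx
    simp [hgrad k x hx, hsub hx]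
  have hu := (h.mono hsub measurableSet_ball).memLp.1
  have hG := (h.mono hsub measurableSet_ball).memLp_grad.1
  -- Two successive extractions: the first serves the functions, the second, taken inside it, the
  -- gradients.
  obtain ⟨ns, hns, a1⟩ := exists_subseq_ae_sphere
    (fun k => hu.sub (hVs k).continuous.aestronglyMeasurable) c1
  obtain ⟨ms, hms, a2⟩ := exists_subseq_ae_sphere
    (fun k => hG.sub (continuous_gradient (hVs (ns k))).aestronglyMeasurable)
    (c2.comp hns.tendsto_atTop)
  refine ⟨fun k => V (ns (ms k)), fun k => hVs _,
    (c1.comp hns.tendsto_atTop).comp hms.tendsto_atTop,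
    (c2.comp hns.tendsto_atTop).comp hms.tendsto_atTop, ?_⟩
  filter_upwards [a1, a2] with R h1 h2
  exact ⟨h1.comp hms.tendsto_atTop, h2⟩

theorem aestronglyMeasurable_homExt {α R : ℝ} {f : USphere n → ℝ}
    (hf : AEStronglyMeasurable f (sphereMeasure n)) : AEStronglyMeasurable (homExt α R f) := by
  refine AEStronglyMeasurable.mul ?_
    (hf.comp_quasiMeasurePreserving (quasiMeasurePreserving_direction n))
  exact (by fun_prop : Measurable fun x : EucSp n => (‖x‖ / R) ^ α).aestronglyMeasurable

theorem aestronglyMeasurable_homGrad {α R : ℝ} {f : USphere n → ℝ} {F : USphere n → EucSp n}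
    (hf : AEStronglyMeasurable f (sphereMeasure n)) (hF : AEStronglyMeasurable F (sphereMeasure n)) :
    AEStronglyMeasurable (homGrad α R f F) := by
  have h1 := hf.comp_quasiMeasurePreserving (quasiMeasurePreserving_direction n)
  have h2 := hF.comp_quasiMeasurePreserving (quasiMeasurePreserving_direction n)
  have h3 : AEStronglyMeasurable (fun x : EucSp n => (direction x : EucSp n)) :=
    (measurable_subtype_coe.comp measurable_direction).aestronglyMeasurable
  have h4 : AEStronglyMeasurable (fun x => inner ℝ (F (direction x)) (direction x : EucSp n)) :=
    h2.inner h3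
  have h5 : AEStronglyMeasurable (fun x => inner ℝ (F (direction x)) (direction x : EucSp n) •
      (direction x : EucSp n)) := h4.smul h3
  have h6 : AEStronglyMeasurable (fun x : EucSp n => α * f (direction x) / R) := by
    simpa [div_eq_mul_inv] using (h1.const_mul α).mul_const R⁻¹
  have h7 : AEStronglyMeasurable (fun x : EucSp n => (‖x‖ / R) ^ (α - 1)) :=
    (by fun_prop : Measurable fun x : EucSp n => (‖x‖ / R) ^ (α - 1)).aestronglyMeasurable
  exact h7.smul ((h6.smul h3).add (h2.sub h5))

theorem memLp_homExt {α R : ℝ} (hα : 0 ≤ α) (hR : 0 < R) {f : USphere n → ℝ}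
    (hf : MemLp f 2 (sphereMeasure n)) :
    MemLp (homExt α R f) 2 (volume.restrict (ball 0 R)) := by
  refine (memLp_comp_direction hf R).of_le (aestronglyMeasurable_homExt hf.1).restrict ?_
  filter_upwards [ae_restrict_mem measurableSet_ball] with x hx
  exact norm_homExt_le hα hR f (mem_ball_zero_iff.mp hx).le

theorem memLp_homGrad {α R : ℝ} (hα : 1 ≤ α) (hR : 0 < R) {f : USphere n → ℝ}
    {F : USphere n → EucSp n} (hf : MemLp f 2 (sphereMeasure n))
    (hF : MemLp F 2 (sphereMeasure n)) :
    MemLp (homGrad α R f F) 2 (volume.restrict (ball 0 R)) := by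
  refine (((memLp_comp_direction hf R).norm.const_mul (α / R)).add
    (memLp_comp_direction hF R).norm).of_le (aestronglyMeasurable_homGrad hf.1 hF.1).restrict ?_
  filter_upwards [ae_restrict_mem measurableSet_ball] with x hx
  refine (norm_homGrad_le hα hR f F (mem_ball_zero_iff.mp hx).le).trans ?_
  exact le_abs_self _

theorem homExt_sub (α R : ℝ) (f g : USphere n → ℝ) (x : EucSp n) :
    homExt α R f x - homExt α R g x = homExt α R (fun θ => f θ - g θ) x := by
  simp only [homExt]; ring

theorem homGrad_sub (α R : ℝ) (f g : USphere n → ℝ) (F H : USphere n → EucSp n) (x : EucSp n) :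
    homGrad α R f F x - homGrad α R g H x =
      homGrad α R (fun θ => f θ - g θ) (fun θ => F θ - H θ) x := by
  simp only [homGrad]
  rw [← smul_sub, inner_sub_left, mul_sub, sub_div, sub_smul, sub_smul]
  congr 1
  abel

theorem tendsto_homExt {α R : ℝ} (hα : 0 ≤ α) (hR : 0 < R) {f : ℕ → USphere n → ℝ}
    (hf : ∀ k, AEStronglyMeasurable (f k) (sphereMeasure n))
    (h : Tendsto (fun k => eLpNorm (f k) 2 (sphereMeasure n)) atTop (𝓝 0)) :
    Tendsto (fun k => eLpNorm (homExt α R (f k)) 2 (volume.restrict (ball 0 R))) atTop (𝓝 0) := by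
  refine tendsto_of_tendsto_of_tendsto_of_le_of_le tendsto_const_nhds
    (tendsto_eLpNorm_comp_direction hf h R) (fun _ => zero_le) fun k => ?_
  refine eLpNorm_mono_ae ?_
  filter_upwards [ae_restrict_mem measurableSet_ball] with x hx
  exact norm_homExt_le hα hR _ (mem_ball_zero_iff.mp hx).le

theorem tendsto_homGrad {α R : ℝ} (hα : 1 ≤ α) (hR : 0 < R) {f : ℕ → USphere n → ℝ}
    {F : ℕ → USphere n → EucSp n}
    (hf : ∀ k, AEStronglyMeasurable (f k) (sphereMeasure n))
    (hF : ∀ k, AEStronglyMeasurable (F k) (sphereMeasure n))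
    (h : Tendsto (fun k => eLpNorm (f k) 2 (sphereMeasure n)) atTop (𝓝 0))
    (h' : Tendsto (fun k => eLpNorm (F k) 2 (sphereMeasure n)) atTop (𝓝 0)) :
    Tendsto (fun k => eLpNorm (homGrad α R (f k) (F k)) 2 (volume.restrict (ball 0 R)))
      atTop (𝓝 0) := by
  have t1 := ENNReal.Tendsto.const_mul (a := ‖α / R‖ₑ) (tendsto_eLpNorm_comp_direction hf h R)
    (Or.inr (by simp))
  have t2 := t1.add (tendsto_eLpNorm_comp_direction hF h' R)
  rw [mul_zero, add_zero] at t2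
  refine tendsto_of_tendsto_of_tendsto_of_le_of_le tendsto_const_nhds t2
    (fun _ => zero_le) fun k => ?_
  have m1 := ((hf k).comp_quasiMeasurePreserving (quasiMeasurePreserving_direction n)).restrict
    (s := ball (0 : EucSp n) R)
  have m2 := ((hF k).comp_quasiMeasurePreserving (quasiMeasurePreserving_direction n)).restrict
    (s := ball (0 : EucSp n) R)
  calc eLpNorm (homGrad α R (f k) (F k)) 2 (volume.restrict (ball 0 R))
      ≤ eLpNorm ((α / R) • (fun x => ‖f k (direction x)‖) + fun x => ‖F k (direction x)‖) 2
          (volume.restrict (ball 0 R)) := by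
        refine eLpNorm_mono_ae ?_
        filter_upwards [ae_restrict_mem measurableSet_ball] with x hx
        exact (norm_homGrad_le hα hR _ _ (mem_ball_zero_iff.mp hx).le).trans (le_abs_self _)
    _ ≤ _ := by
        refine (eLpNorm_add_le (m1.norm.const_smul _) m2.norm (by norm_num)).trans ?_
        refine add_le_add (le_of_eq ?_) (le_of_eq (eLpNorm_norm _))
        rw [eLpNorm_const_smul, eLpNorm_norm]
        rfl

/-- On almost every ball, the difference between the homogeneous replacement of a Sobolev
function and the function itself belongs to `W^{1,2}_0`. -/
theorem ae_w0Pair_repl {α R₀ : ℝ} (hα : 1 < α) {u : EucSp n → ℝ}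
    {G : EucSp n → EucSp n} (h : MemW12 (ball 0 R₀) u G) {Ω : Set (EucSp n)} (hΩ : IsOpen Ω)
    (hball : ball 0 R₀ ⊆ Ω) {R₁ : ℝ} (hR₁ : R₁ < R₀) :
    ∀ᵐ R ∂volume.restrict (Ioo 0 R₁), W0Pair Ω (replDiff α R u) (replGrad α R u G) := by
  obtain ⟨U, hU, c1, c2, hae⟩ := exists_smooth_approx hR₁ h
  have h₁ := h.mono (ball_subset_ball hR₁.le) measurableSet_ball
  filter_upwards [hae, ae_memLp_sphere h₁.memLp, ae_memLp_sphere h₁.memLp_grad,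
    ae_restrict_mem measurableSet_Ioo] with R ⟨s1, s2⟩ m1 m2 hR
  have hsub : ball (0 : EucSp n) R ⊆ ball 0 R₁ := ball_subset_ball hR.2.le
  have hRΩ : ball (0 : EucSp n) R ⊆ Ω := (hsub.trans (ball_subset_ball hR₁.le)).trans hball
  have h₂ := h₁.mono hsub measurableSet_ball
  have c1' := tendsto_eLpNorm_mono_set hsub c1
  have c2' := tendsto_eLpNorm_mono_set hsub c2
  have hcoe : Continuous fun θ : USphere n => R • (θ : EucSp n) := by fun_prop
  have q1 : ∀ k, AEStronglyMeasurable (fun θ : USphere n => u (R • (θ : EucSp n)) -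
      U k (R • (θ : EucSp n))) (sphereMeasure n) := fun k =>
    m1.1.sub ((hU k).continuous.comp hcoe).aestronglyMeasurable
  have q2 : ∀ k, AEStronglyMeasurable (fun θ : USphere n => G (R • (θ : EucSp n)) -
      ∇ (U k) (R • (θ : EucSp n))) (sphereMeasure n) := fun k =>
    m2.1.sub ((continuous_gradient (hU k)).comp hcoe).aestronglyMeasurable
  have e1 := tendsto_homExt (α := α) (by linarith) hR.1 q1 s1
  have e2 := tendsto_homGrad (α := α) hα.le hR.1 q1 q2 s1 s2
  -- The extension term converges because of convergence on the sphere of radius `R`, for functions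
  -- and gradients alike; the remaining term converges because of convergence in the ball.
  refine W0Pair.of_tendsto (w := fun k => replDiff α R (U k))
    (H := fun k => replGrad α R (U k) (∇ (U k)))
    (fun k => w0Pair_repl_of_contDiffOn hα hR.1 hR.2 (hU k).contDiffOn hΩ ?_)
    (memLp_indicator_ball ((memLp_homExt (by linarith) hR.1 m1).sub h₂.memLp))
    (memLp_indicator_ball ((memLp_homGrad hα.le hR.1 m1 m2).sub h₂.memLp_grad)) ?_ ?_
  · exact (closedBall_subset_ball (hR.2.trans hR₁)).trans hball
  · have t := e1.add c1'
    rw [add_zero] at t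
    refine tendsto_of_tendsto_of_tendsto_of_le_of_le tendsto_const_nhds t
      (fun _ => zero_le) fun k => ?_
    have heq : (fun x => replDiff α R u x - replDiff α R (U k) x) =
        (ball (0 : EucSp n) R).indicator (homExt α R (fun θ => u (R • (θ : EucSp n)) -
          U k (R • (θ : EucSp n))) - fun x => u x - U k x) := by
      ext1 x
      by_cases hx : x ∈ ball (0 : EucSp n) R
      · simp only [replDiff, indicator_of_mem hx, Pi.sub_apply]
        rw [← homExt_sub]
        unfold sphereRestrict
        ring
      · simp [replDiff, hx]
    simp only
    rw [heq, eLpNorm_indicator_ball hRΩ]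
    exact eLpNorm_sub_le (aestronglyMeasurable_homExt (q1 k)).restrict
      (h₂.memLp.1.sub (hU k).continuous.aestronglyMeasurable) (by norm_num)
  · have t := e2.add c2'
    rw [add_zero] at t
    refine tendsto_of_tendsto_of_tendsto_of_le_of_le tendsto_const_nhds t
      (fun _ => zero_le) fun k => ?_
    have heq : (fun x => replGrad α R u G x - replGrad α R (U k) (∇ (U k)) x) =
        (ball (0 : EucSp n) R).indicator (homGrad α R (fun θ => u (R • (θ : EucSp n)) -
          U k (R • (θ : EucSp n))) (fun θ => G (R • (θ : EucSp n)) - ∇ (U k) (R • (θ : EucSp n)))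
          - fun x => G x - ∇ (U k) x) := by
      ext1 x
      by_cases hx : x ∈ ball (0 : EucSp n) R
      · simp only [replGrad, indicator_of_mem hx, Pi.sub_apply]
        rw [← homGrad_sub]
        unfold sphereRestrict
        abel
      · simp [replGrad, hx]
    simp only
    rw [heq, eLpNorm_indicator_ball hRΩ]
    exact eLpNorm_sub_le (aestronglyMeasurable_homGrad (q1 k) (q2 k)).restrict
      (h₂.memLp_grad.1.sub (continuous_gradient (hU k)).aestronglyMeasurable) (by norm_num)

end

/-! ### Absolute continuity along rays -/

section

variable {n : ℕ}

theorem sub_eq_integral_inner_gradient {V : EucSp n → ℝ} {R₁ : ℝ}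
    (hV : ContDiffOn ℝ 1 V (ball 0 R₁)) {r R : ℝ} (hr : 0 < r) (hrR : r ≤ R) (hR : R < R₁)
    (θ : USphere n) :
    IntervalIntegrable (fun t => inner ℝ (∇ V (t • (θ : EucSp n))) (θ : EucSp n)) volume r R ∧
    V (R • (θ : EucSp n)) - V (r • (θ : EucSp n)) =
      ∫ t in r..R, inner ℝ (∇ V (t • (θ : EucSp n))) (θ : EucSp n) := by
  have hmem : ∀ t ∈ uIcc r R, t • (θ : EucSp n) ∈ ball (0 : EucSp n) R₁ := by
    intro t ht
    rw [uIcc_of_le hrR] at ht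
    rw [mem_ball_zero_iff, norm_smul_usphere (hr.le.trans ht.1)]
    exact ht.2.trans_lt hR
  have hc : ContinuousOn (fun t : ℝ => fderiv ℝ V (t • (θ : EucSp n)) (θ : EucSp n)) (uIcc r R) :=
    ((hV.continuousOn_fderiv_of_isOpen isOpen_ball le_rfl).comp (by fun_prop) hmem).clm_apply
      continuousOn_const
  simp only [inner_gradient_eq_fderiv]
  refine ⟨hc.intervalIntegrable, ?_⟩
  rw [intervalIntegral.integral_eq_sub_of_hasDerivAt (f := fun t => V (t • (θ : EucSp n)))]
  · intro t ht
    have h1 := ((hV.differentiableOn one_ne_zero).differentiableAt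
      (isOpen_ball.mem_nhds (hmem t ht))).hasFDerivAt
    have h2 : HasDerivAt (fun t : ℝ => t • (θ : EucSp n)) (θ : EucSp n) t := by
      simpa using (hasDerivAt_id t).smul_const (θ : EucSp n)
    exact h1.comp_hasDerivAt t h2
  · exact hc.intervalIntegrable

end

section

variable {n : ℕ} [NeZero n] {E : Type*} [NormedAddCommGroup E]

/-- Away from the origin the weight `t^(n-1)` is at least `r^(n-1)`, so it can be dropped at the
cost of a constant. -/
theorem lintegral_annulus_le {f : EucSp n → ENNReal} {r R₁ : ℝ} (hr : 0 < r)
    (hf : AEMeasurable f (volume.restrict (ball 0 R₁))) :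
    ∫⁻ t in Ioo r R₁, ∫⁻ θ, f (t • (θ : EucSp n)) ∂sphereMeasure n ≤
      (ENNReal.ofReal (r ^ (n - 1)))⁻¹ * ∫⁻ x in ball 0 R₁, f x := by
  have h0 : ENNReal.ofReal (r ^ (n - 1)) ≠ 0 := by simpa using pow_pos hr (n - 1)
  have h1 : ENNReal.ofReal (r ^ (n - 1)) *
      ∫⁻ t in Ioo r R₁, ∫⁻ θ, f (t • (θ : EucSp n)) ∂sphereMeasure n ≤ ∫⁻ x in ball 0 R₁, f x := by
    rw [lintegral_polar_ball hf, ← lintegral_const_mul' _ _ ENNReal.ofReal_ne_top]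
    refine (setLIntegral_mono' measurableSet_Ioo fun t ht => ?_).trans
      (lintegral_mono_set (Ioo_subset_Ioo_left hr.le))
    have : r ≤ t := ht.1.le
    gcongr
  calc _ = (ENNReal.ofReal (r ^ (n - 1)))⁻¹ * (ENNReal.ofReal (r ^ (n - 1)) *
      ∫⁻ t in Ioo r R₁, ∫⁻ θ, f (t • (θ : EucSp n)) ∂sphereMeasure n) := by
        rw [← mul_assoc, ENNReal.inv_mul_cancel h0 ENNReal.ofReal_ne_top, one_mul]
    _ ≤ _ := by gcongr

theorem aestronglyMeasurable_polar {f : EucSp n → E} {r R₁ : ℝ} (hr : 0 ≤ r)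
    (hf : AEStronglyMeasurable f (volume.restrict (ball 0 R₁))) :
    AEStronglyMeasurable (fun p : ℝ × USphere n => f (p.1 • (p.2 : EucSp n)))
      ((volume.restrict (Ioo r R₁)).prod (sphereMeasure n)) := by
  have h := hf.comp_measurePreserving (measurePreserving_polarMap_ball n R₁)
  refine AEStronglyMeasurable.mono_ac ?_ h
  refine Measure.AbsolutelyContinuous.prod ?_ Measure.AbsolutelyContinuous.rfl
  rw [restrict_Ioo_radialMeasure]
  exact (Measure.restrict_mono (Ioo_subset_Ioo_left hr) le_rfl).absolutelyContinuous.trans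
    (withDensity_absolutelyContinuous' (by fun_prop) (ae_ofReal_pow_ne_zero n R₁))

theorem integrable_polar_annulus {f : EucSp n → E} {r R₁ : ℝ} (hr : 0 < r)
    (hf : IntegrableOn f (ball 0 R₁)) :
    Integrable (fun p : ℝ × USphere n => f (p.1 • (p.2 : EucSp n)))
      ((volume.restrict (Ioo r R₁)).prod (sphereMeasure n)) := by
  have hm := aestronglyMeasurable_polar (n := n) hr.le hf.1
  refine ⟨hm, ?_⟩
  rw [hasFiniteIntegral_iff_enorm, lintegral_prod _ hm.enorm]
  have h0 : ENNReal.ofReal (r ^ (n - 1)) ≠ 0 := by simpa using pow_pos hr (n - 1)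
  refine (lintegral_annulus_le hr hf.1.enorm).trans_lt (ENNReal.mul_lt_top ?_ hf.2)
  simpa using pow_pos hr (n - 1)

/-- Integration of a weak gradient along almost every ray, for limits of smooth functions. -/
theorem ae_sub_eq_integral_inner {V : ℕ → EucSp n → ℝ} {v : EucSp n → ℝ} {P : EucSp n → EucSp n}
    {R₁ : ℝ} (hV : ∀ k, ContDiffOn ℝ 1 (V k) (ball 0 R₁)) (hP : IntegrableOn P (ball 0 R₁))
    (hc : Tendsto (fun k => eLpNorm (fun x => P x - ∇ (V k) x) 1 (volume.restrict (ball 0 R₁)))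
      atTop (𝓝 0))
    {r R : ℝ} (hr : 0 < r) (hrR : r < R) (hR : R < R₁)
    (mr : AEStronglyMeasurable (fun θ : USphere n => v (r • (θ : EucSp n))) (sphereMeasure n))
    (mR : AEStronglyMeasurable (fun θ : USphere n => v (R • (θ : EucSp n))) (sphereMeasure n))
    (cr : Tendsto (fun k => eLpNorm (fun θ : USphere n => v (r • (θ : EucSp n)) -
      V k (r • (θ : EucSp n))) 1 (sphereMeasure n)) atTop (𝓝 0))
    (cR : Tendsto (fun k => eLpNorm (fun θ : USphere n => v (R • (θ : EucSp n)) -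
      V k (R • (θ : EucSp n))) 1 (sphereMeasure n)) atTop (𝓝 0)) :
    ∀ᵐ θ : USphere n ∂sphereMeasure n, v (R • (θ : EucSp n)) - v (r • (θ : EucSp n)) =
      ∫ t in r..R, inner ℝ (P (t • (θ : EucSp n))) (θ : EucSp n) := by
  simp only [eLpNorm_one_eq_lintegral_enorm] at hc cr cR
  have hsub : Ioc r R ⊆ Ioo r R₁ := fun t ht => ⟨ht.1, ht.2.trans_lt hR⟩
  have hPp := integrable_polar_annulus (n := n) hr hP
  have hθm : AEStronglyMeasurable (fun p : ℝ × USphere n => (p.2 : EucSp n))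
      ((volume.restrict (Ioo r R₁)).prod (sphereMeasure n)) :=
    (continuous_subtype_val.comp continuous_snd).aestronglyMeasurable
  have hIp : Integrable (fun p : ℝ × USphere n =>
      inner ℝ (P (p.1 • (p.2 : EucSp n))) (p.2 : EucSp n))
      ((volume.restrict (Ioo r R₁)).prod (sphereMeasure n)) := by
    refine hPp.norm.mono (hPp.1.inner hθm) (.of_forall fun p => ?_)
    refine (norm_inner_le_norm _ _).trans ?_
    simp
  have hIp' : Integrable (fun p : ℝ × USphere n =>
      inner ℝ (P (p.1 • (p.2 : EucSp n))) (p.2 : EucSp n))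
      ((volume.restrict (Ioc r R)).prod (sphereMeasure n)) :=
    hIp.mono_measure (Measure.prod_mono (Measure.restrict_mono hsub le_rfl) le_rfl)
  set X : USphere n → ℝ := fun θ => v (R • (θ : EucSp n)) - v (r • (θ : EucSp n)) -
      ∫ t in r..R, inner ℝ (P (t • (θ : EucSp n))) (θ : EucSp n) with hX
  have hXm : AEStronglyMeasurable X (sphereMeasure n) := by
    refine (mR.sub mr).sub ?_
    simp only [intervalIntegral.integral_of_le hrR.le]
    exact hIp'.integral_prod_right.1
  -- The defect `X` of the identity vanishes for each smooth `V k`. Its `L¹` norm is thus at most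
  -- the sum of the three approximation errors: on the two spheres and, for the gradient, in the
  -- annulus.
  have hXle : ∀ k, ∫⁻ θ, ‖X θ‖ₑ ∂sphereMeasure n ≤
      (∫⁻ θ : USphere n, ‖v (R • (θ : EucSp n)) - V k (R • (θ : EucSp n))‖ₑ ∂sphereMeasure n +
        ∫⁻ θ : USphere n, ‖v (r • (θ : EucSp n)) - V k (r • (θ : EucSp n))‖ₑ ∂sphereMeasure n) +
      (ENNReal.ofReal (r ^ (n - 1)))⁻¹ * ∫⁻ x in ball 0 R₁, ‖P x - ∇ (V k) x‖ₑ := by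
    intro k
    have hmD : AEStronglyMeasurable (fun x => P x - ∇ (V k) x) (volume.restrict (ball 0 R₁)) :=
      hP.1.sub (measurable_gradient (V k)).aestronglyMeasurable
    have hmV : ∀ s, 0 < s → s < R₁ → Continuous fun θ : USphere n => V k (s • (θ : EucSp n)) := by
      intro s hs hs1
      refine (hV k).continuousOn.comp_continuous (by fun_prop) fun θ => ?_
      rwa [mem_ball_zero_iff, norm_smul_usphere hs.le]
    have h1 := lintegral_annulus_le (n := n) hr hmD.enorm
    rw [lintegral_lintegral_swap (aestronglyMeasurable_polar (n := n) hr.le hmD).enorm] at h1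
    refine le_trans ?_ (add_le_add_right h1 _)
    have aR : AEMeasurable (fun θ : USphere n =>
        ‖v (R • (θ : EucSp n)) - V k (R • (θ : EucSp n))‖ₑ) (sphereMeasure n) :=
      (mR.sub (hmV R (hr.trans hrR) hR).aestronglyMeasurable).enorm
    have ar : AEMeasurable (fun θ : USphere n =>
        ‖v (r • (θ : EucSp n)) - V k (r • (θ : EucSp n))‖ₑ) (sphereMeasure n) :=
      (mr.sub (hmV r hr (hrR.trans hR)).aestronglyMeasurable).enorm
    have aRr : AEMeasurable (fun θ : USphere n =>
        ‖v (R • (θ : EucSp n)) - V k (R • (θ : EucSp n))‖ₑ +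
        ‖v (r • (θ : EucSp n)) - V k (r • (θ : EucSp n))‖ₑ) (sphereMeasure n) := aR.add ar
    rw [← lintegral_add_left' aR, ← lintegral_add_left' aRr]
    refine lintegral_mono_ae ?_
    filter_upwards [hIp'.prod_left_ae] with θ hθ
    obtain ⟨i1, e1⟩ := sub_eq_integral_inner_gradient (hV k) hr hrR.le hR θ
    have i2 : IntervalIntegrable (fun t => inner ℝ (P (t • (θ : EucSp n))) (θ : EucSp n))
        volume r R := by
      rw [intervalIntegrable_iff_integrableOn_Ioc_of_le hrR.le]
      exact hθ
    have hXe : X θ = (v (R • (θ : EucSp n)) - V k (R • (θ : EucSp n))) -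
        (v (r • (θ : EucSp n)) - V k (r • (θ : EucSp n))) -
        ∫ t in r..R, inner ℝ (P (t • (θ : EucSp n)) - ∇ (V k) (t • (θ : EucSp n)))
          (θ : EucSp n) := by
      simp only [inner_sub_left]
      rw [intervalIntegral.integral_sub i2 i1, ← e1, hX]
      ring
    rw [hXe]
    refine enorm_sub_le.trans (add_le_add enorm_sub_le ?_)
    rw [intervalIntegral.integral_of_le hrR.le]
    refine (enorm_integral_le_lintegral_enorm _).trans ((lintegral_mono_set hsub).trans ?_)
    refine lintegral_mono fun t => ?_
    rw [← ofReal_norm, ← ofReal_norm]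
    refine ENNReal.ofReal_le_ofReal ((norm_inner_le_norm _ _).trans ?_)
    simp
  have ht := ((cR.add cr).add (ENNReal.Tendsto.const_mul
    (a := (ENNReal.ofReal (r ^ (n - 1)))⁻¹) hc (Or.inr (by simpa using pow_pos hr (n - 1)))))
  simp only [mul_zero, add_zero] at ht
  have h0 : ∫⁻ θ, ‖X θ‖ₑ ∂sphereMeasure n = 0 :=
    le_antisymm (ge_of_tendsto' ht hXle) zero_le
  rw [lintegral_eq_zero_iff' hXm.enorm] at h0
  filter_upwards [h0] with θ hθ
  simpa [hX, sub_eq_zero] using hθ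

/-- The splitting `f₀g₀ - fg = (f₀-f)g₀ + f₀(g₀-g) - (f₀-f)(g₀-g)` and Hölder's inequality involve
only the norms of the limits, so no uniform bound on the sequences is needed. -/
theorem tendsto_eLpNorm_one_smul {α F ι : Type*} [MeasurableSpace α]
    {μ : Measure α} {l : Filter ι} [NormedAddCommGroup F] [NormedSpace ℝ F]
    {f : ι → α → ℝ} {f₀ : α → ℝ} {g : ι → α → F} {g₀ : α → F}
    (hf : ∀ k, AEStronglyMeasurable (f k) μ) (hg : ∀ k, AEStronglyMeasurable (g k) μ)
    (hf₀ : MemLp f₀ 2 μ) (hg₀ : MemLp g₀ 2 μ)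
    (h : Tendsto (fun k => eLpNorm (fun x => f₀ x - f k x) 2 μ) l (𝓝 0))
    (h' : Tendsto (fun k => eLpNorm (fun x => g₀ x - g k x) 2 μ) l (𝓝 0)) :
    Tendsto (fun k => eLpNorm (fun x => f₀ x • g₀ x - f k x • g k x) 1 μ) l (𝓝 0) := by
  have t := ((ENNReal.Tendsto.mul_const h (Or.inr hg₀.eLpNorm_ne_top)).add
    (ENNReal.Tendsto.const_mul h' (Or.inr hf₀.eLpNorm_ne_top))).add
    (ENNReal.Tendsto.mul h (Or.inr (by simp)) h' (Or.inr (by simp)))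
  simp only [zero_mul, mul_zero, add_zero] at t
  refine tendsto_of_tendsto_of_tendsto_of_le_of_le tendsto_const_nhds t
    (fun _ => zero_le) fun k => ?_
  have e : (fun x => f₀ x • g₀ x - f k x • g k x) =
      ((fun x => f₀ x - f k x) • g₀ + f₀ • (fun x => g₀ x - g k x)) -
        (fun x => f₀ x - f k x) • (fun x => g₀ x - g k x) := by
    ext1 x
    simp only [Pi.sub_apply, Pi.add_apply, Pi.smul_apply', sub_smul, smul_sub]
    abel
  have m1 := hf₀.1.sub (hf k)
  have m2 := hg₀.1.sub (hg k)
  simp only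
  rw [e]
  refine (eLpNorm_sub_le ((m1.smul hg₀.1).add (hf₀.1.smul m2)) (m1.smul m2) le_rfl).trans
    (add_le_add ((eLpNorm_add_le (m1.smul hg₀.1) (hf₀.1.smul m2) le_rfl).trans
      (add_le_add ?_ ?_)) ?_)
  · exact eLpNorm_smul_le_mul_eLpNorm hg₀.1 m1
  · exact eLpNorm_smul_le_mul_eLpNorm m2 hf₀.1
  · exact eLpNorm_smul_le_mul_eLpNorm m2 m1

theorem tendsto_eLpNorm_one_of_two {α F : Type*} [MeasurableSpace α]
    {μ : Measure α} [IsFiniteMeasure μ] [NormedAddCommGroup F] {f : ℕ → α → F}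
    (hf : ∀ k, AEStronglyMeasurable (f k) μ)
    (h : Tendsto (fun k => eLpNorm (f k) 2 μ) atTop (𝓝 0)) :
    Tendsto (fun k => eLpNorm (f k) 1 μ) atTop (𝓝 0) := by
  have t := ENNReal.Tendsto.mul_const (b := μ univ ^ (1 / (1 : ENNReal).toReal - 1 / (2 : ENNReal).toReal))
    h (Or.inr (by
      refine ENNReal.rpow_ne_top_of_nonneg (by norm_num) (measure_ne_top _ _)))
  rw [zero_mul] at t
  exact tendsto_of_tendsto_of_tendsto_of_le_of_le tendsto_const_nhds t
    (fun _ => zero_le) fun k => eLpNorm_le_eLpNorm_mul_rpow_measure_univ (by norm_num) (hf k)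

/-- The flux integrand of `u ^ 2` through the sphere of radius `t`. -/
def sphereFlux (u : EucSp n → ℝ) (G : EucSp n → EucSp n) (t : ℝ) : ℝ :=
  ∫ θ : USphere n, 2 * (u (t • (θ : EucSp n)) * inner ℝ (G (t • (θ : EucSp n))) (θ : EucSp n))
    ∂sphereMeasure n

theorem integrable_flux_polar {u : EucSp n → ℝ} {G : EucSp n → EucSp n} {r R₁ : ℝ} (hr : 0 < r)
    (hu : MemLp u 2 (volume.restrict (ball 0 R₁))) (hG : MemLp G 2 (volume.restrict (ball 0 R₁))) :
    Integrable (fun p : ℝ × USphere n => 2 * (u (p.1 • (p.2 : EucSp n)) *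
      inner ℝ (G (p.1 • (p.2 : EucSp n))) (p.2 : EucSp n)))
      ((volume.restrict (Ioo r R₁)).prod (sphereMeasure n)) := by
  have h := integrable_polar_annulus (n := n) hr (MemLp.integrable_smul_two hu hG)
  have hθm : AEStronglyMeasurable (fun p : ℝ × USphere n => (p.2 : EucSp n))
      ((volume.restrict (Ioo r R₁)).prod (sphereMeasure n)) :=
    (continuous_subtype_val.comp continuous_snd).aestronglyMeasurable
  have h2 : Integrable (fun p : ℝ × USphere n => inner ℝ (u (p.1 • (p.2 : EucSp n)) •
      G (p.1 • (p.2 : EucSp n))) (p.2 : EucSp n))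
      ((volume.restrict (Ioo r R₁)).prod (sphereMeasure n)) := by
    refine h.norm.mono (h.1.inner hθm) (.of_forall fun p => ?_)
    refine (norm_inner_le_norm _ _).trans ?_
    simp
  simpa only [real_inner_smul_left] using h2.const_mul 2

theorem integrableOn_sphereFlux {u : EucSp n → ℝ} {G : EucSp n → EucSp n} {r R₁ : ℝ} (hr : 0 < r)
    (hu : MemLp u 2 (volume.restrict (ball 0 R₁))) (hG : MemLp G 2 (volume.restrict (ball 0 R₁))) :
    IntegrableOn (sphereFlux u G) (Ioo r R₁) :=
  (integrable_flux_polar hr hu hG).integral_prod_left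

/-- The identity along rays is applied to `u` and to `u²` with gradient `2uG`; the second one is
then integrated over the sphere. Products of `L²` limits converge only in `L¹`, which is why the
identity along rays is phrased in `L¹`. -/
theorem sphere_identities {U : ℕ → EucSp n → ℝ} {u : EucSp n → ℝ} {G : EucSp n → EucSp n}
    {R₁ : ℝ} (hU : ∀ k, ContDiffOn ℝ 1 (U k) (ball 0 R₁))
    (hu : MemLp u 2 (volume.restrict (ball 0 R₁))) (hG : MemLp G 2 (volume.restrict (ball 0 R₁)))
    (c1 : Tendsto (fun k => eLpNorm (fun x => u x - U k x) 2 (volume.restrict (ball 0 R₁)))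
      atTop (𝓝 0))
    (c2 : Tendsto (fun k => eLpNorm (fun x => G x - ∇ (U k) x) 2 (volume.restrict (ball 0 R₁)))
      atTop (𝓝 0))
    {r R : ℝ} (hr : 0 < r) (hrR : r < R) (hR : R < R₁)
    (mr : MemLp (fun θ : USphere n => u (r • (θ : EucSp n))) 2 (sphereMeasure n))
    (mR : MemLp (fun θ : USphere n => u (R • (θ : EucSp n))) 2 (sphereMeasure n))
    (cr : Tendsto (fun k => eLpNorm (fun θ : USphere n => u (r • (θ : EucSp n)) -
      U k (r • (θ : EucSp n))) 2 (sphereMeasure n)) atTop (𝓝 0))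
    (cR : Tendsto (fun k => eLpNorm (fun θ : USphere n => u (R • (θ : EucSp n)) -
      U k (R • (θ : EucSp n))) 2 (sphereMeasure n)) atTop (𝓝 0)) :
    (∀ᵐ θ : USphere n ∂sphereMeasure n, u (R • (θ : EucSp n)) - u (r • (θ : EucSp n)) =
      ∫ t in r..R, inner ℝ (G (t • (θ : EucSp n))) (θ : EucSp n)) ∧
    (∫ θ : USphere n, u (R • (θ : EucSp n)) ^ 2 ∂sphereMeasure n) -
      (∫ θ : USphere n, u (r • (θ : EucSp n)) ^ 2 ∂sphereMeasure n) =
      ∫ t in r..R, sphereFlux u G t := by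
  have : IsFiniteMeasure (volume.restrict (ball (0 : EucSp n) R₁)) :=
    ⟨by simpa using measure_ball_lt_top⟩
  have hmU : ∀ s, 0 < s → s < R₁ → ∀ k, AEStronglyMeasurable
      (fun θ : USphere n => U k (s • (θ : EucSp n))) (sphereMeasure n) := by
    intro s hs hs1 k
    refine ((hU k).continuousOn.comp_continuous (by fun_prop) fun θ => ?_).aestronglyMeasurable
    rwa [mem_ball_zero_iff, norm_smul_usphere hs.le]
  have hmUr := hmU r hr (hrR.trans hR)
  have hmUR := hmU R (hr.trans hrR) hR
  have hmb : ∀ k, AEStronglyMeasurable (U k) (volume.restrict (ball 0 R₁)) := fun k =>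
    (hU k).continuousOn.aestronglyMeasurable measurableSet_ball
  have hmg : ∀ k, AEStronglyMeasurable (∇ (U k)) (volume.restrict (ball 0 R₁)) := fun k =>
    (measurable_gradient _).aestronglyMeasurable
  refine ⟨ae_sub_eq_integral_inner hU (memLp_one_iff_integrable.mp
    (hG.mono_exponent (by norm_num))) (tendsto_eLpNorm_one_of_two
      (fun k => hG.1.sub (hmg k)) c2) hr hrR hR mr.1 mR.1
      (tendsto_eLpNorm_one_of_two (fun k => mr.1.sub (hmUr k)) cr)
      (tendsto_eLpNorm_one_of_two (fun k => mR.1.sub (hmUR k)) cR), ?_⟩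
  have hsq := ae_sub_eq_integral_inner (V := fun k x => U k x * U k x) (v := fun x => u x * u x)
    (P := fun x => (2 * u x) • G x) (fun k => (hU k).mul (hU k))
    (MemLp.integrable_smul_two (hu.const_mul 2) hG) ?_ hr hrR hR
    (mr.1.mul mr.1) (mR.1.mul mR.1)
    (tendsto_eLpNorm_one_smul hmUr hmUr mr mr cr cr)
    (tendsto_eLpNorm_one_smul hmUR hmUR mR mR cR cR)
  · have hi := integrable_flux_polar (n := n) hr hu hG
    have hsub : Ioc r R ⊆ Ioo r R₁ := fun t ht => ⟨ht.1, ht.2.trans_lt hR⟩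
    have hi' := hi.mono_measure (Measure.prod_mono (Measure.restrict_mono hsub le_rfl)
      (le_refl (sphereMeasure n)))
    rw [← integral_sub mR.integrable_sq mr.integrable_sq, intervalIntegral.integral_of_le hrR.le]
    unfold sphereFlux
    rw [integral_integral_swap hi']
    refine integral_congr_ae ?_
    filter_upwards [hsq] with θ hθ
    rw [sq, sq, hθ, intervalIntegral.integral_of_le hrR.le]
    refine integral_congr_ae (.of_forall fun t => ?_)
    simp only [real_inner_smul_left]
    ring
  · have c1' : Tendsto (fun k => eLpNorm (fun x => 2 * u x - 2 * U k x) 2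
        (volume.restrict (ball 0 R₁))) atTop (𝓝 0) := by
      have t := ENNReal.Tendsto.const_mul (a := ‖(2 : ℝ)‖ₑ) c1 (Or.inr (by simp))
      rw [mul_zero] at t
      refine t.congr fun k => ?_
      rw [← eLpNorm_const_smul]
      congr 1
      ext1 x
      simp [mul_sub]
    refine (tendsto_eLpNorm_one_smul (fun k => (hmb k).const_mul 2) hmg (hu.const_mul 2) hG c1'
      c2).congr fun k => ?_
    refine eLpNorm_congr_ae ?_
    filter_upwards [ae_restrict_mem measurableSet_ball] with x hx
    have hd := ((hU k).differentiableOn one_ne_zero).differentiableAt (isOpen_ball.mem_nhds hx)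
    congr 1
    refine ext_inner_right ℝ fun w => ?_
    rw [inner_gradient_eq_fderiv, fderiv_fun_mul hd hd, real_inner_smul_left,
      inner_gradient_eq_fderiv]
    simp
    ring

end

/-- Smooth approximation works only inside strictly smaller balls; countably many of them exhaust
the whole one. -/
theorem ae_Ioo_of_forall_lt {R₀ : ℝ} {P : ℝ → Prop}
    (h : ∀ R₁ < R₀, ∀ᵐ R ∂volume.restrict (Ioo 0 R₁), P R) :
    ∀ᵐ R ∂volume.restrict (Ioo 0 R₀), P R := by
  obtain ⟨s, -, hs1, hs2⟩ := exists_seq_strictMono_tendsto R₀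
  have h1 : ∀ᵐ R : ℝ, ∀ m, R ∈ Ioo 0 (s m) → P R := ae_all_iff.mpr fun m =>
    (ae_restrict_iff' measurableSet_Ioo).mp (h (s m) (hs1 m))
  rw [ae_restrict_iff' measurableSet_Ioo]
  filter_upwards [h1] with R hR hR0
  obtain ⟨m, hm⟩ := ((tendsto_order.mp hs2).1 R hR0.2).exists
  exact hR m ⟨hR0.1, hm⟩

theorem continuousOn_primitive_Ioo {f : ℝ → ℝ} {a b c : ℝ} (hc : c ∈ Ioo a b)
    (hf : ∀ x y, a < x → x ≤ y → y < b → IntervalIntegrable f volume x y) :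
    ContinuousOn (fun x => ∫ t in c..x, f t) (Ioo a b) := by
  intro x hx
  refine ContinuousAt.continuousWithinAt ?_
  obtain ⟨p, hp1, hp2⟩ := exists_between (lt_min hc.1 hx.1)
  obtain ⟨q, hq1, hq2⟩ := exists_between (max_lt hc.2 hx.2)
  have hpq : p ≤ q := (hp2.le.trans (min_le_left _ _)).trans ((le_max_left _ _).trans hq1.le)
  have hcm : c ∈ uIcc p q := by
    rw [uIcc_of_le hpq]
    exact ⟨hp2.le.trans (min_le_left _ _), (le_max_left _ _).trans hq1.le⟩
  have h := ((hf p q hp1 hpq hq2).absolutelyContinuousOnInterval_intervalIntegral hcm).continuousOn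
  rw [uIcc_of_le hpq] at h
  exact h.continuousAt (Icc_mem_nhds (hp2.trans_le (min_le_right _ _))
    ((le_max_right _ _).trans_lt hq1))

theorem isFiniteMeasure_restrict_ball {n : ℕ} (R : ℝ) :
    IsFiniteMeasure (volume.restrict (ball (0 : EucSp n) R)) :=
  ⟨by simpa using measure_ball_lt_top⟩

theorem IsSphereTrace.continuousOn_integral_sq {n : ℕ} {R₀ : ℝ} {u : EucSp n → ℝ}
    {T : ℝ → USphere n → ℝ} (hT : IsSphereTrace R₀ u T) :
    ContinuousOn (fun R => ∫ θ, T R θ ^ 2 ∂sphereMeasure n) (Ioo 0 R₀) := by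
  rw [continuousOn_iff_continuous_domRestrict, continuous_iff_continuousAt]
  intro R
  have hc : Tendsto (fun r : Ioo 0 R₀ => eLpNorm (fun θ => T R θ - T r θ) 2 (sphereMeasure n))
      (𝓝 R) (𝓝 0) := by
    refine ((hT.cont R R.2).comp (continuous_subtype_val.tendsto R)).congr fun r => ?_
    exact eLpNorm_sub_comm (T r) (T R) 2 (sphereMeasure n)
  have hL := tendsto_eLpNorm_one_smul (f := fun r : Ioo 0 R₀ => T r)
    (g := fun r : Ioo 0 R₀ => T r) (fun r => (hT.memLp r r.2).1) (fun r => (hT.memLp r r.2).1)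
    (hT.memLp R R.2) (hT.memLp R R.2) hc hc
  refine tendsto_integral_of_L1' _ (hT.memLp R R.2).integrable_sq.1
    (.of_forall fun r => (hT.memLp r r.2).integrable_sq) ?_
  refine hL.congr fun r => ?_
  rw [← eLpNorm_neg]
  congr 1
  ext1 θ
  simp
  ring

section

variable {n : ℕ} [NeZero n]

/-- A radius is good if the approximating sequence, fixed in advance, converges in `L²` of that
sphere. Goodness concerns one radius at a time, so a single set of full measure serves all pairs. -/
theorem exists_good_radii {R₀ R₁ : ℝ} (hR₁ : R₁ < R₀) {u : EucSp n → ℝ}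
    {G : EucSp n → EucSp n} (h : MemW12 (ball 0 R₀) u G) :
    ∃ good : Set ℝ, (∀ᵐ R ∂volume.restrict (Ioo 0 R₁), R ∈ good) ∧
      ∀ r ∈ good, ∀ R ∈ good, 0 < r → r < R → R < R₁ →
      (∀ᵐ θ : USphere n ∂sphereMeasure n, u (R • (θ : EucSp n)) - u (r • (θ : EucSp n)) =
        ∫ t in r..R, inner ℝ (G (t • (θ : EucSp n))) (θ : EucSp n)) ∧
      (∫ θ : USphere n, u (R • (θ : EucSp n)) ^ 2 ∂sphereMeasure n) -
        (∫ θ : USphere n, u (r • (θ : EucSp n)) ^ 2 ∂sphereMeasure n) =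
        ∫ t in r..R, sphereFlux u G t := by
  obtain ⟨U, hU, c1, c2, hae⟩ := exists_smooth_approx hR₁ h
  have h₁ := h.mono (ball_subset_ball hR₁.le) measurableSet_ball
  refine ⟨{R | MemLp (fun θ : USphere n => u (R • (θ : EucSp n))) 2 (sphereMeasure n) ∧
    Tendsto (fun k => eLpNorm (fun θ : USphere n => u (R • (θ : EucSp n)) -
      U k (R • (θ : EucSp n))) 2 (sphereMeasure n)) atTop (𝓝 0)}, ?_, ?_⟩
  · filter_upwards [hae, ae_memLp_sphere h₁.memLp] with R h1 h2
    exact ⟨h2, h1.1⟩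
  · intro r hr R hR h0 hrR hRR
    exact sphere_identities (fun k => (hU k).contDiffOn) h₁.memLp h₁.memLp_grad c1 c2 h0 hrR hRR
      hr.1 hR.1 hr.2 hR.2

theorem ae_ae_sub_eq_integral {R₀ : ℝ} {u : EucSp n → ℝ} {G : EucSp n → EucSp n}
    (h : MemW12 (ball 0 R₀) u G) :
    ∀ᵐ r ∂volume.restrict (Ioo 0 R₀), ∀ᵐ R ∂volume.restrict (Ioo 0 R₀),
      (∀ᵐ θ : USphere n ∂sphereMeasure n, u (R • (θ : EucSp n)) - u (r • (θ : EucSp n)) =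
        ∫ t in r..R, inner ℝ (G (t • (θ : EucSp n))) (θ : EucSp n)) ∧
      (∫ θ : USphere n, u (R • (θ : EucSp n)) ^ 2 ∂sphereMeasure n) -
        (∫ θ : USphere n, u (r • (θ : EucSp n)) ^ 2 ∂sphereMeasure n) =
        ∫ t in r..R, sphereFlux u G t := by
  obtain ⟨s, -, hs1, hs2⟩ := exists_seq_strictMono_tendsto R₀
  choose good hg1 hg2 using fun m => exists_good_radii (hs1 m) h
  have h1 : ∀ᵐ r : ℝ, ∀ m, r ∈ Ioo 0 (s m) → r ∈ good m := ae_all_iff.mpr fun m =>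
    (ae_restrict_iff' measurableSet_Ioo).mp (hg1 m)
  rw [ae_restrict_iff' measurableSet_Ioo]
  filter_upwards [h1] with r hr hr0
  refine (ae_restrict_iff' measurableSet_Ioo).mpr ?_
  filter_upwards [h1] with R hR hR0
  obtain ⟨m, hm1, hm2⟩ := (((tendsto_order.mp hs2).1 r hr0.2).and
    ((tendsto_order.mp hs2).1 R hR0.2)).exists
  have gr := hr m ⟨hr0.1, hm1⟩
  have gR := hR m ⟨hR0.1, hm2⟩
  rcases lt_trichotomy r R with hlt | heq | hgt
  · exact hg2 m r gr R gR hr0.1 hlt hm2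
  · subst heq
    simp
  · obtain ⟨a1, a2⟩ := hg2 m R gR r gr hR0.1 hgt hm1
    constructor
    · filter_upwards [a1] with θ hθ
      rw [intervalIntegral.integral_symm, ← hθ]
      ring
    · rw [intervalIntegral.integral_symm, ← a2]
      ring

/-! ### Traces on spheres -/

theorem integrable_ray {R₀ r : ℝ} (hr : 0 < r) {G : EucSp n → EucSp n}
    (hG : MemLp G 2 (volume.restrict (ball 0 R₀))) :
    Integrable (fun p : ℝ × USphere n => inner ℝ (G (p.1 • (p.2 : EucSp n))) (p.2 : EucSp n))
      ((volume.restrict (Ioo r R₀)).prod (sphereMeasure n)) := by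
  have := isFiniteMeasure_restrict_ball (n := n) R₀
  have hPp := integrable_polar_annulus (n := n) hr
    (memLp_one_iff_integrable.mp (hG.mono_exponent (by norm_num)))
  have hθm : AEStronglyMeasurable (fun p : ℝ × USphere n => (p.2 : EucSp n))
      ((volume.restrict (Ioo r R₀)).prod (sphereMeasure n)) :=
    (continuous_subtype_val.comp continuous_snd).aestronglyMeasurable
  refine hPp.norm.mono (hPp.1.inner hθm) (.of_forall fun p => ?_)
  refine (norm_inner_le_norm _ _).trans ?_
  simp

theorem aestronglyMeasurable_ray_integral {R₀ : ℝ} {G : EucSp n → EucSp n}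
    (hG : MemLp G 2 (volume.restrict (ball 0 R₀))) {a b : ℝ} (ha : a ∈ Ioo 0 R₀)
    (hb : b ∈ Ioo 0 R₀) : AEStronglyMeasurable (fun θ : USphere n =>
      ∫ t in a..b, inner ℝ (G (t • (θ : EucSp n))) (θ : EucSp n)) (sphereMeasure n) := by
  wlog hab : a ≤ b generalizing a b
  · simp_rw [intervalIntegral.integral_symm b a]
    exact (this hb ha (not_le.mp hab).le).neg
  have hsub : Ioc a b ⊆ Ioo (a / 2) R₀ := fun t ht =>
    ⟨by linarith [ht.1, ha.1], ht.2.trans_lt hb.2⟩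
  have h := (integrable_ray (half_pos ha.1) hG).mono_measure (Measure.prod_mono
    (Measure.restrict_mono hsub le_rfl) (le_refl (sphereMeasure n)))
  simp_rw [intervalIntegral.integral_of_le hab]
  exact h.integral_prod_right.1

/-- Cauchy–Schwarz on each ray produces the factor `|b - a|`, and the annulus estimate bounds what
remains. The curve of traces is thus locally Hölder continuous of exponent `1/2` in `L²`. -/
theorem lintegral_ray_integral_sq_le {R₀ : ℝ} {G : EucSp n → EucSp n}
    (hG : MemLp G 2 (volume.restrict (ball 0 R₀))) {r a b : ℝ} (hr : 0 < r) (hra : r < a)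
    (hrb : r < b) (ha : a < R₀) (hb : b < R₀) :
    ∫⁻ θ : USphere n, ‖∫ t in a..b, inner ℝ (G (t • (θ : EucSp n))) (θ : EucSp n)‖ₑ ^ 2
      ∂sphereMeasure n ≤ ENNReal.ofReal |b - a| * ((ENNReal.ofReal (r ^ (n - 1)))⁻¹ *
        ∫⁻ x in ball (0 : EucSp n) R₀, ‖G x‖ₑ ^ 2) := by
  wlog hab : a ≤ b generalizing a b
  · simp_rw [intervalIntegral.integral_symm b a, enorm_neg]
    rw [abs_sub_comm]
    exact this hrb hra hb ha (not_le.mp hab).le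
  have hsub : Ioc a b ⊆ Ioo r R₀ := fun t ht => ⟨hra.trans ht.1, ht.2.trans_lt hb⟩
  have hm := aestronglyMeasurable_polar (n := n) hr.le hG.1
  have hmeas : AEMeasurable (fun p : ℝ × USphere n => ‖G (p.1 • (p.2 : EucSp n))‖ₑ ^ 2)
      ((volume.restrict (Ioo r R₀)).prod (sphereMeasure n)) := hm.enorm.pow_const 2
  have h1 := lintegral_annulus_le (n := n) hr (hG.1.enorm.pow_const 2)
  rw [lintegral_lintegral_swap hmeas] at h1
  refine le_trans ?_ (mul_le_mul_right h1 _)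
  rw [← lintegral_const_mul' _ _ ENNReal.ofReal_ne_top]
  refine lintegral_mono_ae ?_
  have hsec : ∀ᵐ θ : USphere n ∂sphereMeasure n,
      AEStronglyMeasurable (fun t : ℝ => G (t • (θ : EucSp n))) (volume.restrict (Ioo r R₀)) :=
    hm.prod_swap.prodMk_left
  filter_upwards [hsec] with θ hθ
  have hθ' := hθ.mono_measure (Measure.restrict_mono hsub le_rfl)
  have h2 : ‖∫ t in a..b, inner ℝ (G (t • (θ : EucSp n))) (θ : EucSp n)‖ₑ ≤
      ∫⁻ t in Ioc a b, ‖G (t • (θ : EucSp n))‖ₑ := by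
    rw [intervalIntegral.integral_of_le hab]
    refine (enorm_integral_le_lintegral_enorm _).trans (lintegral_mono fun t => ?_)
    rw [← ofReal_norm, ← ofReal_norm]
    refine ENNReal.ofReal_le_ofReal ((norm_inner_le_norm _ _).trans ?_)
    simp
  refine (pow_le_pow_left' h2 2).trans ((sq_lintegral_le hθ'.enorm).trans ?_)
  rw [Measure.restrict_apply_univ, Real.volume_Ioc, abs_of_nonneg (sub_nonneg.mpr hab)]
  gcongr

theorem eLpNorm_two_lt_top_of_lintegral {α E : Type*} [MeasurableSpace α] {μ : Measure α}
    [NormedAddCommGroup E] {f : α → E} (h : ∫⁻ x, ‖f x‖ₑ ^ 2 ∂μ < ⊤) : eLpNorm f 2 μ < ⊤ := by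
  rw [← eLpNorm_two_sq] at h
  by_contra htop
  rw [not_lt, top_le_iff] at htop
  rw [htop] at h
  simp at h

/-- The trace is obtained from the restriction to one generic sphere by integrating the radial part
of the weak gradient along rays. -/
theorem exists_isSphereTrace {R₀ : ℝ} (hR₀ : 0 < R₀) {u : EucSp n → ℝ} {G : EucSp n → EucSp n}
    (h : MemW12 (ball 0 R₀) u G) : ∃ T : ℝ → USphere n → ℝ, IsSphereTrace R₀ u T := by
  have hne : (ae (volume.restrict (Ioo 0 R₀))).NeBot := by
    rw [ae_neBot, Ne, Measure.restrict_eq_zero]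
    simpa using hR₀
  obtain ⟨r₀, ⟨hr1, hr2⟩, hr3⟩ := (((ae_ae_sub_eq_integral h).and (ae_memLp_sphere h.memLp)).and
    (ae_restrict_mem measurableSet_Ioo)).exists
  set T : ℝ → USphere n → ℝ := fun R θ => u (r₀ • (θ : EucSp n)) +
    ∫ t in r₀..R, inner ℝ (G (t • (θ : EucSp n))) (θ : EucSp n) with hT
  have hfin : ∫⁻ x in ball (0 : EucSp n) R₀, ‖G x‖ₑ ^ 2 ≠ ⊤ := by
    rw [← eLpNorm_two_sq]
    exact (ENNReal.pow_lt_top h.memLp_grad.2).ne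
  have hCfin : ∀ r : ℝ, 0 < r → (ENNReal.ofReal (r ^ (n - 1)))⁻¹ *
      ∫⁻ x in ball (0 : EucSp n) R₀, ‖G x‖ₑ ^ 2 ≠ ⊤ := fun r hr =>
    ENNReal.mul_ne_top (by simpa using pow_pos hr (n - 1)) hfin
  refine ⟨T, fun R hR => ?_, ?_, fun R hR => ?_⟩
  · refine hr2.add ⟨aestronglyMeasurable_ray_integral h.memLp_grad hr3 hR,
      eLpNorm_two_lt_top_of_lintegral ?_⟩
    obtain ⟨r, hr0, hrlt⟩ := exists_between (lt_min hr3.1 hR.1)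
    refine (lintegral_ray_integral_sq_le h.memLp_grad hr0 (hrlt.trans_le (min_le_left _ _))
      (hrlt.trans_le (min_le_right _ _)) hr3.2 hR.2).trans_lt ?_
    exact (ENNReal.mul_ne_top ENNReal.ofReal_ne_top (hCfin r hr0)).lt_top
  · filter_upwards [hr1] with R hR
    filter_upwards [hR.1] with θ hθ
    rw [hT]
    simp only
    rw [← hθ]
    ring
  · rw [tendsto_eLpNorm_two_iff]
    obtain ⟨r, hr0, hrlt⟩ := exists_between (lt_min hr3.1 hR.1)
    have hrr := hrlt.trans_le (min_le_left _ _)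
    have hrR := hrlt.trans_le (min_le_right _ _)
    have hlim : Tendsto (fun s : ℝ => ENNReal.ofReal |s - R| * ((ENNReal.ofReal (r ^ (n - 1)))⁻¹ *
        ∫⁻ x in ball (0 : EucSp n) R₀, ‖G x‖ₑ ^ 2)) (𝓝 R) (𝓝 0) := by
      have h1 : Tendsto (fun s : ℝ => ENNReal.ofReal |s - R|) (𝓝 R) (𝓝 0) := by
        have : Continuous fun s : ℝ => ENNReal.ofReal |s - R| :=
          ENNReal.continuous_ofReal.comp (by fun_prop)
        simpa using this.tendsto R
      simpa using ENNReal.Tendsto.mul_const h1 (Or.inr (hCfin r hr0))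
    refine tendsto_of_tendsto_of_tendsto_of_le_of_le' tendsto_const_nhds hlim
      (.of_forall fun _ => zero_le) ?_
    filter_upwards [isOpen_Ioo.mem_nhds (show R ∈ Ioo r R₀ from ⟨hrR, hR.2⟩)] with s hs
    refine le_trans (le_of_eq (lintegral_congr_ae ?_))
      (lintegral_ray_integral_sq_le h.memLp_grad hr0 hrR hs.1 hR.2 hs.2)
    filter_upwards [(integrable_ray hr0 h.memLp_grad).prod_left_ae] with θ hθ
    have hi : ∀ a b, a ∈ Ioo r R₀ → b ∈ Ioo r R₀ → IntervalIntegrable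
        (fun t => inner ℝ (G (t • (θ : EucSp n))) (θ : EucSp n)) volume a b := by
      intro a b ha hb
      have hsub : uIcc a b ⊆ Ioo r R₀ := ordConnected_Ioo.uIcc_subset ha hb
      exact IntegrableOn.intervalIntegrable (IntegrableOn.mono_set hθ hsub)
    rw [hT]
    simp only
    rw [add_sub_add_left_eq_sub, intervalIntegral.integral_interval_sub_left
      (hi _ _ ⟨hrr, hr3.2⟩ hs) (hi _ _ ⟨hrr, hr3.2⟩ ⟨hrR, hR.2⟩)]

theorem intervalIntegrable_sphereFlux {R₀ : ℝ} {u : EucSp n → ℝ} {G : EucSp n → EucSp n}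
    (h : MemW12 (ball 0 R₀) u G) {a b : ℝ} (ha : 0 < a) (hab : a ≤ b) (hb : b < R₀) :
    IntervalIntegrable (sphereFlux u G) volume a b := by
  refine IntegrableOn.intervalIntegrable ?_
  rw [uIcc_of_le hab]
  exact (integrableOn_sphereFlux (half_pos ha) h.memLp h.memLp_grad).mono_set
    fun t ht => ⟨by linarith [ht.1], ht.2.trans_lt hb⟩

/-- From a generic base radius `r₀` the identity holds for almost every endpoint. Both sides are
continuous in the endpoint, hence it holds for all, and subtraction removes `r₀`. -/
theorem IsSphereTrace.integral_sq_sub {R₀ : ℝ} {u : EucSp n → ℝ} {G : EucSp n → EucSp n}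
    (h : MemW12 (ball 0 R₀) u G) {T : ℝ → USphere n → ℝ} (hT : IsSphereTrace R₀ u T) {r R : ℝ}
    (hr : r ∈ Ioo 0 R₀) (hR : R ∈ Ioo 0 R₀) :
    (∫ θ, T R θ ^ 2 ∂sphereMeasure n) - (∫ θ, T r θ ^ 2 ∂sphereMeasure n) =
      ∫ t in r..R, sphereFlux u G t := by
  have hne : (ae (volume.restrict (Ioo 0 R₀))).NeBot := by
    rw [ae_neBot, Ne, Measure.restrict_eq_zero]
    simpa using hr.1.trans hr.2
  obtain ⟨r₀, ⟨hr1, hr2⟩, hr3⟩ := (((ae_ae_sub_eq_integral h).and hT.ae_eq).and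
    (ae_restrict_mem measurableSet_Ioo)).exists
  have hi : ∀ x y, 0 < x → x ≤ y → y < R₀ → IntervalIntegrable (sphereFlux u G) volume x y :=
    fun x y hx hxy hy => intervalIntegrable_sphereFlux h hx hxy hy
  have hi' : ∀ x ∈ Ioo 0 R₀, IntervalIntegrable (sphereFlux u G) volume r₀ x := by
    intro x hx
    rcases le_total r₀ x with hle | hle
    · exact hi _ _ hr3.1 hle hx.2
    · exact (hi _ _ hx.1 hle hr3.2).symm
  have key : EqOn (fun R => (∫ θ, T R θ ^ 2 ∂sphereMeasure n) -
      ∫ θ, T r₀ θ ^ 2 ∂sphereMeasure n) (fun R => ∫ t in r₀..R, sphereFlux u G t) (Ioo 0 R₀) := by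
    refine Measure.eqOn_open_of_ae_eq (μ := volume) ?_ isOpen_Ioo
      (hT.continuousOn_integral_sq.sub continuousOn_const) (continuousOn_primitive_Ioo hr3 hi)
    filter_upwards [hr1, hT.ae_eq] with R hR hTR
    rw [← hR.2]
    congr 1
    · refine integral_congr_ae ?_
      filter_upwards [hTR] with θ hθ
      rw [hθ]
    · refine integral_congr_ae ?_
      filter_upwards [hr2] with θ hθ
      rw [hθ]
  have k1 := key hr
  have k2 := key hR
  simp only at k1 k2
  rw [← intervalIntegral.integral_interval_sub_left (hi' R hR) (hi' r hr), ← k1, ← k2]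
  ring

end

section

variable {n : ℕ} [NeZero n]

/-! ### Comparison with the homogeneous replacement -/

theorem direction_smul_of_ne_zero {t : ℝ} (ht : 0 < t) {x : EucSp n} (hx : x ≠ 0) :
    direction (t • x) = direction x := by
  conv_lhs => rw [← norm_smul_direction x, smul_smul]
  exact direction_smul (mul_pos ht (norm_pos_iff.mpr hx)) _

theorem isPosHomogeneous_homExt {α R : ℝ} (hα : 0 < α) (hR : 0 < R) (f : USphere n → ℝ) :
    IsPosHomogeneous α (homExt α R f) := by
  intro t x ht
  rcases eq_or_ne x 0 with rfl | hx
  · simp [homExt, Real.zero_rpow hα.ne']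
  · rw [homExt, homExt, direction_smul_of_ne_zero ht hx, norm_smul, Real.norm_of_nonneg ht.le,
      mul_div_assoc, Real.mul_rpow ht.le (by positivity), mul_assoc]

theorem norm_homGrad_sq (α R : ℝ) (f : USphere n → ℝ) (F : USphere n → EucSp n) (x : EucSp n) :
    ‖homGrad α R f F x‖ ^ 2 = ((‖x‖ / R) ^ (α - 1)) ^ 2 * ((α * f (direction x) / R) ^ 2 +
      (‖F (direction x)‖ ^ 2 - inner ℝ (F (direction x)) (direction x : EucSp n) ^ 2)) := by
  rw [homGrad, norm_smul, mul_pow, Real.norm_eq_abs, sq_abs, norm_add_sq_real,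
    norm_sub_inner_smul_sq, norm_smul, norm_usphere, mul_one, Real.norm_eq_abs, sq_abs,
    real_inner_smul_left, inner_sub_right, real_inner_smul_right, real_inner_self_eq_norm_sq,
    norm_usphere, real_inner_comm (F (direction x))]
  ring

theorem integral_pow_mul_rpow_sq {α R : ℝ} (hα : 1 < α) (hR : 0 < R) :
    ∫ r in Ioo 0 R, r ^ (n - 1) * ((r / R) ^ (α - 1)) ^ 2 = R ^ n / (n + 2 * (α - 1)) := by
  have hn : (n : ℝ) ≥ 1 := by exact_mod_cast NeZero.one_le
  have h1 : ∀ r ∈ Ioo 0 R, r ^ (n - 1) * ((r / R) ^ (α - 1)) ^ 2 =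
      R ^ (-(2 * (α - 1))) * r ^ ((n : ℝ) - 1 + 2 * (α - 1)) := by
    intro r hr
    rw [Real.div_rpow hr.1.le hR.le, div_pow, ← Real.rpow_natCast (r ^ (α - 1)),
      ← Real.rpow_natCast (R ^ (α - 1)), ← Real.rpow_mul hr.1.le, ← Real.rpow_mul hR.le,
      Real.rpow_neg hR.le, Real.rpow_add hr.1, ← Real.rpow_natCast, Nat.cast_sub NeZero.one_le]
    push_cast
    rw [mul_comm (α - 1) 2]
    ring
  rw [setIntegral_congr_fun measurableSet_Ioo h1, integral_const_mul, ← integral_Ioc_eq_integral_Ioo,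
    ← intervalIntegral.integral_of_le hR.le, integral_rpow (Or.inl (by linarith)),
    Real.zero_rpow (by linarith), sub_zero,
    show (n : ℝ) - 1 + 2 * (α - 1) + 1 = n + 2 * (α - 1) by ring, ← mul_div_assoc,
    ← Real.rpow_add hR, neg_add_cancel_comm_assoc, Real.rpow_natCast]

/-- The radial and tangential parts are orthogonal, and in polar coordinates the integral factors.
The radial factor `∫ r^(n-1) (r/R)^(2(α-1)) dr` is the constant in front. -/
theorem integral_norm_homGrad_sq {α R : ℝ} (hα : 1 < α) (hR : 0 < R) {f : USphere n → ℝ}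
    {F : USphere n → EucSp n} (hf : MemLp f 2 (sphereMeasure n))
    (hF : MemLp F 2 (sphereMeasure n)) :
    ∫ x in ball (0 : EucSp n) R, ‖homGrad α R f F x‖ ^ 2 = R ^ n / (n + 2 * (α - 1)) *
      ((α / R) ^ 2 * (∫ θ, f θ ^ 2 ∂sphereMeasure n) + ((∫ θ, ‖F θ‖ ^ 2 ∂sphereMeasure n) -
        ∫ θ : USphere n, inner ℝ (F θ) (θ : EucSp n) ^ 2 ∂sphereMeasure n)) := by
  have hθ : AEStronglyMeasurable (fun θ : USphere n => (θ : EucSp n)) (sphereMeasure n) :=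
    continuous_subtype_val.aestronglyMeasurable
  have hN : MemLp (fun θ : USphere n => inner ℝ (F θ) (θ : EucSp n)) 2 (sphereMeasure n) := by
    refine hF.mono (hF.1.inner hθ) (.of_forall fun θ => ?_)
    simpa using norm_inner_le_norm (𝕜 := ℝ) (F θ) (θ : EucSp n)
  have i1 := hf.integrable_sq
  have i2 := hF.integrable_norm_pow (by norm_num)
  have i3 := hN.integrable_sq
  have e1 : ∀ θ, (α * f θ / R) ^ 2 = (α / R) ^ 2 * f θ ^ 2 := fun θ => by ring
  simp_rw [norm_homGrad_sq]
  have h := integral_ball_radial_mul (n := n) R (fun r => ((r / R) ^ (α - 1)) ^ 2)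
    (fun θ => (α * f θ / R) ^ 2 + (‖F θ‖ ^ 2 - inner ℝ (F θ) (θ : EucSp n) ^ 2))
    (by fun_prop) (by
      simp_rw [e1]
      exact ((i1.const_mul _).add (i2.sub i3)).1)
  refine h.trans ?_
  rw [integral_pow_mul_rpow_sq hα hR]
  simp_rw [e1]
  have i23 : Integrable (fun θ : USphere n => ‖F θ‖ ^ 2 - inner ℝ (F θ) (θ : EucSp n) ^ 2)
      (sphereMeasure n) := i2.sub i3
  rw [integral_add (i1.const_mul _) i23, integral_sub i2 i3, integral_const_mul]

/-- The hypothesis `hφ` puts `φ` below its own homogeneous extension from the sphere, and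
homogeneous extension is monotone. -/
theorem le_homExt {α R : ℝ} (hR : 0 < R) {φ u : EucSp n → ℝ} {x : EucSp n} (hx : x ≠ 0)
    (hφ : φ x ≤ (‖x‖ / R) ^ α * φ ((R / ‖x‖) • x))
    (h : φ (R • (direction x : EucSp n)) ≤ u (R • (direction x : EucSp n))) :
    φ x ≤ homExt α R (sphereRestrict u R) x := by
  refine hφ.trans ?_
  have e : (R / ‖x‖) • x = R • (direction x : EucSp n) := by
    rw [coe_direction hx, smul_smul, div_eq_mul_inv]
  rw [e, homExt]
  exact mul_le_mul_of_nonneg_left h (by positivity)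

theorem MemW12.add_w0Pair {n : ℕ} {Ω : Set (EucSp n)} {u v : EucSp n → ℝ} {G H : EucSp n → EucSp n}
    (h : MemW12 Ω u G) (h' : W0Pair Ω v H) :
    MemW12 Ω (fun x => u x + v x) (fun x => G x + H x) := by
  have h2 := h'.memW12
  refine ⟨h.memLp.add h2.memLp, h.memLp_grad.add h2.memLp_grad, fun ψ hψ => ?_⟩
  simp_rw [add_smul, smul_add]
  have m1 := hψ.memLp (volume.restrict Ω)
  have m2 := hψ.memLp_gradient (volume.restrict Ω)
  rw [integral_add (MemLp.integrable_smul_two h.memLp m2)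
    (MemLp.integrable_smul_two h2.memLp m2),
    integral_add (MemLp.integrable_smul_two m1 h.memLp_grad)
    (MemLp.integrable_smul_two m1 h2.memLp_grad),
    h.weak ψ hψ, h2.weak ψ hψ, neg_add]

/-- In the ball the competitor is the convex combination `(1-c)u + ch` of two functions above `φ`.
The value `c = 1` yields the energy inequality, `c = 1/2` the case of equality. -/
theorem isAdmissible_add_repl {α R c : ℝ} (hR : 0 < R) (hc : 0 < c) (hc1 : c ≤ 1)
    {Ω : Set (EucSp n)} {g φ u : EucSp n → ℝ}
    {G : EucSp n → EucSp n} (hu : IsAdmissible Ω g φ u G)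
    (hW : W0Pair Ω (replDiff α R u) (replGrad α R u G))
    (hφ : ∀ x : EucSp n, x ≠ 0 → ‖x‖ ≤ R → φ x ≤ (‖x‖ / R) ^ α * φ ((R / ‖x‖) • x))
    (hθ : ∀ᵐ θ : USphere n ∂sphereMeasure n, φ (R • (θ : EucSp n)) ≤ u (R • (θ : EucSp n))) :
    IsAdmissible Ω g φ (fun x => u x + c * replDiff α R u x)
      (fun x => G x + c • replGrad α R u G x) := by
  have hcW := hW.const_smul hc.ne'
  refine ⟨hu.memW12.add_w0Pair hcW, ?_, ?_⟩
  · obtain ⟨B, hB⟩ := hu.boundary.exists_w0Pair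
    have h := (hB.add hcW).memW12Zero
    simpa only [add_sub_right_comm] using h
  · filter_upwards [hu.above, ae_restrict_of_ae (ae_direction hθ),
      ae_restrict_of_ae (ae_ne_zero n)] with x h1 h2 h3
    by_cases hx : x ∈ ball (0 : EucSp n) R
    · have h4 := le_homExt hR h3 (hφ x h3 (mem_ball_zero_iff.mp hx).le) h2
      rw [replDiff, indicator_of_mem hx]
      nlinarith
    · simpa [replDiff, hx] using h1

theorem integral_sq_le_add_repl {α R c : ℝ} (hR : 0 < R) (hc : 0 < c) (hc1 : c ≤ 1)
    {Ω : Set (EucSp n)} (hΩ : MeasurableSet Ω) (hball : ball 0 R ⊆ Ω) {g φ u : EucSp n → ℝ}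
    {G : EucSp n → EucSp n} (hu : IsObstacleMinimizer Ω g φ u G)
    (hW : W0Pair Ω (replDiff α R u) (replGrad α R u G))
    (hφ : ∀ x : EucSp n, x ≠ 0 → ‖x‖ ≤ R → φ x ≤ (‖x‖ / R) ^ α * φ ((R / ‖x‖) • x))
    (hθ : ∀ᵐ θ : USphere n ∂sphereMeasure n, φ (R • (θ : EucSp n)) ≤ u (R • (θ : EucSp n))) :
    ∫ x in ball 0 R, ‖G x‖ ^ 2 ≤ ∫ x in ball 0 R, ‖G x + c • (homGrad α R (sphereRestrict u R)
      (fun θ => G (R • (θ : EucSp n))) x - G x)‖ ^ 2 := by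
  have hadm := isAdmissible_add_repl hR hc hc1 hu.admissible hW hφ hθ
  have hmin := hu.minimal _ _ hadm
  have i1 : IntegrableOn (fun x => ‖G x‖ ^ 2) Ω :=
    hu.admissible.memW12.memLp_grad.integrable_norm_pow (by norm_num)
  have i2 : IntegrableOn (fun x => ‖G x + c • replGrad α R u G x‖ ^ 2) Ω :=
    hadm.memW12.memLp_grad.integrable_norm_pow (by norm_num)
  rw [← integral_inter_add_sdiff (s := Ω) (t := ball 0 R) measurableSet_ball i1,
    ← integral_inter_add_sdiff (s := Ω) (t := ball 0 R) measurableSet_ball i2,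
    inter_eq_self_of_subset_right hball,
    integral_congr_ae (μ := volume.restrict (Ω \ ball 0 R))
      (g := fun x => ‖G x‖ ^ 2) (f := fun x => ‖G x + c • replGrad α R u G x‖ ^ 2) (by
        filter_upwards [ae_restrict_mem (hΩ.diff measurableSet_ball)] with x hx
        simp [replGrad, hx.2])] at hmin
  have h := le_of_add_le_add_right hmin
  refine h.trans (le_of_eq (setIntegral_congr_fun measurableSet_ball fun x hx => ?_))
  simp [replGrad, hx]

theorem integral_sq_le_homGrad {α R : ℝ} (hR : 0 < R)
    {Ω : Set (EucSp n)} (hΩ : MeasurableSet Ω) (hball : ball 0 R ⊆ Ω) {g φ u : EucSp n → ℝ}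
    {G : EucSp n → EucSp n} (hu : IsObstacleMinimizer Ω g φ u G)
    (hW : W0Pair Ω (replDiff α R u) (replGrad α R u G))
    (hφ : ∀ x : EucSp n, x ≠ 0 → ‖x‖ ≤ R → φ x ≤ (‖x‖ / R) ^ α * φ ((R / ‖x‖) • x))
    (hθ : ∀ᵐ θ : USphere n ∂sphereMeasure n, φ (R • (θ : EucSp n)) ≤ u (R • (θ : EucSp n))) :
    ∫ x in ball 0 R, ‖G x‖ ^ 2 ≤ ∫ x in ball 0 R, ‖homGrad α R (sphereRestrict u R)
      (fun θ => G (R • (θ : EucSp n))) x‖ ^ 2 := by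
  simpa using integral_sq_le_add_repl hR one_pos le_rfl hΩ hball hu hW hφ hθ

/-- The energy is strictly convex: the parallelogram identity at the midpoint of `u` and `h` would
lower it unless the gradients agree. The membership on the whole space, `hW'`, then lets compact
support exclude a nonzero constant difference. -/
theorem isAEHomogeneousOnBall_of_integral_eq {α R : ℝ} (hα : 1 < α) (hR : 0 < R)
    {Ω : Set (EucSp n)} (hΩ : MeasurableSet Ω)
    (hball : ball 0 R ⊆ Ω) {g φ u : EucSp n → ℝ}
    {G : EucSp n → EucSp n} (hu : IsObstacleMinimizer Ω g φ u G)
    (hW : W0Pair Ω (replDiff α R u) (replGrad α R u G))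
    (hW' : W0Pair univ (replDiff α R u) (replGrad α R u G))
    (hφ : ∀ x : EucSp n, x ≠ 0 → ‖x‖ ≤ R → φ x ≤ (‖x‖ / R) ^ α * φ ((R / ‖x‖) • x))
    (hθ : ∀ᵐ θ : USphere n ∂sphereMeasure n, φ (R • (θ : EucSp n)) ≤ u (R • (θ : EucSp n)))
    (hf : MemLp (sphereRestrict u R) 2 (sphereMeasure n))
    (hF : MemLp (fun θ : USphere n => G (R • (θ : EucSp n))) 2 (sphereMeasure n))
    (heq : ∫ x in ball 0 R, ‖homGrad α R (sphereRestrict u R)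
      (fun θ => G (R • (θ : EucSp n))) x‖ ^ 2 = ∫ x in ball 0 R, ‖G x‖ ^ 2) :
    IsAEHomogeneousOnBall α R u := by
  set H := homGrad α R (sphereRestrict u R) (fun θ => G (R • (θ : EucSp n))) with hH
  have hhalf := integral_sq_le_add_repl hR one_half_pos (by norm_num) hΩ hball hu hW hφ hθ
  have hmG : MemLp G 2 (volume.restrict (ball 0 R)) :=
    (hu.admissible.memW12.mono hball hΩ).memLp_grad
  have hmH : MemLp H 2 (volume.restrict (ball 0 R)) := memLp_homGrad hα.le hR hf hF
  have i1 := hmG.integrable_norm_pow (p := 2) (by norm_num)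
  have i2 := hmH.integrable_norm_pow (p := 2) (by norm_num)
  have i3 : Integrable (fun x => ‖H x - G x‖ ^ 2) (volume.restrict (ball 0 R)) :=
    (hmH.sub hmG).integrable_norm_pow (by norm_num)
  have i12 : Integrable (fun x => 1 / 2 * ‖G x‖ ^ 2 + 1 / 2 * ‖H x‖ ^ 2)
    (volume.restrict (ball 0 R)) := (i1.const_mul _).add (i2.const_mul _)
  have hpar : ∀ x, ‖G x + (1 / 2 : ℝ) • (H x - G x)‖ ^ 2 =
      1 / 2 * ‖G x‖ ^ 2 + 1 / 2 * ‖H x‖ ^ 2 - 1 / 4 * ‖H x - G x‖ ^ 2 := by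
    intro x
    rw [norm_add_sq_real, norm_smul, real_inner_smul_right, inner_sub_right, norm_sub_sq_real,
      real_inner_self_eq_norm_sq, real_inner_comm (G x) (H x), mul_pow, norm_sub_sq_real,
      real_inner_comm (G x) (H x)]
    norm_num
    ring
  simp_rw [← hH, hpar] at hhalf
  rw [integral_sub i12 (i3.const_mul _),
    integral_add (i1.const_mul _) (i2.const_mul _), integral_const_mul, integral_const_mul,
    integral_const_mul, heq] at hhalf
  have hzero : ∫ x in ball 0 R, ‖H x - G x‖ ^ 2 = 0 :=
    le_antisymm (by linarith) (integral_nonneg fun x => by positivity)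
  rw [integral_eq_zero_iff_of_nonneg (fun x => by positivity) i3] at hzero
  have hgrad : replGrad α R u G =ᵐ[volume] 0 := by
    filter_upwards [(ae_restrict_iff' measurableSet_ball).mp hzero] with x hx
    by_cases hxb : x ∈ ball (0 : EucSp n) R
    · rw [replGrad, indicator_of_mem hxb]
      simpa using hx hxb
    · simp [replGrad, hxb]
  have hcomp : HasCompactSupport (replDiff α R u) := by
    refine HasCompactSupport.intro (isCompact_closedBall 0 R) fun x hx => ?_
    exact indicator_of_notMem (fun h => hx (ball_subset_closedBall h)) _
  have hd := hW'.memW12.ae_eq_zero_of_grad_eq_zero hcomp hgrad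
  refine ⟨_, isPosHomogeneous_homExt (by linarith) hR (sphereRestrict u R), ?_⟩
  rw [ae_restrict_iff' measurableSet_ball]
  filter_upwards [hd] with x hx hxb
  rw [replDiff, indicator_of_mem hxb, Pi.zero_apply, sub_eq_zero] at hx
  exact hx.symm

/-! ### The derivative of the Weiss energy -/

theorem weissA_eq {n : ℕ} {α R : ℝ} (hR : 0 < R) (G : EucSp n → EucSp n)
    (T : ℝ → USphere n → ℝ) :
    weissA α G T R = R ^ (-((n : ℝ) + 2 * (α - 1))) * (∫ x in ball (0 : EucSp n) R, ‖G x‖ ^ 2)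
      - α * (R ^ (-(2 * α)) * ∫ θ, T R θ ^ 2 ∂sphereMeasure n) := by
  rw [weissA]
  simp_rw [div_pow]
  rw [integral_div, ← Real.rpow_natCast (R ^ α), ← Real.rpow_mul hR.le, Real.rpow_neg hR.le (2 * α)]
  push_cast
  rw [mul_comm α 2]
  ring

/-- An identity that does not use minimality. With `N` the normal derivative, the defect expands to
`N² - (2α/R) T N + (α/R)² T²`. Its `N²` cancels the one missing from the tangential energy, the
cross term comes from the derivative of `∫ T²`, and the two `T²` terms add up to the derivative of
the factor `R^(-2α)`. -/
theorem hasDerivAt_weissA {α R : ℝ} (hα : 1 < α) (hR : 0 < R) {G : EucSp n → EucSp n}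
    {T : ℝ → USphere n → ℝ} (hf : MemLp (T R) 2 (sphereMeasure n))
    (hF : MemLp (fun θ : USphere n => G (R • (θ : EucSp n))) 2 (sphereMeasure n))
    (hD : HasDerivAt (fun r => ∫ x in ball (0 : EucSp n) r, ‖G x‖ ^ 2)
      (R ^ (n - 1) * ∫ θ : USphere n, ‖G (R • (θ : EucSp n))‖ ^ 2 ∂sphereMeasure n) R)
    (hH : HasDerivAt (fun r => ∫ θ, T r θ ^ 2 ∂sphereMeasure n)
      (∫ θ : USphere n, 2 * (T R θ * inner ℝ (G (R • (θ : EucSp n))) (θ : EucSp n))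
        ∂sphereMeasure n) R) :
    Integrable (radialDefect α G T R) (sphereMeasure n) ∧
    HasDerivAt (weissA α G T) ((n + 2 * (α - 1)) * R ^ (-((n : ℝ) + 2 * (α - 1))) / R *
      ((∫ x in ball 0 R, ‖homGrad α R (T R) (fun θ => G (R • (θ : EucSp n))) x‖ ^ 2) -
        ∫ x in ball 0 R, ‖G x‖ ^ 2) +
      R ^ (-(1 + 2 * (α - 1))) * ∫ θ, radialDefect α G T R θ ∂sphereMeasure n) R := by
  have hn : (n : ℝ) ≥ 1 := by exact_mod_cast NeZero.one_le
  set F : USphere n → EucSp n := fun θ => G (R • (θ : EucSp n)) with hFdef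
  set N : USphere n → ℝ := fun θ => inner ℝ (F θ) (θ : EucSp n) with hNdef
  have hθ : AEStronglyMeasurable (fun θ : USphere n => (θ : EucSp n)) (sphereMeasure n) :=
    continuous_subtype_val.aestronglyMeasurable
  have hN : MemLp N 2 (sphereMeasure n) := by
    refine hF.mono (hF.1.inner hθ) (.of_forall fun θ => ?_)
    simpa using norm_inner_le_norm (𝕜 := ℝ) (F θ) (θ : EucSp n)
  have i1 := hf.integrable_sq
  have i3 := hN.integrable_sq
  have i4 : Integrable (fun θ => T R θ * N θ) (sphereMeasure n) := hf.integrable_mul hN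
  have i34 : Integrable (fun θ => N θ ^ 2 - 2 * α / R * (T R θ * N θ)) (sphereMeasure n) :=
    i3.sub (i4.const_mul _)
  have e : radialDefect α G T R = fun θ =>
      N θ ^ 2 - 2 * α / R * (T R θ * N θ) + (α / R) ^ 2 * T R θ ^ 2 := by
    ext1 θ
    simp only [radialDefect, hNdef, hFdef]
    ring
  refine ⟨by rw [e]; exact i34.add (i1.const_mul _), ?_⟩
  have hev : weissA α G T =ᶠ[𝓝 R] fun r => r ^ (-((n : ℝ) + 2 * (α - 1))) *
      (∫ x in ball (0 : EucSp n) r, ‖G x‖ ^ 2) -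
      α * (r ^ (-(2 * α)) * ∫ θ, T r θ ^ 2 ∂sphereMeasure n) := by
    filter_upwards [lt_mem_nhds hR] with r hr
    exact weissA_eq hr G T
  have d1 := (hasDerivAt_id R).rpow_const (p := -((n : ℝ) + 2 * (α - 1))) (Or.inl hR.ne')
  have d2 := (hasDerivAt_id R).rpow_const (p := -(2 * α)) (Or.inl hR.ne')
  refine (((d1.mul hD).sub ((d2.mul hH).const_mul α)).congr_of_eventuallyEq hev).congr_deriv ?_
  rw [integral_norm_homGrad_sq hα hR hf hF, e]
  rw [    integral_add i34 (i1.const_mul _), integral_sub i3 (i4.const_mul _),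
    integral_const_mul, integral_const_mul, integral_const_mul]
  simp only [id]
  rw [Real.rpow_sub_one hR.ne', Real.rpow_sub_one hR.ne']
  -- All powers are reduced to `R^(-(n+2(α-1)))`, `R^(n-1)` and `R`, after which the identity is
  -- algebraic.
  have hpow : R ^ n = R ^ (n - 1) * R := by
    rw [← pow_succ, Nat.sub_add_cancel NeZero.one_le]
  have hq : R ^ (-(1 + 2 * (α - 1))) = R ^ (-((n : ℝ) + 2 * (α - 1))) * R ^ (n - 1) := by
    rw [← Real.rpow_natCast, ← Real.rpow_add hR, Nat.cast_sub NeZero.one_le]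
    congr 1
    push_cast
    ring
  have hq2 : R ^ (-(2 * α)) = R ^ (-((n : ℝ) + 2 * (α - 1))) * R ^ (n - 1) / R := by
    rw [← hq, ← Real.rpow_sub_one hR.ne']
    congr 1
    ring
  rw [hq, hq2, hpow]
  have h0 : (n : ℝ) + 2 * (α - 1) ≠ 0 := by linarith
  field_simp
  ring

end

/-! ### Functions that are primitives -/

theorem AbsolutelyContinuousOnInterval.congr {f g : ℝ → ℝ} {a b : ℝ}
    (hf : AbsolutelyContinuousOnInterval f a b) (h : EqOn f g (uIcc a b)) :
    AbsolutelyContinuousOnInterval g a b := by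
  refine Tendsto.congr' ?_ hf
  rw [EventuallyEq, eventually_inf_principal]
  refine .of_forall fun E hE => Finset.sum_congr rfl fun i hi => ?_
  rw [h (hE.1 i hi).1, h (hE.1 i hi).2]

theorem absolutelyContinuousOnInterval_of_sub_eq_integral {f g : ℝ → ℝ} {a b : ℝ}
    (hg : IntervalIntegrable g volume a b)
    (h : ∀ x ∈ uIcc a b, f x - f a = ∫ t in a..x, g t) :
    AbsolutelyContinuousOnInterval f a b := by
  have h1 : AbsolutelyContinuousOnInterval (fun _ : ℝ => f a) a b :=
    ContDiffOn.absolutelyContinuousOnInterval contDiffOn_const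
  refine (h1.add (hg.absolutelyContinuousOnInterval_intervalIntegral left_mem_uIcc)).congr
    fun x hx => ?_
  rw [Pi.add_apply, ← h x hx]
  ring

/-- Since `g` need not be integrable up to the endpoints, Lebesgue's differentiation theorem is
applied on the countably many compact subintervals with rational endpoints. -/
theorem ae_hasDerivAt_of_sub_eq_integral {f g : ℝ → ℝ} {R₀ : ℝ}
    (hg : ∀ x y, 0 < x → x ≤ y → y < R₀ → IntervalIntegrable g volume x y)
    (h : ∀ r ∈ Ioo 0 R₀, ∀ R ∈ Ioo 0 R₀, f R - f r = ∫ t in r..R, g t) :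
    ∀ᵐ R ∂volume.restrict (Ioo 0 R₀), HasDerivAt f (g R) R := by
  have h1 : ∀ᵐ R : ℝ, ∀ p q : ℚ, (0 : ℝ) < p ∧ (p : ℝ) < q ∧ (q : ℝ) < R₀ →
      R ∈ uIcc (p : ℝ) q → ∀ c ∈ uIcc (p : ℝ) q,
        HasDerivAt (fun x => ∫ t in c..x, g t) (g R) R := by
    rw [ae_all_iff]
    intro p
    rw [ae_all_iff]
    intro q
    by_cases hpq : (0 : ℝ) < p ∧ (p : ℝ) < q ∧ (q : ℝ) < R₀
    · filter_upwards [(hg p q hpq.1 hpq.2.1.le hpq.2.2).ae_hasDerivAt_integral] with R hR _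
      exact hR
    · exact .of_forall fun R h => absurd h hpq
  rw [ae_restrict_iff' measurableSet_Ioo]
  filter_upwards [h1] with R hR hR0
  obtain ⟨p, hp1, hp2⟩ := exists_rat_btwn hR0.1
  obtain ⟨q, hq1, hq2⟩ := exists_rat_btwn hR0.2
  have hd := hR p q ⟨hp1, hp2.trans hq1, hq2⟩ (by
    rw [uIcc_of_le (hp2.trans hq1).le]; exact ⟨hp2.le, hq1.le⟩) p left_mem_uIcc
  refine (hd.const_add (f p)).congr_of_eventuallyEq ?_
  filter_upwards [isOpen_Ioo.mem_nhds hR0] with x hx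
  rw [← h p ⟨hp1, hp2.trans hR0.2⟩ x hx]
  ring

theorem monotoneOn_of_absolutelyContinuousOnInterval {f : ℝ → ℝ} {a b : ℝ}
    (hf : ∀ x y, a < x → x < y → y < b → AbsolutelyContinuousOnInterval f x y)
    (h : ∀ᵐ x ∂volume.restrict (Ioo a b), 0 ≤ deriv f x) : MonotoneOn f (Ioo a b) := by
  intro x hx y hy hxy
  rcases hxy.eq_or_lt with rfl | hlt
  · exact le_rfl
  rw [← sub_nonneg, ← (hf x y hx.1 hlt hy.2).integral_deriv_eq_sub]
  refine intervalIntegral.integral_nonneg_of_ae_restrict hxy (ae_restrict_of_ae_restrict_of_subset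
    (Icc_subset_Ioo hx.1 hy.2) h)

/-! ### The Weiss energy as a function of the radius -/

section

variable {n : ℕ} [NeZero n]

theorem integral_ball_sub {R₀ : ℝ} {f : EucSp n → ℝ} (hf : IntegrableOn f (ball 0 R₀)) {r R : ℝ}
    (hr : r ∈ Ioo 0 R₀) (hR : R ∈ Ioo 0 R₀) :
    (∫ x in ball (0 : EucSp n) R, f x) - (∫ x in ball (0 : EucSp n) r, f x) =
      ∫ t in r..R, t ^ (n - 1) * ∫ θ, f (t • (θ : EucSp n)) ∂sphereMeasure n := by
  have hi : ∀ s ∈ Ioo 0 R₀, IntervalIntegrable (fun t => t ^ (n - 1) *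
      ∫ θ, f (t • (θ : EucSp n)) ∂sphereMeasure n) volume 0 s := by
    intro s hs
    rw [intervalIntegrable_iff_integrableOn_Ioo_of_le hs.1.le]
    exact (integrable_polar_ball hf).1.mono_set (Ioo_subset_Ioo_right hs.2.le)
  have he : ∀ s ∈ Ioo 0 R₀, ∫ x in ball (0 : EucSp n) s, f x =
      ∫ t in 0..s, t ^ (n - 1) * ∫ θ, f (t • (θ : EucSp n)) ∂sphereMeasure n := by
    intro s hs
    rw [intervalIntegral.integral_of_le hs.1.le, integral_Ioc_eq_integral_Ioo]
    exact (integrable_polar_ball (hf.mono_set (ball_subset_ball hs.2.le))).2.2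
  rw [he R hR, he r hr, intervalIntegral.integral_interval_sub_left (hi R hR) (hi r hr)]

theorem intervalIntegrable_integral_sphere {R₀ : ℝ} {f : EucSp n → ℝ}
    (hf : IntegrableOn f (ball 0 R₀)) {a b : ℝ} (ha : 0 < a) (hab : a ≤ b) (hb : b < R₀) :
    IntervalIntegrable (fun t => t ^ (n - 1) * ∫ θ, f (t • (θ : EucSp n)) ∂sphereMeasure n)
      volume a b := by
  rw [intervalIntegrable_iff_integrableOn_Ioo_of_le hab]
  exact (integrable_polar_ball hf).1.mono_set (Ioo_subset_Ioo ha.le hb.le)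

theorem absolutelyContinuousOnInterval_weissA {α R₀ : ℝ} {u : EucSp n → ℝ} {G : EucSp n → EucSp n}
    (h : MemW12 (ball 0 R₀) u G) {T : ℝ → USphere n → ℝ} (hT : IsSphereTrace R₀ u T) {a b : ℝ}
    (ha : 0 < a) (hab : a < b) (hb : b < R₀) :
    AbsolutelyContinuousOnInterval (weissA α G T) a b := by
  have hsub : ∀ x ∈ uIcc a b, x ∈ Ioo 0 R₀ := by
    rw [uIcc_of_le hab.le]
    exact fun x hx => ⟨ha.trans_le hx.1, hx.2.trans_lt hb⟩
  have ha0 := hsub a left_mem_uIcc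
  have hG : IntegrableOn (fun x => ‖G x‖ ^ 2) (ball 0 R₀) :=
    h.memLp_grad.integrable_norm_pow (by norm_num)
  have hD := absolutelyContinuousOnInterval_of_sub_eq_integral
    (intervalIntegrable_integral_sphere hG ha hab.le hb)
    fun x hx => integral_ball_sub hG ha0 (hsub x hx)
  have hH := absolutelyContinuousOnInterval_of_sub_eq_integral
    (intervalIntegrable_sphereFlux h ha hab.le hb)
    fun x hx => hT.integral_sq_sub h ha0 (hsub x hx)
  have hp : ∀ p : ℝ, AbsolutelyContinuousOnInterval (fun x : ℝ => x ^ p) a b := fun p =>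
    ContDiffOn.absolutelyContinuousOnInterval fun x hx =>
      (Real.contDiffAt_rpow_const_of_ne (hsub x hx).1.ne').contDiffWithinAt
  refine (((hp (-((n : ℝ) + 2 * (α - 1)))).fun_mul hD).fun_sub (((hp (-(2 * α))).fun_mul hH).const_mul α)).congr
    fun x hx => ?_
  exact (weissA_eq (hsub x hx).1 G T).symm

/-- The properties of the derivative of the Weiss energy at a radius `R` at which the energy and
the spherical mean are differentiable and the homogeneous replacement is admissible. -/
theorem weissA_deriv_spec {α R : ℝ} (hα : 1 < α) (hR : 0 < R) {Ω : Set (EucSp n)}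
    (hΩ : MeasurableSet Ω) (hball : ball 0 R ⊆ Ω) {g φ u : EucSp n → ℝ} {G : EucSp n → EucSp n}
    (hu : IsObstacleMinimizer Ω g φ u G)
    (hW : W0Pair Ω (replDiff α R u) (replGrad α R u G))
    (hW' : W0Pair univ (replDiff α R u) (replGrad α R u G))
    (hφ : ∀ x : EucSp n, x ≠ 0 → ‖x‖ ≤ R → φ x ≤ (‖x‖ / R) ^ α * φ ((R / ‖x‖) • x))
    (hθ : ∀ᵐ θ : USphere n ∂sphereMeasure n, φ (R • (θ : EucSp n)) ≤ u (R • (θ : EucSp n)))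
    (hf : MemLp (sphereRestrict u R) 2 (sphereMeasure n))
    (hF : MemLp (fun θ : USphere n => G (R • (θ : EucSp n))) 2 (sphereMeasure n))
    {T : ℝ → USphere n → ℝ} (hT : T R =ᵐ[sphereMeasure n] sphereRestrict u R)
    (hD : HasDerivAt (fun r => ∫ x in ball (0 : EucSp n) r, ‖G x‖ ^ 2)
      (R ^ (n - 1) * ∫ θ : USphere n, ‖G (R • (θ : EucSp n))‖ ^ 2 ∂sphereMeasure n) R)
    (hH : HasDerivAt (fun r => ∫ θ, T r θ ^ 2 ∂sphereMeasure n) (sphereFlux u G R) R) :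
    DifferentiableAt ℝ (weissA α G T) R ∧
    Integrable (radialDefect α G T R) (sphereMeasure n) ∧
    R ^ (-(1 + 2 * (α - 1))) * (∫ θ, radialDefect α G T R θ ∂(sphereMeasure n))
      ≤ deriv (weissA α G T) R ∧
    (deriv (weissA α G T) R = 0 → IsAEHomogeneousOnBall α R u) := by
  have hn : (n : ℝ) ≥ 1 := by exact_mod_cast NeZero.one_le
  have hH' : sphereFlux u G R = ∫ θ : USphere n,
      2 * (T R θ * inner ℝ (G (R • (θ : EucSp n))) (θ : EucSp n)) ∂sphereMeasure n := by
    refine integral_congr_ae ?_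
    filter_upwards [hT] with θ h
    rw [h, sphereRestrict]
  rw [hH'] at hH
  obtain ⟨h1, h2⟩ := hasDerivAt_weissA hα hR ((memLp_congr_ae hT).mpr hf) hF hD hH
  have hE : ∫ x in ball (0 : EucSp n) R,
      ‖homGrad α R (T R) (fun θ => G (R • (θ : EucSp n))) x‖ ^ 2 =
      ∫ x in ball (0 : EucSp n) R,
      ‖homGrad α R (sphereRestrict u R) (fun θ => G (R • (θ : EucSp n))) x‖ ^ 2 := by
    refine integral_congr_ae (ae_restrict_of_ae ?_)
    filter_upwards [ae_direction hT] with x hx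
    rw [homGrad, homGrad, hx]
  rw [hE] at h2
  have hmin := integral_sq_le_homGrad hR hΩ hball hu hW hφ hθ
  have hc : 0 < (n + 2 * (α - 1)) * R ^ (-((n : ℝ) + 2 * (α - 1))) / R := by
    have := Real.rpow_pos_of_pos hR (-((n : ℝ) + 2 * (α - 1)))
    have : 0 < (n : ℝ) + 2 * (α - 1) := by linarith
    positivity
  have hdef : 0 ≤ R ^ (-(1 + 2 * (α - 1))) * ∫ θ, radialDefect α G T R θ ∂sphereMeasure n :=
    mul_nonneg (by positivity) (integral_nonneg fun θ => sq_nonneg _)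
  have hfirst := mul_nonneg hc.le (sub_nonneg.mpr hmin)
  refine ⟨h2.differentiableAt, h1, ?_, fun h0 => ?_⟩
  · rw [h2.deriv]
    linarith
  · rw [h2.deriv] at h0
    -- Both summands of the derivative are nonnegative, so a zero derivative forces the energy gap
    -- to be zero.
    have h3 := (mul_eq_zero.mp (le_antisymm (by linarith) hfirst)).resolve_left hc.ne'
    exact isAEHomogeneousOnBall_of_integral_eq hα hR hΩ hball hu hW hW' hφ hθ hf hF
      (sub_eq_zero.mp h3)

theorem ae_weissA_deriv_spec {α R₀ : ℝ} (hα : 1 < α) {Ω : Set (EucSp n)}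
    (hΩ : IsOpen Ω) (hball : ball 0 R₀ ⊆ Ω) {g φ u : EucSp n → ℝ} {G : EucSp n → EucSp n}
    (hu : IsObstacleMinimizer Ω g φ u G)
    (hφ : ∀ R ∈ Ioo 0 R₀, ∀ x : EucSp n, x ≠ 0 → ‖x‖ ≤ R →
      φ x ≤ (‖x‖ / R) ^ α * φ ((R / ‖x‖) • x))
    {T : ℝ → USphere n → ℝ} (hT : IsSphereTrace R₀ u T) :
    ∀ᵐ R ∂volume.restrict (Ioo 0 R₀), DifferentiableAt ℝ (weissA α G T) R ∧
      Integrable (radialDefect α G T R) (sphereMeasure n) ∧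
      R ^ (-(1 + 2 * (α - 1))) * (∫ θ, radialDefect α G T R θ ∂(sphereMeasure n))
        ≤ deriv (weissA α G T) R ∧
      (deriv (weissA α G T) R = 0 → IsAEHomogeneousOnBall α R u) := by
  have h : MemW12 (ball 0 R₀) u G := hu.admissible.memW12.mono hball hΩ.measurableSet
  have hG : IntegrableOn (fun x => ‖G x‖ ^ 2) (ball 0 R₀) :=
    h.memLp_grad.integrable_norm_pow (by norm_num)
  have hD := ae_hasDerivAt_of_sub_eq_integral
    (f := fun r => ∫ x in ball (0 : EucSp n) r, ‖G x‖ ^ 2)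
    (fun x y hx hxy hy => intervalIntegrable_integral_sphere hG hx hxy hy)
    (fun r hr R hR => integral_ball_sub hG hr hR)
  have hH := ae_hasDerivAt_of_sub_eq_integral (f := fun r => ∫ θ, T r θ ^ 2 ∂sphereMeasure n)
    (fun x y hx hxy hy => intervalIntegrable_sphereFlux h hx hxy hy)
    (fun r hr R hR => hT.integral_sq_sub h hr hR)
  filter_upwards [hD, hH, hT.ae_eq, ae_restrict_mem measurableSet_Ioo, ae_memLp_sphere h.memLp,
    ae_memLp_sphere h.memLp_grad,
    ae_Ioo_of_forall_lt fun R₁ hR₁ => ae_w0Pair_repl hα h hΩ hball hR₁,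
    ae_Ioo_of_forall_lt fun R₁ hR₁ => ae_w0Pair_repl hα h isOpen_univ (subset_univ _) hR₁,
    ae_polar_ball (ae_restrict_of_ae_restrict_of_subset hball hu.admissible.above)]
    with R h1 h2 h3 h4 h5 h6 h7 h8 h9
  exact weissA_deriv_spec hα h4.1 hΩ.measurableSet ((ball_subset_ball h4.2.le).trans hball) hu h7 h8
    (hφ R h4) h9 h5 h6 h3 h1 h2

theorem deriv_weissA_nonneg {n : ℕ} {α R : ℝ} (hR : 0 < R) {G : EucSp n → EucSp n}
    {T : ℝ → USphere n → ℝ}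
    (h : R ^ (-(1 + 2 * (α - 1))) * (∫ θ, radialDefect α G T R θ ∂(sphereMeasure n))
        ≤ deriv (weissA α G T) R) : 0 ≤ deriv (weissA α G T) R :=
  (mul_nonneg (by positivity) (integral_nonneg fun θ => sq_nonneg _)).trans h

end

section

variable {n : ℕ}

/-! ### Uniqueness of weak gradients -/

/-- The fundamental lemma of the calculus of variations, applied to the difference of the gradients.
-/
theorem MemW12.grad_ae_eq {Ω : Set (EucSp n)} (hΩ : IsOpen Ω) {u v : EucSp n → ℝ}
    {G H : EucSp n → EucSp n} (h : MemW12 Ω u G) (h' : MemW12 Ω v H)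
    (huv : u =ᵐ[volume.restrict Ω] v) : G =ᵐ[volume.restrict Ω] H := by
  have hloc : LocallyIntegrable (fun x => G x - H x) (volume.restrict Ω) :=
    (h.memLp_grad.sub h'.memLp_grad).locallyIntegrable (by norm_num)
  have hz := hΩ.ae_eq_zero_of_integral_contDiff_smul_eq_zero
    (μ := volume.restrict Ω) (hloc.locallyIntegrableOn Ω) fun ψ h1 h2 h3 => by
      have hψ : IsTestFunction Ω ψ := ⟨h1, h2, h3⟩
      have m := hψ.memLp (volume.restrict Ω)
      simp_rw [smul_sub]
      rw [integral_sub (MemLp.integrable_smul_two m h.memLp_grad)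
        (MemLp.integrable_smul_two m h'.memLp_grad), sub_eq_zero, ← neg_inj,
        ← h.weak ψ hψ, ← h'.weak ψ hψ]
      refine integral_congr_ae ?_
      filter_upwards [huv] with x hx
      rw [hx]
  filter_upwards [hz, ae_restrict_mem hΩ.measurableSet] with x hx hxΩ
  exact sub_eq_zero.mp (hx hxΩ)

theorem memW12_zero (Ω : Set (EucSp n)) : MemW12 Ω (0 : EucSp n → ℝ) (0 : EucSp n → EucSp n) :=
  ⟨MemLp.zero, MemLp.zero, by simp⟩

/-! ### Homogeneity on balls -/

theorem ae_ball_of_forall_lt {ρ : ℝ} (hρ : 0 < ρ) {P : EucSp n → Prop}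
    (h : ∀ R ∈ Ioo 0 ρ, ∀ᵐ x ∂volume.restrict (ball 0 R), P x) :
    ∀ᵐ x ∂volume.restrict (ball 0 ρ), P x := by
  obtain ⟨s, -, hs1, hs2⟩ := exists_seq_strictMono_tendsto' hρ
  have h1 : ∀ᵐ x : EucSp n, ∀ m, x ∈ ball 0 (s m) → P x := ae_all_iff.mpr fun m =>
    (ae_restrict_iff' measurableSet_ball).mp (h (s m) (hs1 m))
  rw [ae_restrict_iff' measurableSet_ball]
  filter_upwards [h1] with x hx hx0
  obtain ⟨m, hm⟩ := ((tendsto_order.mp hs2).1 ‖x‖ (mem_ball_zero_iff.mp hx0)).exists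
  exact hx m (mem_ball_zero_iff.mpr hm)

theorem IsAEHomogeneousOnBall.mono {α ρ R : ℝ} {u : EucSp n → ℝ}
    (h : IsAEHomogeneousOnBall α ρ u) (hR : R ≤ ρ) : IsAEHomogeneousOnBall α R u := by
  obtain ⟨v, hv, huv⟩ := h
  exact ⟨v, hv, ae_restrict_of_ae_restrict_of_subset (ball_subset_ball hR) huv⟩

theorem ae_comp_const_smul {t : ℝ} (ht : t ≠ 0) {P : EucSp n → Prop} (h : ∀ᵐ x, P x) :
    ∀ᵐ x : EucSp n, P (t • x) := by
  rw [ae_iff] at h ⊢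
  have := Measure.addHaar_preimage_smul (volume : Measure (EucSp n)) ht {x | ¬ P x}
  rw [h, mul_zero] at this
  exact this

theorem IsPosHomogeneous.ae_eq_ball {α r R : ℝ} (hr : 0 < r) (hR : 0 < R) {v w : EucSp n → ℝ}
    (hv : IsPosHomogeneous α v) (hw : IsPosHomogeneous α w)
    (h : ∀ᵐ x ∂volume.restrict (ball (0 : EucSp n) r), v x = w x) :
    ∀ᵐ x ∂volume.restrict (ball (0 : EucSp n) R), v x = w x := by
  have ht : 0 < r / R := div_pos hr hR
  rw [ae_restrict_iff' measurableSet_ball] at h ⊢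
  filter_upwards [ae_comp_const_smul ht.ne' h] with x hx hxR
  have hmem : (r / R) • x ∈ ball (0 : EucSp n) r := by
    rw [mem_ball_zero_iff, norm_smul, Real.norm_of_nonneg ht.le, div_mul_eq_mul_div, div_lt_iff₀ hR]
    exact mul_lt_mul_of_pos_left (mem_ball_zero_iff.mp hxR) hr
  have h1 := hx hmem
  rw [hv _ _ ht, hw _ _ ht] at h1
  exact mul_left_cancel₀ (Real.rpow_pos_of_pos ht α).ne' h1

/-- The homogeneous representatives for different radii agree on a common small ball, hence by
scaling on every ball, so the one belonging to `ρ / 2` serves throughout. -/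
theorem isAEHomogeneousOnBall_of_forall_lt {α ρ : ℝ} (hρ : 0 < ρ) {u : EucSp n → ℝ}
    (h : ∀ R ∈ Ioo 0 ρ, IsAEHomogeneousOnBall α R u) : IsAEHomogeneousOnBall α ρ u := by
  obtain ⟨v, hv, huv⟩ := h (ρ / 2) ⟨half_pos hρ, half_lt_self hρ⟩
  refine ⟨v, hv, ae_ball_of_forall_lt hρ fun R hR => ?_⟩
  obtain ⟨w, hw, huw⟩ := h R hR
  have hm : 0 < min (ρ / 2) R := lt_min (half_pos hρ) hR.1
  have h1 : ∀ᵐ x ∂volume.restrict (ball (0 : EucSp n) (min (ρ / 2) R)), w x = v x := by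
    filter_upwards [ae_restrict_of_ae_restrict_of_subset (ball_subset_ball (min_le_left _ _)) huv,
      ae_restrict_of_ae_restrict_of_subset (ball_subset_ball (min_le_right _ _)) huw] with x h1 h2
    rw [← h1, ← h2]
  filter_upwards [huw, hw.ae_eq_ball hm hR.1 hv h1] with x h2 h3
  rw [h2, h3]

end

section

variable {n : ℕ} [NeZero n]

theorem IsPosHomogeneous.homExt_eq {α R : ℝ} (hR : 0 < R) {v : EucSp n → ℝ}
    (hv : IsPosHomogeneous α v) {x : EucSp n} (hx : x ≠ 0) :
    homExt α R (sphereRestrict v R) x = v x := by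
  have hx' : 0 < ‖x‖ := norm_pos_iff.mpr hx
  rw [homExt, sphereRestrict, ← hv _ _ (div_pos hx' hR), smul_smul, div_mul_cancel₀ _ hR.ne',
    norm_smul_direction]

/-- A homogeneous function is its own replacement, so the difference vanishes, and weak gradients
are unique. -/
theorem replGrad_ae_eq_zero {α R R₀ : ℝ} (hR : R ∈ Ioo 0 R₀) {u v : EucSp n → ℝ}
    {G : EucSp n → EucSp n} (hv : IsPosHomogeneous α v)
    (huv : ∀ᵐ x ∂volume.restrict (ball 0 R₀), u x = v x)
    (hθ : ∀ᵐ θ : USphere n ∂sphereMeasure n, u (R • (θ : EucSp n)) = v (R • (θ : EucSp n)))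
    (hW : W0Pair univ (replDiff α R u) (replGrad α R u G)) :
    replGrad α R u G =ᵐ[volume] 0 := by
  have hd : replDiff α R u =ᵐ[volume] 0 := by
    filter_upwards [ae_direction hθ, ae_ne_zero n, (ae_restrict_iff' measurableSet_ball).mp huv]
      with x h1 h2 h3
    by_cases hx : x ∈ ball (0 : EucSp n) R
    · rw [replDiff, indicator_of_mem hx, h3 (ball_subset_ball hR.2.le hx), Pi.zero_apply,
        sub_eq_zero, ← hv.homExt_eq hR.1 h2, homExt, homExt, sphereRestrict, h1, sphereRestrict]
    · simp [replDiff, hx]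
  have h := hW.memW12.grad_ae_eq isOpen_univ (memW12_zero univ) (by simpa using hd)
  simpa using h

/-- Euler's relation for the weak gradient of a homogeneous function. -/
theorem ae_inner_eq_of_homogeneous {α ρ : ℝ} (hα : 1 < α) (hρ : 0 < ρ)
    {u v : EucSp n → ℝ} {G : EucSp n → EucSp n} (h : MemW12 (ball 0 ρ) u G)
    (hv : IsPosHomogeneous α v) (huv : ∀ᵐ x ∂volume.restrict (ball 0 ρ), u x = v x) :
    ∀ᵐ x ∂volume.restrict (ball (0 : EucSp n) ρ),
      inner ℝ (G x) (direction x : EucSp n) = α * u x / ‖x‖ := by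
  have hW := ae_Ioo_of_forall_lt fun R₁ hR₁ =>
    ae_w0Pair_repl hα h isOpen_univ (subset_univ _) hR₁
  have hgood : ∀ᵐ R ∂volume.restrict (Ioo 0 ρ), ∀ᵐ x ∂volume.restrict (ball (0 : EucSp n) R),
      inner ℝ (G x) (direction x : EucSp n) = α * u x / ‖x‖ := by
    filter_upwards [hW, ae_polar_ball huv, ae_restrict_mem measurableSet_Ioo] with R h1 h2 hR
    rw [ae_restrict_iff' measurableSet_ball]
    filter_upwards [replGrad_ae_eq_zero hR hv huv h2 h1, ae_direction h2, ae_ne_zero n,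
      (ae_restrict_iff' measurableSet_ball).mp huv] with x h3 h4 h5 h6 hx
    -- Now `G` is the explicit gradient of the homogeneous extension. Its tangential part is
    -- orthogonal to the direction, and the radial part is `α u / |x|`.
    rw [replGrad, indicator_of_mem hx, Pi.zero_apply, sub_eq_zero] at h3
    have hx' : 0 < ‖x‖ := norm_pos_iff.mpr h5
    rw [← h3, h6 (ball_subset_ball hR.2.le hx), ← hv.homExt_eq hR.1 h5, homGrad, homExt,
      real_inner_smul_left, inner_add_left, inner_sub_left, real_inner_smul_left,
      real_inner_smul_left, real_inner_self_eq_norm_sq, norm_usphere, sphereRestrict, sphereRestrict,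
      h4, Real.rpow_sub_one (div_pos hx' hR.1).ne']
    field_simp [hR.1.ne']
    ring
  refine ae_ball_of_forall_lt hρ fun R hR => ?_
  have hne : (ae (volume.restrict (Ioo R ρ))).NeBot := by
    rw [ae_neBot, Ne, Measure.restrict_eq_zero]
    simpa using hR.2
  obtain ⟨R', h1, h2⟩ := ((ae_restrict_of_ae_restrict_of_subset (Ioo_subset_Ioo_left hR.1.le)
    hgood).and (ae_restrict_mem measurableSet_Ioo)).exists
  exact ae_restrict_of_ae_restrict_of_subset (ball_subset_ball h2.1.le) h1

/-- In the derivative formula the energy gap is zero because the replacement has gradient `G`, and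
the radial defect is zero by Euler's relation. -/
theorem ae_hasDerivAt_weissA_zero {α ρ R₀ : ℝ} (hα : 1 < α) (hρ : 0 < ρ) (hρR : ρ ≤ R₀)
    {u : EucSp n → ℝ} {G : EucSp n → EucSp n} (h : MemW12 (ball 0 R₀) u G)
    {T : ℝ → USphere n → ℝ} (hT : IsSphereTrace R₀ u T) (hu : IsAEHomogeneousOnBall α ρ u) :
    ∀ᵐ R ∂volume.restrict (Ioo 0 ρ), HasDerivAt (weissA α G T) 0 R := by
  obtain ⟨v, hv, huv⟩ := hu
  have hG : IntegrableOn (fun x => ‖G x‖ ^ 2) (ball 0 R₀) :=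
    h.memLp_grad.integrable_norm_pow (by norm_num)
  have hD := ae_hasDerivAt_of_sub_eq_integral
    (f := fun r => ∫ x in ball (0 : EucSp n) r, ‖G x‖ ^ 2)
    (fun x y hx hxy hy => intervalIntegrable_integral_sphere hG hx hxy hy)
    (fun r hr R hR => integral_ball_sub hG hr hR)
  have hH := ae_hasDerivAt_of_sub_eq_integral (f := fun r => ∫ θ, T r θ ^ 2 ∂sphereMeasure n)
    (fun x y hx hxy hy => intervalIntegrable_sphereFlux h hx hxy hy)
    (fun r hr R hR => hT.integral_sq_sub h hr hR)
  have hEuler := ae_polar_ball (ae_inner_eq_of_homogeneous hα hρ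
    (h.mono (ball_subset_ball hρR) measurableSet_ball) hv huv)
  have hsub : Ioo 0 ρ ⊆ Ioo 0 R₀ := Ioo_subset_Ioo_right hρR
  filter_upwards [ae_restrict_of_ae_restrict_of_subset hsub hD,
    ae_restrict_of_ae_restrict_of_subset hsub hH,
    ae_restrict_of_ae_restrict_of_subset hsub hT.ae_eq, ae_restrict_mem measurableSet_Ioo,
    ae_restrict_of_ae_restrict_of_subset hsub (ae_memLp_sphere h.memLp),
    ae_restrict_of_ae_restrict_of_subset hsub (ae_memLp_sphere h.memLp_grad),
    ae_restrict_of_ae_restrict_of_subset hsub (ae_Ioo_of_forall_lt fun R₁ hR₁ =>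
      ae_w0Pair_repl hα h isOpen_univ (subset_univ _) hR₁),
    ae_polar_ball huv, hEuler] with R h1 h2 h3 h4 h5 h6 h7 h8 h9
  have hH' : sphereFlux u G R = ∫ θ : USphere n,
      2 * (T R θ * inner ℝ (G (R • (θ : EucSp n))) (θ : EucSp n)) ∂sphereMeasure n := by
    refine integral_congr_ae ?_
    filter_upwards [h3] with θ hθ
    rw [hθ]
  rw [hH'] at h2
  have hTu : T R =ᵐ[sphereMeasure n] sphereRestrict u R := h3
  refine (hasDerivAt_weissA hα h4.1 ((memLp_congr_ae hTu).mpr h5) h6 h1 h2).2.congr_deriv ?_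
  have hE : ∫ x in ball (0 : EucSp n) R,
      ‖homGrad α R (T R) (fun θ => G (R • (θ : EucSp n))) x‖ ^ 2 =
      ∫ x in ball (0 : EucSp n) R, ‖G x‖ ^ 2 := by
    refine integral_congr_ae ?_
    rw [EventuallyEq, ae_restrict_iff' measurableSet_ball]
    filter_upwards [ae_direction hTu, replGrad_ae_eq_zero h4 hv huv h8 h7] with x hx hx2 hxb
    rw [replGrad, indicator_of_mem hxb, Pi.zero_apply, sub_eq_zero] at hx2
    rw [← hx2, homGrad, homGrad, hx]
  have hdef : ∫ θ, radialDefect α G T R θ ∂sphereMeasure n = 0 := by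
    refine integral_eq_zero_of_ae ?_
    filter_upwards [h3, h9] with θ h10 h11
    rw [direction_smul h4.1, norm_smul_usphere h4.1.le] at h11
    rw [radialDefect, h11, h10]
    simp
  rw [hE, hdef]
  simp

theorem exists_weissA_eq_const {α ρ R₀ : ℝ} (hα : 1 < α) (hρ : 0 < ρ) (hρR : ρ ≤ R₀)
    {u : EucSp n → ℝ} {G : EucSp n → EucSp n} (h : MemW12 (ball 0 R₀) u G)
    {T : ℝ → USphere n → ℝ} (hT : IsSphereTrace R₀ u T) (hu : IsAEHomogeneousOnBall α ρ u) :
    ∃ c : ℝ, ∀ R ∈ Ioo 0 ρ, weissA α G T R = c := by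
  have hz := (ae_restrict_iff' measurableSet_Ioo).mp
    (ae_hasDerivAt_weissA_zero hα hρ hρR h hT hu)
  have key : ∀ r R, 0 < r → r < R → R < ρ → weissA α G T r = weissA α G T R := by
    intro r R hr hrR hR
    have hac := absolutelyContinuousOnInterval_weissA (α := α) h hT hr hrR (hR.trans_le hρR)
    obtain ⟨c, hc⟩ := hac.const_of_ae_hasDerivAt_zero (by
      filter_upwards [hz] with x hx hxu
      rw [uIcc_of_le hrR.le] at hxu
      exact hx ⟨hr.trans_le hxu.1, hxu.2.trans_lt hR⟩)
    rw [hc r left_mem_uIcc, hc R right_mem_uIcc]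
  refine ⟨weissA α G T (ρ / 2), fun R hR => ?_⟩
  rcases lt_trichotomy R (ρ / 2) with hlt | heq | hgt
  · exact key _ _ hR.1 hlt (half_lt_self hρ)
  · rw [heq]
  · exact (key _ _ (half_pos hρ) hgt hR.2).symm

/-- Homogeneity in `B_R` makes the energy constant only for radii below `R`, so the derivative at
`R` has to be computed from the left. -/
theorem deriv_eq_zero_of_const_left {f : ℝ → ℝ} {a R c : ℝ} (ha : a < R)
    (hf : DifferentiableAt ℝ f R) (h : ∀ r ∈ Ioo a R, f r = c) : deriv f R = 0 := by
  have hR : f R = c := by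
    have h1 : Tendsto f (𝓝[<] R) (𝓝 (f R)) := hf.continuousAt.continuousWithinAt
    have h2 : Tendsto f (𝓝[<] R) (𝓝 c) := by
      refine tendsto_const_nhds.congr' ?_
      filter_upwards [Ioo_mem_nhdsLT ha] with r hr
      exact (h r hr).symm
    exact tendsto_nhds_unique h1 h2
  have h3 : HasDerivWithinAt f (deriv f R) (Iio R) R := hf.hasDerivAt.hasDerivWithinAt
  have h4 : HasDerivWithinAt f 0 (Iio R) R := by
    refine (hasDerivWithinAt_const R (Iio R) c).congr_of_eventuallyEq ?_ hR
    filter_upwards [Ioo_mem_nhdsLT ha] with r hr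
    exact h r hr
  exact (uniqueDiffWithinAt_Iio R).eq_deriv _ h3 h4

/-- For each `R < ρ` there is a radius in `(R, ρ)` at which the almost-everywhere implication is
available and the derivative is zero. Homogeneity in that larger ball restricts to `B_R`. -/
theorem isAEHomogeneousOnBall_of_weissA_const {n : ℕ} {α ρ R₀ c : ℝ} (hρ : 0 < ρ) (hρR : ρ ≤ R₀)
    {u : EucSp n → ℝ} {G : EucSp n → EucSp n} {T : ℝ → USphere n → ℝ}
    (h : ∀ᵐ R ∂volume.restrict (Ioo 0 R₀),
      deriv (weissA α G T) R = 0 → IsAEHomogeneousOnBall α R u)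
    (hc : ∀ R ∈ Ioo 0 ρ, weissA α G T R = c) : IsAEHomogeneousOnBall α ρ u := by
  refine isAEHomogeneousOnBall_of_forall_lt hρ fun R hR => ?_
  have hne : (ae (volume.restrict (Ioo R ρ))).NeBot := by
    rw [ae_neBot, Ne, Measure.restrict_eq_zero]
    simpa using hR.2
  obtain ⟨R', h1, h2⟩ := ((ae_restrict_of_ae_restrict_of_subset (Ioo_subset_Ioo hR.1.le hρR)
    h).and (ae_restrict_mem measurableSet_Ioo)).exists
  refine (h1 ?_).mono h2.1.le
  have hev : weissA α G T =ᶠ[𝓝 R'] fun _ => c := by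
    filter_upwards [isOpen_Ioo.mem_nhds (show R' ∈ Ioo 0 ρ from ⟨hR.1.trans h2.1, h2.2⟩)] with r hr
    exact hc r hr
  rw [hev.deriv_eq, deriv_const]

/-! ### Pointwise homogeneity of continuous functions -/

/-- For fixed `t ≤ 1` the relation `u(tx) = t^α u(x)` holds almost everywhere and both sides are
continuous, so it holds everywhere. As `v` is uncontrolled on a null set, the witness is rebuilt
from the values of `u` on the sphere of radius `ρ / 2`. -/
theorem isHomogeneousOnBall_iff {α ρ : ℝ} (hα : 0 < α) (hρ : 0 < ρ) {u : EucSp n → ℝ}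
    (hu : ContinuousOn u (ball 0 ρ)) :
    IsHomogeneousOnBall α ρ u ↔ IsAEHomogeneousOnBall α ρ u := by
  constructor
  · rintro ⟨v, hv, huv⟩
    exact ⟨v, hv, ae_restrict_of_forall_mem measurableSet_ball huv⟩
  rintro ⟨v, hv, huv⟩
  have key : ∀ t : ℝ, 0 < t → t ≤ 1 → EqOn (fun x => u (t • x)) (fun x => t ^ α * u x)
      (ball 0 ρ) := by
    intro t ht ht1
    have hmaps : MapsTo (fun x : EucSp n => t • x) (ball 0 ρ) (ball 0 ρ) := by
      intro x hx
      rw [mem_ball_zero_iff] at hx ⊢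
      rw [norm_smul, Real.norm_of_nonneg ht.le]
      exact (mul_le_of_le_one_left (norm_nonneg x) ht1).trans_lt hx
    refine Measure.eqOn_open_of_ae_eq (μ := volume) ?_ isOpen_ball
      (hu.comp (continuous_const_smul t).continuousOn hmaps) (continuousOn_const.mul hu)
    have huv' := (ae_restrict_iff' measurableSet_ball).mp huv
    rw [EventuallyEq, ae_restrict_iff' measurableSet_ball]
    filter_upwards [huv', ae_comp_const_smul ht.ne' huv'] with x h1 h2 hx
    rw [h1 hx, h2 (hmaps hx), hv t x ht]
  have hmem : ∀ θ : USphere n, (ρ / 2) • (θ : EucSp n) ∈ ball (0 : EucSp n) ρ := fun θ => by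
    rw [mem_ball_zero_iff, norm_smul_usphere (half_pos hρ).le]
    exact half_lt_self hρ
  refine ⟨_, isPosHomogeneous_homExt hα (half_pos hρ) (sphereRestrict u (ρ / 2)), fun x hx => ?_⟩
  rcases eq_or_ne x 0 with rfl | hx0
  -- At the origin the scaling relation reads `u(0) = 2^(-α) u(0)`, which forces the value zero.
  · have h0 := key (1 / 2) (by norm_num) (by norm_num) (mem_ball_self hρ)
    simp only [smul_zero] at h0
    have hlt : (1 / 2 : ℝ) ^ α < 1 := Real.rpow_lt_one (by norm_num) (by norm_num) hα
    have h1 : u 0 = 0 := by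
      have : (1 - (1 / 2 : ℝ) ^ α) * u 0 = 0 := by linarith
      exact (mul_eq_zero.mp this).resolve_left (by linarith)
    simp [homExt, Real.zero_rpow hα.ne', h1]
  · have hpos : 0 < ‖x‖ := norm_pos_iff.mpr hx0
    have hρ2 := half_pos hρ
    rw [homExt, sphereRestrict]
    rcases le_total ‖x‖ (ρ / 2) with hle | hle
    · have h1 := key (‖x‖ / (ρ / 2)) (by positivity) ((div_le_one hρ2).mpr hle)
        (hmem (direction x))
      simp only [smul_smul, div_mul_cancel₀ _ hρ2.ne', norm_smul_direction] at h1
      exact h1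
    · have h1 := key (ρ / 2 / ‖x‖) (by positivity) ((div_le_one hpos).mpr hle) hx
      have e : (ρ / 2 / ‖x‖) • x = (ρ / 2) • (direction x : EucSp n) := by
        rw [coe_direction hx0, smul_smul, div_eq_mul_inv]
      simp only [e] at h1
      rw [h1, ← mul_assoc, ← Real.mul_rpow (by positivity) (by positivity),
        div_mul_div_cancel₀ hρ2.ne', div_self hpos.ne', Real.one_rpow, one_mul]

end

section

variable {n : ℕ}

/-! ### Functions of class `C¹` -/

/-- The gradient may be unbounded near the boundary of the open ball; a cutoff reduces local
statements to globally Lipschitz functions. -/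
theorem exists_contDiff_eqOn_ball {R R₀ : ℝ} (hR : R ∈ Ioo 0 R₀) {u : EucSp n → ℝ}
    (hu : ContDiffOn ℝ 1 u (ball 0 R₀)) :
    ∃ f : EucSp n → ℝ, ContDiff ℝ 1 f ∧ HasCompactSupport f ∧ EqOn f u (ball 0 R) := by
  obtain ⟨r, hr1, hr2⟩ := exists_between hR.2
  let χ : ContDiffBump (0 : EucSp n) := ⟨R, r, hR.1, hr1⟩
  have hχ : ContDiff ℝ 1 χ := χ.contDiff
  refine ⟨fun x => χ x * u x, ?_, χ.hasCompactSupport.mul_right, fun x hx => ?_⟩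
  · rw [contDiff_iff_contDiffAt]
    intro x
    by_cases hx : x ∈ ball (0 : EucSp n) R₀
    · exact hχ.contDiffAt.mul (hu.contDiffAt (isOpen_ball.mem_nhds hx))
    · have hxt : x ∉ tsupport χ := by
        rw [χ.tsupport_eq]
        exact fun h => hx (closedBall_subset_ball hr2 h)
      refine (contDiffAt_const (c := (0 : ℝ))).congr_of_eventuallyEq ?_
      filter_upwards [(isClosed_tsupport χ).isOpen_compl.mem_nhds hxt] with y hy
      rw [image_eq_zero_of_notMem_tsupport hy, zero_mul]
  · simp only
    rw [χ.one_of_mem_closedBall (ball_subset_closedBall hx), one_mul]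

theorem gradient_eqOn_ball {R : ℝ} {f u : EucSp n → ℝ} (h : EqOn f u (ball 0 R)) :
    EqOn (∇ f) (∇ u) (ball 0 R) := fun _ hx =>
  Filter.EventuallyEq.gradient_eq (h.eventuallyEq_of_mem (isOpen_ball.mem_nhds hx))

theorem MemW12.grad_ae_eq_gradient {R₀ : ℝ} (hR₀ : 0 < R₀) {u : EucSp n → ℝ}
    {G : EucSp n → EucSp n} (h : MemW12 (ball 0 R₀) u G) (hu : ContDiffOn ℝ 1 u (ball 0 R₀)) :
    ∀ᵐ x ∂volume.restrict (ball 0 R₀), G x = ∇ u x := by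
  refine ae_ball_of_forall_lt hR₀ fun R hR => ?_
  obtain ⟨f, hf, hc, hfu⟩ := exists_contDiff_eqOn_ball hR hu
  obtain ⟨C, hC⟩ := hf.lipschitzWith_of_hasCompactSupport hc one_ne_zero
  have h1 := (hC.memW12_univ hc).mono (subset_univ (ball 0 R)) MeasurableSet.univ
  have h2 := h.mono (ball_subset_ball hR.2.le) measurableSet_ball
  filter_upwards [h2.grad_ae_eq isOpen_ball h1
    (ae_restrict_of_forall_mem measurableSet_ball fun x hx => (hfu hx).symm),
    ae_restrict_mem measurableSet_ball] with x h3 h4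
  rw [h3, gradient_eqOn_ball hfu h4]

theorem LipschitzWith.isSphereTrace {f : EucSp n → ℝ} {C : NNReal} (hf : LipschitzWith C f)
    (R₀ : ℝ) : IsSphereTrace R₀ f (sphereRestrict f) := by
  have hcont : ∀ R : ℝ, Continuous (sphereRestrict f R) := fun R =>
    hf.continuous.comp (continuous_subtype_val.const_smul R)
  have : IsFiniteMeasure (sphereMeasure n) := by unfold sphereMeasure; infer_instance
  refine ⟨fun R _ => (hcont R).memLp_of_hasCompactSupport (HasCompactSupport.of_compactSpace _),
    .of_forall fun R => .of_forall fun θ => rfl, fun R _ => ?_⟩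
  have hb : ∀ r : ℝ, eLpNorm (fun θ => sphereRestrict f r θ - sphereRestrict f R θ) 2
      (sphereMeasure n) ≤ sphereMeasure n univ ^ (2 : ENNReal).toReal⁻¹ *
        ENNReal.ofReal (C * |r - R|) := by
    intro r
    refine eLpNorm_le_of_ae_bound (.of_forall fun θ => ?_)
    refine (hf.norm_sub_le _ _).trans (le_of_eq ?_)
    rw [← sub_smul, norm_smul, norm_usphere, mul_one, Real.norm_eq_abs]
  refine tendsto_of_tendsto_of_tendsto_of_le_of_le tendsto_const_nhds ?_ (fun _ => zero_le) hb
  have h1 : Tendsto (fun r : ℝ => ENNReal.ofReal (C * |r - R|)) (𝓝 R) (𝓝 0) := by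
    have : Continuous fun r : ℝ => ENNReal.ofReal (C * |r - R|) :=
      ENNReal.continuous_ofReal.comp (by fun_prop)
    simpa using this.tendsto R
  have h2 := ENNReal.Tendsto.const_mul (a := sphereMeasure n univ ^ (2 : ENNReal).toReal⁻¹) h1
    (Or.inr (ENNReal.rpow_ne_top_of_nonneg (by positivity) (measure_ne_top _ _)))
  simpa using h2

theorem ContDiffOn.isSphereTrace {R₀ : ℝ} {u : EucSp n → ℝ} (hu : ContDiffOn ℝ 1 u (ball 0 R₀)) :
    IsSphereTrace R₀ u (sphereRestrict u) := by
  have hloc : ∀ R ∈ Ioo 0 R₀, ∃ f : EucSp n → ℝ, IsSphereTrace R₀ f (sphereRestrict f) ∧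
      ∀ᶠ r in 𝓝 R, sphereRestrict u r = sphereRestrict f r := by
    intro R hR
    obtain ⟨R', h1, h2⟩ := exists_between hR.2
    obtain ⟨f, hf, hc, hfu⟩ := exists_contDiff_eqOn_ball ⟨hR.1.trans h1, h2⟩ hu
    obtain ⟨C, hC⟩ := hf.lipschitzWith_of_hasCompactSupport hc one_ne_zero
    refine ⟨f, hC.isSphereTrace R₀, ?_⟩
    filter_upwards [isOpen_Ioo.mem_nhds (show R ∈ Ioo 0 R' from ⟨hR.1, h1⟩)] with r hr
    ext1 θ
    refine (hfu ?_).symm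
    rw [mem_ball_zero_iff, norm_smul_usphere hr.1.le]
    exact hr.2
  refine ⟨fun R hR => ?_, .of_forall fun R => .of_forall fun θ => rfl, fun R hR => ?_⟩
  · obtain ⟨f, hf, hev⟩ := hloc R hR
    rw [hev.self_of_nhds]
    exact hf.memLp R hR
  · obtain ⟨f, hf, hev⟩ := hloc R hR
    refine (hf.cont R hR).congr' ?_
    filter_upwards [hev] with r hr
    rw [hr, hev.self_of_nhds]

theorem hasDerivAt_of_sub_eq_integral {f g : ℝ → ℝ} {R₀ R : ℝ} (hR : R ∈ Ioo 0 R₀)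
    (hg : Continuous g) (h : ∀ r ∈ Ioo 0 R₀, ∀ s ∈ Ioo 0 R₀, f s - f r = ∫ t in r..s, g t) :
    HasDerivAt f (g R) R := by
  refine ((hg.integral_hasStrictDerivAt R R).hasDerivAt.const_add (f R)).congr_of_eventuallyEq ?_
  filter_upwards [isOpen_Ioo.mem_nhds hR] with x hx
  rw [← h R hR x hx]
  ring

theorem continuous_sphere_integral {f : EucSp n × USphere n → ℝ} (hf : Continuous f) :
    Continuous fun t : ℝ => ∫ θ : USphere n, f (t • (θ : EucSp n), θ) ∂sphereMeasure n := by
  have : IsFiniteMeasure (sphereMeasure n) := by unfold sphereMeasure; infer_instance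
  have h := continuous_parametric_integral_of_continuous (μ := sphereMeasure n)
    (f := fun (t : ℝ) (θ : USphere n) => f (t • (θ : EucSp n), θ))
    (by simp only [Function.uncurry_def]; fun_prop) (isCompact_univ (X := USphere n))
  simpa using h

end

section

variable {n : ℕ} [NeZero n]

theorem hasDerivAt_of_contDiff {f : EucSp n → ℝ} (hf : ContDiff ℝ 1 f) (hc : HasCompactSupport f)
    {R : ℝ} (hR : 0 < R) :
    HasDerivAt (fun r => ∫ x in ball (0 : EucSp n) r, ‖∇ f x‖ ^ 2)
      (R ^ (n - 1) * ∫ θ : USphere n, ‖∇ f (R • (θ : EucSp n))‖ ^ 2 ∂sphereMeasure n) R ∧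
    HasDerivAt (fun r => ∫ θ, sphereRestrict f r θ ^ 2 ∂sphereMeasure n)
      (sphereFlux f (∇ f) R) R := by
  obtain ⟨C, hC⟩ := hf.lipschitzWith_of_hasCompactSupport hc one_ne_zero
  have h := (hC.memW12_univ hc).mono (subset_univ (ball 0 (R + 1))) MeasurableSet.univ
  have hG : IntegrableOn (fun x => ‖∇ f x‖ ^ 2) (ball 0 (R + 1)) :=
    h.memLp_grad.integrable_norm_pow (by norm_num)
  have hmem : R ∈ Ioo 0 (R + 1) := ⟨hR, lt_add_one R⟩
  have hcg : Continuous (∇ f) := continuous_gradient hf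
  have hcf : Continuous f := hf.continuous
  constructor
  · refine hasDerivAt_of_sub_eq_integral hmem
      (g := fun t => t ^ (n - 1) * ∫ θ : USphere n, ‖∇ f (t • (θ : EucSp n))‖ ^ 2 ∂sphereMeasure n)
      ?_ fun r hr s hs => integral_ball_sub hG hr hs
    exact (continuous_pow (n - 1)).mul (continuous_sphere_integral
      (f := fun p => ‖∇ f p.1‖ ^ 2) (by fun_prop))
  · refine hasDerivAt_of_sub_eq_integral hmem ?_ fun r hr s hs =>
      (hC.isSphereTrace (R + 1)).integral_sq_sub h hr hs
    exact continuous_sphere_integral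
      (f := fun p => 2 * (f p.1 * inner ℝ (∇ f p.1) (p.2 : EucSp n))) (by fun_prop)

theorem hasDerivAt_of_contDiffOn {R R₀ : ℝ} (hR : R ∈ Ioo 0 R₀) {u : EucSp n → ℝ}
    (hu : ContDiffOn ℝ 1 u (ball 0 R₀)) :
    HasDerivAt (fun r => ∫ x in ball (0 : EucSp n) r, ‖∇ u x‖ ^ 2)
      (R ^ (n - 1) * ∫ θ : USphere n, ‖∇ u (R • (θ : EucSp n))‖ ^ 2 ∂sphereMeasure n) R ∧
    HasDerivAt (fun r => ∫ θ, sphereRestrict u r θ ^ 2 ∂sphereMeasure n)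
      (sphereFlux u (∇ u) R) R := by
  obtain ⟨R', h1, h2⟩ := exists_between hR.2
  obtain ⟨f, hf, hc, hfu⟩ := exists_contDiff_eqOn_ball ⟨hR.1.trans h1, h2⟩ hu
  have hgu := gradient_eqOn_ball hfu
  have hmem : ∀ r ∈ Ioo 0 R', ∀ θ : USphere n, r • (θ : EucSp n) ∈ ball (0 : EucSp n) R' := by
    intro r hr θ
    rw [mem_ball_zero_iff, norm_smul_usphere hr.1.le]
    exact hr.2
  have hRR : R ∈ Ioo 0 R' := ⟨hR.1, h1⟩
  obtain ⟨d1, d2⟩ := hasDerivAt_of_contDiff hf hc hR.1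
  constructor
  · simp_rw [hgu (hmem R hRR _)] at d1
    refine d1.congr_of_eventuallyEq ?_
    filter_upwards [isOpen_Ioo.mem_nhds hRR] with r hr
    refine setIntegral_congr_fun measurableSet_ball fun x hx => ?_
    rw [hgu (ball_subset_ball hr.2.le hx)]
  · have e : sphereFlux f (∇ f) R = sphereFlux u (∇ u) R := by
      simp_rw [sphereFlux, hgu (hmem R hRR _), hfu (hmem R hRR _)]
    rw [e] at d2
    refine d2.congr_of_eventuallyEq ?_
    filter_upwards [isOpen_Ioo.mem_nhds hRR] with r hr
    simp_rw [sphereRestrict, hfu (hmem r hr _)]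

end

/-! ### Independence of representatives -/

section

variable {n : ℕ}

theorem IsObstacleMinimizer.congr_grad {Ω : Set (EucSp n)} {g φ u : EucSp n → ℝ}
    {G H : EucSp n → EucSp n} (h : IsObstacleMinimizer Ω g φ u G)
    (hGH : G =ᵐ[volume.restrict Ω] H) : IsObstacleMinimizer Ω g φ u H := by
  have ha := h.admissible
  refine ⟨⟨⟨ha.memW12.memLp, (memLp_congr_ae hGH).mp ha.memW12.memLp_grad, fun ψ hψ => ?_⟩,
    ha.boundary, ha.above⟩, fun w K hw => ?_⟩
  · rw [ha.memW12.weak ψ hψ]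
    congr 1
    refine integral_congr_ae ?_
    filter_upwards [hGH] with x hx
    rw [hx]
  · refine le_trans (le_of_eq ?_) (h.minimal w K hw)
    refine integral_congr_ae ?_
    filter_upwards [hGH] with x hx
    rw [hx]

/-- The inequality is the equation `max φ u = u` between continuous functions, which extends from
almost every point to every point of an open set. -/
theorem forall_le_of_ae_le {U : Set (EucSp n)} (hU : IsOpen U) {φ u : EucSp n → ℝ}
    (hφ : ContinuousOn φ U) (hu : ContinuousOn u U)
    (h : ∀ᵐ x ∂volume.restrict U, φ x ≤ u x) : ∀ x ∈ U, φ x ≤ u x := by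
  have he : EqOn (fun x => max (φ x) (u x)) u U := by
    refine Measure.eqOn_open_of_ae_eq (μ := volume) ?_ hU (hφ.sup hu) hu
    filter_upwards [h] with x hx
    exact max_eq_right hx
  intro x hx
  exact max_eq_right_iff.mp (he hx)

theorem weissA_congr_grad {α R : ℝ} {G H : EucSp n → EucSp n} (h : EqOn G H (ball 0 R))
    (T : ℝ → USphere n → ℝ) : weissA α G T R = weissA α H T R := by
  have e : ∫ x in ball (0 : EucSp n) R, ‖G x‖ ^ 2 = ∫ x in ball (0 : EucSp n) R, ‖H x‖ ^ 2 :=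
    setIntegral_congr_fun measurableSet_ball fun x hx => by rw [h hx]
  rw [weissA, weissA, e]

end

/-! ### Conclusions for Sobolev and for `C¹` minimizers -/

section

variable {n : ℕ} [NeZero n]

/-- The properties of the Weiss energy of a solution of the obstacle problem. -/
theorem weissA_spec {α R₀ : ℝ} (hα : 1 < α) {Ω : Set (EucSp n)}
    (hΩ : IsOpen Ω) (hball : ball 0 R₀ ⊆ Ω) {g φ u : EucSp n → ℝ} {G : EucSp n → EucSp n}
    (hu : IsObstacleMinimizer Ω g φ u G)
    (hφ : ∀ R ∈ Ioo 0 R₀, ∀ x : EucSp n, x ≠ 0 → ‖x‖ ≤ R →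
      φ x ≤ (‖x‖ / R) ^ α * φ ((R / ‖x‖) • x))
    {T : ℝ → USphere n → ℝ} (hT : IsSphereTrace R₀ u T) :
    MonotoneOn (weissA α G T) (Ioo 0 R₀) ∧
    (∀ a b : ℝ, 0 < a → a < b → b < R₀ → AbsolutelyContinuousOnInterval (weissA α G T) a b) ∧
    (∀ᵐ R ∂volume.restrict (Ioo 0 R₀), DifferentiableAt ℝ (weissA α G T) R ∧
      Integrable (radialDefect α G T R) (sphereMeasure n) ∧
      R ^ (-(1 + 2 * (α - 1))) * (∫ θ, radialDefect α G T R θ ∂(sphereMeasure n))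
        ≤ deriv (weissA α G T) R ∧
      (deriv (weissA α G T) R = 0 ↔ IsAEHomogeneousOnBall α R u)) ∧
    (∀ ρ ∈ Ioc 0 R₀, (∃ c : ℝ, ∀ R ∈ Ioo 0 ρ, weissA α G T R = c) ↔
      IsAEHomogeneousOnBall α ρ u) := by
  have h : MemW12 (ball 0 R₀) u G := hu.admissible.memW12.mono hball hΩ.measurableSet
  have hspec := ae_weissA_deriv_spec hα hΩ hball hu hφ hT
  have hac : ∀ a b : ℝ, 0 < a → a < b → b < R₀ →
      AbsolutelyContinuousOnInterval (weissA α G T) a b := fun a b ha hab hb =>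
    absolutelyContinuousOnInterval_weissA h hT ha hab hb
  refine ⟨monotoneOn_of_absolutelyContinuousOnInterval hac ?_, hac, ?_, fun ρ hρ => ⟨?_, ?_⟩⟩
  · filter_upwards [hspec, ae_restrict_mem measurableSet_Ioo] with R h1 h2
    exact deriv_weissA_nonneg h2.1 h1.2.2.1
  · filter_upwards [hspec, ae_restrict_mem measurableSet_Ioo] with R h1 h2
    refine ⟨h1.1, h1.2.1, h1.2.2.1, h1.2.2.2, fun h3 => ?_⟩
    obtain ⟨c, hc⟩ := exists_weissA_eq_const hα h2.1 h2.2.le h hT h3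
    exact deriv_eq_zero_of_const_left h2.1 h1.1 hc
  · rintro ⟨c, hc⟩
    exact isAEHomogeneousOnBall_of_weissA_const hρ.1 hρ.2 (hspec.mono fun R h => h.2.2.2) hc
  · exact exists_weissA_eq_const hα hρ.1 hρ.2 h hT

/-- The properties of the Weiss energy of a continuously differentiable solution of the obstacle
problem. -/
theorem weissA_spec_of_contDiffOn {α R₀ : ℝ} (hα : 1 < α) (hR₀ : 0 < R₀) {Ω : Set (EucSp n)}
    (hΩ : IsOpen Ω) (hball : ball 0 R₀ ⊆ Ω) {g φ u : EucSp n → ℝ} {G : EucSp n → EucSp n}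
    (hu : IsObstacleMinimizer Ω g φ u G)
    (hφ : ∀ R ∈ Ioo 0 R₀, ∀ x : EucSp n, x ≠ 0 → ‖x‖ ≤ R →
      φ x ≤ (‖x‖ / R) ^ α * φ ((R / ‖x‖) • x))
    (hφc : ContinuousOn φ Ω) (huc : ContDiffOn ℝ 1 u (ball 0 R₀)) :
    MonotoneOn (weissA α (∇ u) (sphereRestrict u)) (Ioo 0 R₀) ∧
    (∀ R ∈ Ioo 0 R₀, DifferentiableAt ℝ (weissA α (∇ u) (sphereRestrict u)) R ∧
      Integrable (radialDefect α (∇ u) (sphereRestrict u) R) (sphereMeasure n) ∧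
      R ^ (-(1 + 2 * (α - 1))) *
          (∫ θ, radialDefect α (∇ u) (sphereRestrict u) R θ ∂(sphereMeasure n))
        ≤ deriv (weissA α (∇ u) (sphereRestrict u)) R ∧
      (deriv (weissA α (∇ u) (sphereRestrict u)) R = 0 ↔ IsHomogeneousOnBall α R u)) ∧
    (∀ ρ ∈ Ioc 0 R₀, (∃ c : ℝ, ∀ R ∈ Ioo 0 ρ, weissA α (∇ u) (sphereRestrict u) R = c) ↔
      IsHomogeneousOnBall α ρ u) := by
  classical
  have h : MemW12 (ball 0 R₀) u G := hu.admissible.memW12.mono hball hΩ.measurableSet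
  -- Since `u` is `C¹` only in the ball, the pointwise gradient replaces `G` there and nowhere else.
  -- The result is still a weak gradient of `u` on `Ω`.
  set G' : EucSp n → EucSp n := (ball (0 : EucSp n) R₀).piecewise (∇ u) G with hG'
  have hon : EqOn G' (∇ u) (ball 0 R₀) := piecewise_eqOn _ _ _
  have hGG : G =ᵐ[volume.restrict Ω] G' := by
    refine ae_restrict_of_ae ?_
    filter_upwards [(ae_restrict_iff' measurableSet_ball).mp (h.grad_ae_eq_gradient hR₀ huc)]
      with x hx
    by_cases hxb : x ∈ ball (0 : EucSp n) R₀
    · rw [hon hxb, hx hxb]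
    · exact (piecewise_eq_of_notMem _ _ _ hxb).symm
  have hu' := hu.congr_grad hGG
  have hT := huc.isSphereTrace
  have hcont : ContinuousOn u (ball 0 R₀) := huc.continuousOn
  have hA : ∀ R ∈ Ioo 0 R₀, weissA α G' (sphereRestrict u) R =
      weissA α (∇ u) (sphereRestrict u) R := fun R hR =>
    weissA_congr_grad (hon.mono (ball_subset_ball hR.2.le)) _
  have hmem : ∀ R ∈ Ioo 0 R₀, ∀ θ : USphere n, R • (θ : EucSp n) ∈ ball (0 : EucSp n) R₀ := by
    intro R hR θ
    rw [mem_ball_zero_iff, norm_smul_usphere hR.1.le]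
    exact hR.2
  have hle := forall_le_of_ae_le isOpen_ball (hφc.mono hball) hcont
    (ae_restrict_of_ae_restrict_of_subset hball hu.admissible.above)
  obtain ⟨s1, -, -, s4⟩ := weissA_spec hα hΩ hball hu' hφ hT
  refine ⟨s1.congr hA, fun R hR => ?_, fun ρ hρ => ?_⟩
  · have hev : weissA α (∇ u) (sphereRestrict u) =ᶠ[𝓝 R] weissA α G' (sphereRestrict u) := by
      filter_upwards [isOpen_Ioo.mem_nhds hR] with r hr
      exact (hA r hr).symm
    have hrad : radialDefect α G' (sphereRestrict u) R =
        radialDefect α (∇ u) (sphereRestrict u) R := by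
      ext1 θ
      rw [radialDefect, radialDefect, hon (hmem R hR θ)]
    have hrepl : replGrad α R u G' = replGrad α R u (∇ u) := by
      have e : (fun θ : USphere n => G' (R • (θ : EucSp n))) =
          fun θ : USphere n => ∇ u (R • (θ : EucSp n)) := funext fun θ => hon (hmem R hR θ)
      rw [replGrad, replGrad, e]
      exact indicator_congr fun x hx => by rw [hon (ball_subset_ball hR.2.le hx)]
    have hcl : closedBall (0 : EucSp n) R ⊆ ball 0 R₀ := closedBall_subset_ball hR.2
    have hW : W0Pair Ω (replDiff α R u) (replGrad α R u G') := by
      rw [hrepl]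
      exact w0Pair_repl_of_contDiffOn hα hR.1 hR.2 huc hΩ (hcl.trans hball)
    have hW' : W0Pair univ (replDiff α R u) (replGrad α R u G') := by
      rw [hrepl]
      exact w0Pair_repl_of_contDiffOn hα hR.1 hR.2 huc isOpen_univ (subset_univ _)
    obtain ⟨d1, d2⟩ := hasDerivAt_of_contDiffOn hR huc
    have hgc : Continuous fun θ : USphere n => G' (R • (θ : EucSp n)) := by
      have hgr : ContinuousOn (∇ u) (ball 0 R₀) :=
        (LinearIsometryEquiv.continuous _).comp_continuousOn
          (huc.continuousOn_fderiv_of_isOpen isOpen_ball le_rfl)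
      exact (hgr.congr hon).comp_continuous (continuous_subtype_val.const_smul R) (hmem R hR)
    have hfin : IsFiniteMeasure (sphereMeasure n) := by unfold sphereMeasure; infer_instance
    have hF : MemLp (fun θ : USphere n => G' (R • (θ : EucSp n))) 2 (sphereMeasure n) :=
      hgc.memLp_of_hasCompactSupport (HasCompactSupport.of_compactSpace _)
    have hD : HasDerivAt (fun r => ∫ x in ball (0 : EucSp n) r, ‖G' x‖ ^ 2)
        (R ^ (n - 1) * ∫ θ : USphere n, ‖G' (R • (θ : EucSp n))‖ ^ 2 ∂sphereMeasure n) R := by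
      simp_rw [hon (hmem R hR _)]
      refine d1.congr_of_eventuallyEq ?_
      filter_upwards [isOpen_Ioo.mem_nhds hR] with r hr
      refine setIntegral_congr_fun measurableSet_ball fun x hx => ?_
      rw [hon (ball_subset_ball hr.2.le hx)]
    have hH : HasDerivAt (fun r => ∫ θ, sphereRestrict u r θ ^ 2 ∂sphereMeasure n)
        (sphereFlux u G' R) R := by
      have e : sphereFlux u G' R = sphereFlux u (∇ u) R := by
        simp_rw [sphereFlux, hon (hmem R hR _)]
      rw [e]
      exact d2
    have hspec := weissA_deriv_spec hα hR.1 hΩ.measurableSet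
      ((ball_subset_ball hR.2.le).trans hball) hu' hW hW' (hφ R hR)
      (.of_forall fun θ => hle _ (hmem R hR θ)) (hT.memLp R hR) hF (ae_eq_refl _) hD hH
    rw [hrad, ← hev.deriv_eq] at hspec
    have hiff := isHomogeneousOnBall_iff (by linarith : 0 < α) hR.1
      (hcont.mono (ball_subset_ball hR.2.le))
    have hdiff := hev.differentiableAt_iff.mpr hspec.1
    refine ⟨hdiff, hspec.2.1, hspec.2.2.1, fun h0 => hiff.mpr (hspec.2.2.2 h0), fun hh => ?_⟩
    -- The criterion for constancy is used with `ρ = R`; differentiability at `R` itself is already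
    -- known.
    obtain ⟨c, hc⟩ := (s4 R ⟨hR.1, hR.2.le⟩).mpr (hiff.mp hh)
    exact deriv_eq_zero_of_const_left hR.1 hdiff fun r hr =>
      (hA r ⟨hr.1, hr.2.trans hR.2⟩).symm.trans (hc r hr)
  · rw [isHomogeneousOnBall_iff (by linarith : 0 < α) hρ.1 (hcont.mono (ball_subset_ball hρ.2)),
      ← s4 ρ hρ]
    refine exists_congr fun c => forall₂_congr fun R hR => ?_
    rw [hA R ⟨hR.1, hR.2.trans_le hρ.2⟩]

end

end

theorem lemma1 (n : ℕ) (hn : 1 ≤ n) (β : ℝ) (hβ₀ : 0 < β) (hβ₁ : β ≤ 1)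
    (Ω : Set (EucSp n)) (hΩ : IsOpen Ω) (hΩb : Bornology.IsBounded Ω)
    (g φ u : EucSp n → ℝ) (G : EucSp n → EucSp n)
    (hg : ∃ Dg : EucSp n → EucSp n, MemW12 Ω g Dg)
    (hφ : IsC1Holder β Ω φ) (hφ₀ : φ 0 = 0) (hφ₁ : ∇ φ 0 = 0)
    (hu : IsObstacleMinimizer Ω g φ u G)
    (R₀ : ℝ) (hR₀ : 0 < R₀) (hball : ball (0 : EucSp n) R₀ ⊆ Ω)
    (hφR : ∀ R ∈ Ioo 0 R₀, ∀ x : EucSp n, x ≠ 0 → ‖x‖ ≤ R →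
      φ x ≤ (‖x‖ / R) ^ (1 + β) * φ ((R / ‖x‖) • x)) :
    -- traces on spheres exist
    (∃ T : ℝ → USphere n → ℝ, IsSphereTrace R₀ u T) ∧
    -- the statement for the minimizer, with its weak gradient and its traces
    (∀ T : ℝ → USphere n → ℝ, IsSphereTrace R₀ u T →
      MonotoneOn (weissA (1 + β) G T) (Ioo 0 R₀) ∧
      (∀ a b : ℝ, 0 < a → a < b → b < R₀ →
        AbsolutelyContinuousOnInterval (weissA (1 + β) G T) a b) ∧
      (∀ᵐ R ∂(volume.restrict (Ioo 0 R₀)),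
        DifferentiableAt ℝ (weissA (1 + β) G T) R ∧
        Integrable (radialDefect (1 + β) G T R) (sphereMeasure n) ∧
        R ^ (-(1 + 2 * ((1 + β) - 1))) * (∫ θ, radialDefect (1 + β) G T R θ ∂(sphereMeasure n))
          ≤ deriv (weissA (1 + β) G T) R ∧
        (deriv (weissA (1 + β) G T) R = 0 ↔ IsAEHomogeneousOnBall (1 + β) R u)) ∧
      (∀ ρ ∈ Ioc 0 R₀,
        (∃ c : ℝ, ∀ R ∈ Ioo 0 ρ, weissA (1 + β) G T R = c) ↔
          IsAEHomogeneousOnBall (1 + β) ρ u)) ∧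
    -- where the minimizer is continuously differentiable, the same holds at every radius
    (ContDiffOn ℝ 1 u (ball (0 : EucSp n) R₀) →
      MonotoneOn (weissA (1 + β) (∇ u) (sphereRestrict u)) (Ioo 0 R₀) ∧
      (∀ R ∈ Ioo 0 R₀,
        DifferentiableAt ℝ (weissA (1 + β) (∇ u) (sphereRestrict u)) R ∧
        Integrable (radialDefect (1 + β) (∇ u) (sphereRestrict u) R) (sphereMeasure n) ∧
        R ^ (-(1 + 2 * ((1 + β) - 1))) *
            (∫ θ, radialDefect (1 + β) (∇ u) (sphereRestrict u) R θ ∂(sphereMeasure n))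
          ≤ deriv (weissA (1 + β) (∇ u) (sphereRestrict u)) R ∧
        (deriv (weissA (1 + β) (∇ u) (sphereRestrict u)) R = 0 ↔
          IsHomogeneousOnBall (1 + β) R u)) ∧
      (∀ ρ ∈ Ioc 0 R₀,
        (∃ c : ℝ, ∀ R ∈ Ioo 0 ρ, weissA (1 + β) (∇ u) (sphereRestrict u) R = c) ↔
          IsHomogeneousOnBall (1 + β) ρ u)) := by
  have : NeZero n := ⟨by omega⟩
  have hα : 1 < 1 + β := by linarith
  refine ⟨exists_isSphereTrace hR₀ (hu.admissible.memW12.mono hball hΩ.measurableSet),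
    fun T hT => weissA_spec hα hΩ hball hu hφR hT, fun huc =>
    weissA_spec_of_contDiffOn hα hR₀ hΩ hball hu hφR
      (fun x hx => (hφ.1 x hx).continuousAt.continuousWithinAt) huc⟩
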